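/- Let $(M,g)$ be a hyper-Hermitian quaternionic Kähler (hHqK) manifold of dimension $4n$, $n\ge 1$: a smooth Riemannian manifold with integrable almost complex structures $I,J,K$ (a hypercomplex structure), orthogonal with respect to $g$ and satisfying $I^2=J^2=K^2=IJK=-1$, such that the bundle $\mathrm{span}\{I,J,K\}\subset \mathrm{End}(TM)$ is quaternionic Kähler with non-zero scalar curvature. Here quaternionic Kähler means that this bundle is parallel for the Levi-Civita connection $\nabla$ and, if $n=1$, that moreover $g$ is Einstein and its Weyl tensor has no component in $\mathrm{span}\{I,J,K\}$ (half conformal flatness, i.e. self-duality for the appropriate orientation). Let $s$ be the (constant) scalar curvature, let $\nu=\frac{s}{4n(n+2)}$ be the reduced scalar curvature, and let $\varphi$ be the Lee form, $\varphi(X)=\frac12\,\mathrm{trace}\,(Y\mapsto I(\nabla_Y I)X)$. Assume that $d\varphi=0$, $\nu<0$ and $|\varphi|^2+\nu=0$. Then $(M,g)$ is locally isometric to one of the following Riemannian manifolds (with the same $\nu$): every point of $M$ has an open neighbourhood which is isometric to an open subset of $$\{(t,u,v,w)\in\mathbb{R}^4 : t>0\}\times M'$$ with the metric $$-\frac{1}{\nu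 t^2}\Bigl(dt^2+(-du+\nu\,\pi^*\alpha_{I'})^2+(-dv+\nu\,\pi^*\alpha_{J'})^2+(-dw+\nu\,\pi^*\alpha_{K'})^2\Bigr)+\frac1t\,\pi^*g',$$ where $(M',g',I',J',K')$ is a hyper-Kähler manifold of dimension $4(n-1)$, which can be taken to be an open subset of $\mathbb{R}^{4(n-1)}$ with a smooth hyper-Kähler structure, $\pi$ is the projection onto $M'$, and $\alpha_{I'},\alpha_{J'},\alpha_{K'}$ are smooth 1-forms on $M'$ with $d\alpha_{A}=\Omega_{A}$, $\Omega_A(X,Y)=g'(AX,Y)$, for $A=I',J',K'$. -/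

import Mathlib

open scoped Manifold ContDiff Bundle

noncomputable section

set_option maxSynthPendingDepth 3

namespace HHqK

/-! ### Linear algebra -/

/-- `(b, I, J, K)` is a hyper-Hermitian structure on the real vector space `V` with scalar product
`b`: the endomorphisms satisfy `I² = J² = K² = -1 = IJK` and are orthogonal with respect to `b`. -/
structure IsHyperHermitianTriple {V : Type*} [AddCommGroup V] [Module ℝ V] [TopologicalSpace V]
    (b : V →L[ℝ] V →L[ℝ] ℝ) (I J K : V →L[ℝ] V) : Prop where
  I_sq : ∀ v, I (I v) = -v
  J_sq : ∀ v, J (J v) = -v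
  K_sq : ∀ v, K (K v) = -v
  IJK : ∀ v, I (J (K v)) = -v
  orthogonal_I : ∀ u v, b (I u) (I v) = b u v
  orthogonal_J : ∀ u v, b (J u) (J v) = b u v
  orthogonal_K : ∀ u v, b (K u) (K v) = b u v

/-! ### Riemannian geometry on an open set of a finite-dimensional vector space

A tensor field is a function on the vector space `E`; every notion below depends only on the germ
of the fields at the point where it is evaluated. -/

/-- `koszul g x u v w = ½ (D_u g (v, w) + D_v g (u, w) - D_w g (u, v))` at `x`, the Christoffel
symbol of the first kind of the metric `g`; see `koszul_apply`. -/
def koszul {E : Type*} [NormedAddCommGroup E] [NormedSpace ℝ E]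
    (g : E → E →L[ℝ] E →L[ℝ] ℝ) (x : E) : E →L[ℝ] E →L[ℝ] E →L[ℝ] ℝ :=
  (1 / 2 : ℝ) • (fderiv ℝ g x + (fderiv ℝ g x).flip
    - ContinuousLinearMap.comp
        (ContinuousLinearMap.flipₗᵢ ℝ E E ℝ : (E →L[ℝ] E →L[ℝ] ℝ) →L[ℝ] (E →L[ℝ] E →L[ℝ] ℝ))
        (fderiv ℝ g x).flip)

theorem koszul_apply {E : Type*} [NormedAddCommGroup E] [NormedSpace ℝ E]
    (g : E → E →L[ℝ] E →L[ℝ] ℝ) (x u v w : E) :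
    koszul g x u v w =
      1 / 2 * (fderiv ℝ g x u v w + fderiv ℝ g x v u w - fderiv ℝ g x w u v) := rfl

/-- The Christoffel symbol of the second kind, `Γ_x (u, v)`, of the metric `g`: the vector with
`g (Γ (u, v), w) = koszul (u, v, w)` for all `w`. The Levi-Civita connection of `g` is
`∇_u Y = D_u Y + Γ (u, Y)`. -/
def christoffel {E : Type*} [NormedAddCommGroup E] [NormedSpace ℝ E]
    (g : E → E →L[ℝ] E →L[ℝ] ℝ) (x : E) : E →L[ℝ] E →L[ℝ] E :=
  (ContinuousLinearMap.compL ℝ E (E →L[ℝ] ℝ) E (g x).inverse) ∘L koszul g x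

theorem christoffel_apply {E : Type*} [NormedAddCommGroup E] [NormedSpace ℝ E]
    (g : E → E →L[ℝ] E →L[ℝ] ℝ) (x u v : E) :
    christoffel g x u v = (g x).inverse (koszul g x u v) := rfl

/-- The covariant derivative `∇_u A` at `x` of a field `A` of endomorphisms. -/
def covEnd {E : Type*} [NormedAddCommGroup E] [NormedSpace ℝ E]
    (g : E → E →L[ℝ] E →L[ℝ] ℝ) (A : E → E →L[ℝ] E) (x u : E) : E →L[ℝ] E :=
  fderiv ℝ A x u + christoffel g x u ∘L A x - A x ∘L christoffel g x u

/-- The curvature operator `R (u, v) = [∇_u, ∇_v] - ∇_[u, v]` at `x`; see `curvature_apply`. -/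
def curvature {E : Type*} [NormedAddCommGroup E] [NormedSpace ℝ E]
    (g : E → E →L[ℝ] E →L[ℝ] ℝ) (x u v : E) : E →L[ℝ] E :=
  fderiv ℝ (christoffel g) x u v - fderiv ℝ (christoffel g) x v u
    + (christoffel g x u ∘L christoffel g x v - christoffel g x v ∘L christoffel g x u)

theorem curvature_apply {E : Type*} [NormedAddCommGroup E] [NormedSpace ℝ E]
    (g : E → E →L[ℝ] E →L[ℝ] ℝ) (x u v w : E) :
    curvature g x u v w = fderiv ℝ (christoffel g) x u v w - fderiv ℝ (christoffel g) x v u w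
      + (christoffel g x u (christoffel g x v w) - christoffel g x v (christoffel g x u w)) := rfl

theorem curvature_add {E : Type*} [NormedAddCommGroup E] [NormedSpace ℝ E]
    (g : E → E →L[ℝ] E →L[ℝ] ℝ) (x u u' v : E) :
    curvature g x (u + u') v = curvature g x u v + curvature g x u' v := by
  ext w
  simp only [curvature_apply, map_add, add_apply]
  abel

theorem curvature_smul {E : Type*} [NormedAddCommGroup E] [NormedSpace ℝ E]
    (g : E → E →L[ℝ] E →L[ℝ] ℝ) (x : E) (c : ℝ) (u v : E) :
    curvature g x (c • u) v = c • curvature g x u v := by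
  ext w
  simp only [curvature_apply, map_smul, smul_apply, smul_add, smul_sub]

theorem curvature_swap {E : Type*} [NormedAddCommGroup E] [NormedSpace ℝ E]
    (g : E → E →L[ℝ] E →L[ℝ] ℝ) (x u v : E) :
    curvature g x v u = - curvature g x u v := by
  ext w
  simp only [curvature_apply, neg_apply]
  abel

/-- The Ricci tensor `Ric (v, w) = trace (u ↦ R (u, v) w)`. -/
def ricci {E : Type*} [NormedAddCommGroup E] [NormedSpace ℝ E]
    (g : E → E →L[ℝ] E →L[ℝ] ℝ) (x : E) : E →ₗ[ℝ] E →ₗ[ℝ] ℝ :=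
  LinearMap.mk₂ ℝ
    (fun v w => LinearMap.trace ℝ E
      { toFun := fun u => curvature g x u v w
        map_add' := fun a b => by rw [curvature_add, add_apply]
        map_smul' := fun c a => by rw [curvature_smul, smul_apply, RingHom.id_apply] })
    (fun a b w => by
      rw [← map_add]; congr 1; ext u
      simp [curvature_swap g x (_ + _), curvature_add, curvature_swap g x u]; abel)
    (fun c a w => by
      rw [← map_smul]; congr 1; ext u
      simp [curvature_swap g x (_ • _), curvature_smul, curvature_swap g x u])
    (fun v a b => by
      rw [← map_add]; congr 1; ext u; simp)
    (fun c v a => by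
      rw [← map_smul]; congr 1; ext u; simp)

/-- The scalar curvature: the trace of the Ricci tensor with respect to `g`, that is, the trace of
the endomorphism which corresponds to it. -/
def scalarCurvature {E : Type*} [NormedAddCommGroup E] [NormedSpace ℝ E] [FiniteDimensional ℝ E]
    (g : E → E →L[ℝ] E →L[ℝ] ℝ) (x : E) : ℝ :=
  LinearMap.trace ℝ E ((g x).inverse.toLinearMap ∘ₗ
    (LinearMap.toContinuousLinearMap (𝕜 := ℝ) (E := E) (F' := ℝ)).toLinearMap ∘ₗ ricci g x)

/-- The Lee form of `(g, I)`: `φ (X) = ½ trace (u ↦ I ((∇_u I) X))`. -/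
def leeForm {E : Type*} [NormedAddCommGroup E] [NormedSpace ℝ E] [FiniteDimensional ℝ E]
    (g : E → E →L[ℝ] E →L[ℝ] ℝ) (I : E → E →L[ℝ] E) (x : E) : E →L[ℝ] ℝ :=
  LinearMap.toContinuousLinearMap
    { toFun := fun v => 1 / 2 * LinearMap.trace ℝ E
        { toFun := fun u => I x (covEnd g I x u v)
          map_add' := fun a b => by simp [covEnd]; abel
          map_smul' := fun c a => by simp [covEnd, smul_sub] }
      map_add' := fun a b => by
        rw [← mul_add, ← map_add]; congr 2; ext u; simp
      map_smul' := fun c a => by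
        rw [RingHom.id_apply, smul_eq_mul, mul_left_comm, ← smul_eq_mul (a := c), ← map_smul]
        congr 2; ext u; simp }

/-- The exterior derivative of a 1-form, `dα (u, v) = D_u α (v) - D_v α (u)`. -/
def extDerivOne {E : Type*} [NormedAddCommGroup E] [NormedSpace ℝ E]
    (α : E → E →L[ℝ] ℝ) (x u v : E) : ℝ :=
  fderiv ℝ α x u v - fderiv ℝ α x v u

/-- The square of the norm with respect to `g` of a covector `φ` at `x`. -/
def covectorNormSq {E : Type*} [NormedAddCommGroup E] [NormedSpace ℝ E]
    (g : E → E →L[ℝ] E →L[ℝ] ℝ) (x : E) (φ : E →L[ℝ] ℝ) : ℝ :=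
  φ ((g x).inverse φ)

/-- The Nijenhuis tensor `[AX, AY] - A [AX, Y] - A [X, AY] + A² [X, Y]` of an almost complex
structure `A` at `x` vanishes, where `X`, `Y` are the constant vector fields `u`, `v` (so that
`[X, Y] = 0`). -/
def IsIntegrableAt {E : Type*} [NormedAddCommGroup E] [NormedSpace ℝ E]
    (A : E → E →L[ℝ] E) (x : E) : Prop :=
  ∀ u v : E,
    VectorField.lieBracket ℝ (fun y => A y u) (fun y => A y v) x
      - A x (VectorField.lieBracket ℝ (fun y => A y u) (fun _ => v) x)
      - A x (VectorField.lieBracket ℝ (fun _ => u) (fun y => A y v) x) = 0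

/-- The part of the curvature operator of an Einstein metric in dimension 4 which remains after the
constant curvature part `(s / 12) (g (v, ·) u - g (u, ·) v)` is subtracted: the Weyl tensor. -/
def weylEinsteinFour {E : Type*} [NormedAddCommGroup E] [NormedSpace ℝ E] [FiniteDimensional ℝ E]
    (g : E → E →L[ℝ] E →L[ℝ] ℝ) (x u v : E) : E →L[ℝ] E :=
  curvature g x u v
    - (scalarCurvature g x / 12) • ((g x v).smulRight u - (g x u).smulRight v)

/-- The quaternionic Kähler condition at `x`, in dimension `4 * n`, for the metric `g` and the bundle
`S` of endomorphisms spanned by `I`, `J`, `K`.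

The bundle `S` is parallel (this is automatic for `n = 1`), and if `n = 1` then moreover `g` is
Einstein and half conformally flat: the Weyl tensor `W` has no component in `S`, which is one of
the two summands of `so (4) = S ⊕ S'`; equivalently `W (u, v)` lies in `S'`, the commutant of
`I`, `J`, `K`. -/
structure IsQuaternionicKahlerAt {E : Type*} [NormedAddCommGroup E] [NormedSpace ℝ E]
    [FiniteDimensional ℝ E] (n : ℕ) (g : E → E →L[ℝ] E →L[ℝ] ℝ) (I J K : E → E →L[ℝ] E)
    (x : E) : Prop where
  parallel_I : ∀ u, covEnd g I x u ∈ Submodule.span ℝ {I x, J x, K x}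
  parallel_J : ∀ u, covEnd g J x u ∈ Submodule.span ℝ {I x, J x, K x}
  parallel_K : ∀ u, covEnd g K x u ∈ Submodule.span ℝ {I x, J x, K x}
  einstein : n = 1 → ∀ u v, ricci g x u v = scalarCurvature g x / 4 * g x u v
  selfDual_I : n = 1 → ∀ u v w, weylEinsteinFour g x u v (I x w) = I x (weylEinsteinFour g x u v w)
  selfDual_J : n = 1 → ∀ u v w, weylEinsteinFour g x u v (J x w) = J x (weylEinsteinFour g x u v w)
  selfDual_K : n = 1 → ∀ u v w, weylEinsteinFour g x u v (K x w) = K x (weylEinsteinFour g x u v w)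

/-- `(g, I, J, K)` is a (smooth) hyper-Kähler structure on the open set `V`: a Riemannian metric with
an orthogonal almost hypercomplex structure which is parallel. -/
structure IsHyperKahlerOn {E : Type*} [NormedAddCommGroup E] [NormedSpace ℝ E]
    (V : Set E) (g : E → E →L[ℝ] E →L[ℝ] ℝ) (I J K : E → E →L[ℝ] E) : Prop where
  contDiffOn_g : ContDiffOn ℝ ∞ g V
  contDiffOn_I : ContDiffOn ℝ ∞ I V
  contDiffOn_J : ContDiffOn ℝ ∞ J V
  contDiffOn_K : ContDiffOn ℝ ∞ K V
  symm : ∀ x ∈ V, ∀ u v, g x u v = g x v u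
  pos : ∀ x ∈ V, ∀ v, v ≠ 0 → 0 < g x v v
  triple : ∀ x ∈ V, IsHyperHermitianTriple (g x) (I x) (J x) (K x)
  parallel_I : ∀ x ∈ V, ∀ u, covEnd g I x u = 0
  parallel_J : ∀ x ∈ V, ∀ u, covEnd g J x u = 0
  parallel_K : ∀ x ∈ V, ∀ u, covEnd g K x u = 0

/-- `α` is a smooth 1-form on the open set `V` with `dα = Ω_A`, where `Ω_A (u, v) = g (A u, v)` is
the Kähler form of `(g, A)`. -/
structure IsKahlerPrimitiveOn {E : Type*} [NormedAddCommGroup E] [NormedSpace ℝ E]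
    (V : Set E) (g : E → E →L[ℝ] E →L[ℝ] ℝ) (A : E → E →L[ℝ] E) (α : E → E →L[ℝ] ℝ) :
    Prop where
  contDiffOn : ContDiffOn ℝ ∞ α V
  extDeriv_eq : ∀ x ∈ V, ∀ u v, extDerivOne α x u v = g x (A x u) v

/-! ### The models -/

/-- The domain `{t > 0} × V` of the models, where `(t, u, v, w)` are the coordinates of `ℝ⁴`
(indexed by `0, 1, 2, 3`). -/
def modelDomain {F : Type*} (V : Set F) : Set (EuclideanSpace ℝ (Fin 4) × F) :=
  {z | 0 < z.1 0 ∧ z.2 ∈ V}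

/-- The metric
`-(1 / (ν t²)) (dt² + (-du + ν α)² + (-dv + ν β)² + (-dw + ν γ)²) + (1 / t) g'`
on `{t > 0} × V`, as a bilinear form in the tangent vectors `X`, `Y` at the point `z`; the four
squares are those of `dt`, `I dt`, `J dt`, `K dt` for the almost hypercomplex structure of the
model, and `α`, `β`, `γ`, `g'` are pulled back from `V`. -/
def modelMetric {F : Type*} [NormedAddCommGroup F] [NormedSpace ℝ F] (ν : ℝ)
    (g' : F → F →L[ℝ] F →L[ℝ] ℝ) (α β γ : F → F →L[ℝ] ℝ)
    (z X Y : EuclideanSpace ℝ (Fin 4) × F) : ℝ :=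
  -(1 / (ν * z.1 0 ^ 2)) *
      (X.1 0 * Y.1 0
        + (-X.1 1 + ν * α z.2 X.2) * (-Y.1 1 + ν * α z.2 Y.2)
        + (-X.1 2 + ν * β z.2 X.2) * (-Y.1 2 + ν * β z.2 Y.2)
        + (-X.1 3 + ν * γ z.2 X.2) * (-Y.1 3 + ν * γ z.2 Y.2))
    + 1 / z.1 0 * g' z.2 X.2 Y.2

/-! ### Manifolds -/

/-- A smooth almost hyper-Hermitian structure on a `d`-dimensional manifold `M`: a Riemannian metric
`g` and a triple `(I, J, K)` of orthogonal almost complex structures with the quaternionic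
identities. -/
structure AlmostHyperHermitian (d : ℕ) (M : Type*) [TopologicalSpace M]
    [ChartedSpace (EuclideanSpace ℝ (Fin d)) M]
    [IsManifold 𝓘(ℝ, EuclideanSpace ℝ (Fin d)) ∞ M] where
  g : Bundle.ContMDiffRiemannianMetric 𝓘(ℝ, EuclideanSpace ℝ (Fin d)) ∞
    (EuclideanSpace ℝ (Fin d))
    (fun p : M => TangentSpace 𝓘(ℝ, EuclideanSpace ℝ (Fin d)) p)
  I : (p : M) → TangentSpace 𝓘(ℝ, EuclideanSpace ℝ (Fin d)) p →L[ℝ]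
    TangentSpace 𝓘(ℝ, EuclideanSpace ℝ (Fin d)) p
  J : (p : M) → TangentSpace 𝓘(ℝ, EuclideanSpace ℝ (Fin d)) p →L[ℝ]
    TangentSpace 𝓘(ℝ, EuclideanSpace ℝ (Fin d)) p
  K : (p : M) → TangentSpace 𝓘(ℝ, EuclideanSpace ℝ (Fin d)) p →L[ℝ]
    TangentSpace 𝓘(ℝ, EuclideanSpace ℝ (Fin d)) p
  contMDiff_I : ContMDiff 𝓘(ℝ, EuclideanSpace ℝ (Fin d))
    (𝓘(ℝ, EuclideanSpace ℝ (Fin d)).prod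
      𝓘(ℝ, EuclideanSpace ℝ (Fin d) →L[ℝ] EuclideanSpace ℝ (Fin d))) ∞
    (fun p => Bundle.TotalSpace.mk'
      (EuclideanSpace ℝ (Fin d) →L[ℝ] EuclideanSpace ℝ (Fin d))
      (E := fun p : M => TangentSpace 𝓘(ℝ, EuclideanSpace ℝ (Fin d)) p →L[ℝ]
        TangentSpace 𝓘(ℝ, EuclideanSpace ℝ (Fin d)) p) p (I p))
  contMDiff_J : ContMDiff 𝓘(ℝ, EuclideanSpace ℝ (Fin d))
    (𝓘(ℝ, EuclideanSpace ℝ (Fin d)).prod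
      𝓘(ℝ, EuclideanSpace ℝ (Fin d) →L[ℝ] EuclideanSpace ℝ (Fin d))) ∞
    (fun p => Bundle.TotalSpace.mk'
      (EuclideanSpace ℝ (Fin d) →L[ℝ] EuclideanSpace ℝ (Fin d))
      (E := fun p : M => TangentSpace 𝓘(ℝ, EuclideanSpace ℝ (Fin d)) p →L[ℝ]
        TangentSpace 𝓘(ℝ, EuclideanSpace ℝ (Fin d)) p) p (J p))
  contMDiff_K : ContMDiff 𝓘(ℝ, EuclideanSpace ℝ (Fin d))
    (𝓘(ℝ, EuclideanSpace ℝ (Fin d)).prod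
      𝓘(ℝ, EuclideanSpace ℝ (Fin d) →L[ℝ] EuclideanSpace ℝ (Fin d))) ∞
    (fun p => Bundle.TotalSpace.mk'
      (EuclideanSpace ℝ (Fin d) →L[ℝ] EuclideanSpace ℝ (Fin d))
      (E := fun p : M => TangentSpace 𝓘(ℝ, EuclideanSpace ℝ (Fin d)) p →L[ℝ]
        TangentSpace 𝓘(ℝ, EuclideanSpace ℝ (Fin d)) p) p (K p))
  triple : ∀ p, IsHyperHermitianTriple (g.inner p) (I p) (J p) (K p)

/-- The expression in the chart `e` of a field `b` of bilinear forms on the tangent spaces: its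
pullback by `e⁻¹`. -/
def chartForm {d : ℕ} {M : Type*} [TopologicalSpace M]
    [ChartedSpace (EuclideanSpace ℝ (Fin d)) M]
    (e : OpenPartialHomeomorph M (EuclideanSpace ℝ (Fin d)))
    (b : (p : M) → TangentSpace 𝓘(ℝ, EuclideanSpace ℝ (Fin d)) p →L[ℝ]
      TangentSpace 𝓘(ℝ, EuclideanSpace ℝ (Fin d)) p →L[ℝ] ℝ)
    (y : EuclideanSpace ℝ (Fin d)) :
    EuclideanSpace ℝ (Fin d) →L[ℝ] EuclideanSpace ℝ (Fin d) →L[ℝ] ℝ :=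
  ContinuousLinearMap.bilinearComp
    (E := EuclideanSpace ℝ (Fin d)) (F := EuclideanSpace ℝ (Fin d)) (b (e.symm y))
    (mfderiv 𝓘(ℝ, EuclideanSpace ℝ (Fin d)) 𝓘(ℝ, EuclideanSpace ℝ (Fin d)) e.symm y)
    (mfderiv 𝓘(ℝ, EuclideanSpace ℝ (Fin d)) 𝓘(ℝ, EuclideanSpace ℝ (Fin d)) e.symm y)

/-- The expression in the chart `e` of a field `A` of endomorphisms of the tangent spaces. -/
def chartEnd {d : ℕ} {M : Type*} [TopologicalSpace M]
    [ChartedSpace (EuclideanSpace ℝ (Fin d)) M]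
    (e : OpenPartialHomeomorph M (EuclideanSpace ℝ (Fin d)))
    (A : (p : M) → TangentSpace 𝓘(ℝ, EuclideanSpace ℝ (Fin d)) p →L[ℝ]
      TangentSpace 𝓘(ℝ, EuclideanSpace ℝ (Fin d)) p)
    (y : EuclideanSpace ℝ (Fin d)) :
    EuclideanSpace ℝ (Fin d) →L[ℝ] EuclideanSpace ℝ (Fin d) :=
  (mfderiv 𝓘(ℝ, EuclideanSpace ℝ (Fin d)) 𝓘(ℝ, EuclideanSpace ℝ (Fin d)) e (e.symm y)) ∘L
    A (e.symm y) ∘L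
    (mfderiv 𝓘(ℝ, EuclideanSpace ℝ (Fin d)) 𝓘(ℝ, EuclideanSpace ℝ (Fin d)) e.symm y)

/-- A hyper-Hermitian quaternionic Kähler manifold of dimension `4 * n` with reduced scalar curvature
`ν`: the bundle spanned by `I`, `J`, `K` is quaternionic Kähler, `I`, `J`, `K` are integrable, and
the scalar curvature is `4 n (n + 2) ν`, with `ν ≠ 0`. The conditions are tensorial, and are
expressed in the charts. -/
structure IsHHqK (n : ℕ) {M : Type*} [TopologicalSpace M]
    [ChartedSpace (EuclideanSpace ℝ (Fin (4 * n))) M]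
    [IsManifold 𝓘(ℝ, EuclideanSpace ℝ (Fin (4 * n))) ∞ M]
    (S : AlmostHyperHermitian (4 * n) M) (ν : ℝ) : Prop where
  quaternionicKahler : ∀ e ∈ atlas (EuclideanSpace ℝ (Fin (4 * n))) M, ∀ y ∈ e.target,
    IsQuaternionicKahlerAt n (chartForm e S.g.inner) (chartEnd e S.I) (chartEnd e S.J)
      (chartEnd e S.K) y
  integrable_I : ∀ e ∈ atlas (EuclideanSpace ℝ (Fin (4 * n))) M, ∀ y ∈ e.target,
    IsIntegrableAt (chartEnd e S.I) y
  integrable_J : ∀ e ∈ atlas (EuclideanSpace ℝ (Fin (4 * n))) M, ∀ y ∈ e.target,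
    IsIntegrableAt (chartEnd e S.J) y
  integrable_K : ∀ e ∈ atlas (EuclideanSpace ℝ (Fin (4 * n))) M, ∀ y ∈ e.target,
    IsIntegrableAt (chartEnd e S.K) y
  scalarCurvature_eq : ∀ e ∈ atlas (EuclideanSpace ℝ (Fin (4 * n))) M, ∀ y ∈ e.target,
    scalarCurvature (chartForm e S.g.inner) y = 4 * n * (n + 2) * ν
  ne_zero : ν ≠ 0

/-- The expression in the chart `e` of the Lee form of an almost hyper-Hermitian structure, that is,
the Lee form of `I`. (If the structure is hyper-Hermitian, then `J` and `K` have the same one.) -/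
def chartLeeForm {d : ℕ} {M : Type*} [TopologicalSpace M]
    [ChartedSpace (EuclideanSpace ℝ (Fin d)) M]
    [IsManifold 𝓘(ℝ, EuclideanSpace ℝ (Fin d)) ∞ M]
    (S : AlmostHyperHermitian d M) (e : OpenPartialHomeomorph M (EuclideanSpace ℝ (Fin d)))
    (y : EuclideanSpace ℝ (Fin d)) : EuclideanSpace ℝ (Fin d) →L[ℝ] ℝ :=
  leeForm (chartForm e S.g.inner) (chartEnd e S.I) y

/-- The Lee form `φ` is closed: `dφ = 0`. -/
def HasClosedLeeForm {d : ℕ} {M : Type*} [TopologicalSpace M]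
    [ChartedSpace (EuclideanSpace ℝ (Fin d)) M]
    [IsManifold 𝓘(ℝ, EuclideanSpace ℝ (Fin d)) ∞ M]
    (S : AlmostHyperHermitian d M) : Prop :=
  ∀ e ∈ atlas (EuclideanSpace ℝ (Fin d)) M, ∀ y ∈ e.target, ∀ u v,
    extDerivOne (chartLeeForm S e) y u v = 0

/-- The Lee form `φ` satisfies `|φ|² = c` at every point. -/
def LeeFormNormSqEq {d : ℕ} {M : Type*} [TopologicalSpace M]
    [ChartedSpace (EuclideanSpace ℝ (Fin d)) M]
    [IsManifold 𝓘(ℝ, EuclideanSpace ℝ (Fin d)) ∞ M]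
    (S : AlmostHyperHermitian d M) (c : ℝ) : Prop :=
  ∀ e ∈ atlas (EuclideanSpace ℝ (Fin d)) M, ∀ y ∈ e.target,
    covectorNormSq (chartForm e S.g.inner) y (chartLeeForm S e y) = c

end HHqK

end

open scoped Manifold ContDiff Bundle

noncomputable section

set_option maxSynthPendingDepth 3

namespace HHqK


/-! ### Scalar products -/

section ScalarProduct

variable {V : Type*} [NormedAddCommGroup V] [NormedSpace ℝ V] {b : V →L[ℝ] V →L[ℝ] ℝ}

/-! Let `ψ` be the negative of the Lee form. Since the bundle spanned by `I`, `J`, `K` is parallel,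
`∇I = γ J - β K`, `∇J = α K - γ I`, `∇K = β I - α J` for some 1-forms. The vanishing of the three
Nijenhuis tensors forces `α = ψ ∘ I`, `β = ψ ∘ J`, `γ = ψ ∘ K` (`covEnd_eq_leeForm`), so one 1-form
controls the whole connection. The curvature of the bundle is `-ν` times the Kähler forms: for `n ≥
2` this follows from the Bianchi identity and traces (which also give the Einstein equation), for `n
= 1` from self-duality and the value of the scalar curvature. Hence `d(ψI) = -ν Ω_I - ψJ ∧ ψK`, and
cyclically (`isHHqKOn_of_quaternionicKahler`).

If `ψ` is closed, then locally `dt = t ψ` with `t > 0`, and `d(t ψI) = t (-ν Ω_I + ψ ∧ ψI - ψJ ∧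
ψK)`. The right-hand side is `-ν T(I·, ·)`, where `T = t (g + (ψ² + (ψI)² + (ψJ)² + (ψK)²) / ν)`.
The condition `|ψ|² = -ν` says exactly that `T` is degenerate along the quaternionic line spanned by
the dual vector `Ψ` of `ψ`; on its orthogonal complement `T` is `t g`. The four fields in this line
which are dual to `tψ`, `tψI`, `tψJ`, `tψK` therefore lie in the kernels of the differentials of all
four forms. By Cartan's formula their brackets are annihilated by the four forms and by `T`, so the
fields commute (`leeFields_commute`) and are coordinate fields (`exists_straightening`), with `t`
itself as the first coordinate.

In these coordinates each of `tψI`, `tψJ`, `tψK` is a coordinate differential plus a 1-form on the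
transverse slice which does not depend on the slice (`sliceForm_eq`), and `T` descends to the slice
with `I`, `J`, `K`. The Kähler forms of the descended structure are exact, so it is hyper-Kähler by
Hitchin's lemma (`covEnd_eq_zero_of_primitives`). Solving the definition of `T` for `g` gives `g =
-(1 / (ν t²)) ((tψ)² + (tψI)² + (tψJ)² + (tψK)²) + T / t`, which is the model metric
(`form_fderiv_eq_modelMetric`).

The straightening needs a flow which is smooth jointly in the initial point and the parameters. It
comes from the implicit function theorem applied to the integral equation of the flow in the Banach
space `C([0, 1], E)`. -/

theorem eq_zero_of_forall_form_eq_zero (hp : ∀ v, v ≠ 0 → 0 < b v v) {u : V}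
    (h : ∀ w, b u w = 0) : u = 0 := by
  by_contra hu
  exact (hp u hu).ne' (h u)

theorem eq_of_forall_form_eq (hp : ∀ v, v ≠ 0 → 0 < b v v) {u v : V}
    (h : ∀ w, b u w = b v w) : u = v := by
  refine sub_eq_zero.1 (eq_zero_of_forall_form_eq_zero hp fun w => ?_)
  simp [h w]

variable [FiniteDimensional ℝ V]

theorem isInvertible_of_form_pos (hp : ∀ v, v ≠ 0 → 0 < b v v) : b.IsInvertible := by
  have hinj : Function.Injective b.toLinearMap := by
    intro u v huv
    exact eq_of_forall_form_eq hp fun w => congrArg (fun f : V →L[ℝ] ℝ => f w) huv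
  have hd : Module.finrank ℝ V = Module.finrank ℝ (V →L[ℝ] ℝ) := by
    rw [← (LinearMap.toContinuousLinearMap (𝕜 := ℝ) (E := V) (F' := ℝ)).finrank_eq]
    exact (Subspace.dual_finrank_eq (K := ℝ) (V := V)).symm
  refine ⟨(LinearEquiv.ofInjectiveOfFinrankEq b.toLinearMap hinj hd).toContinuousLinearEquiv, ?_⟩
  ext u v
  rfl

theorem form_inverse_apply (hp : ∀ v, v ≠ 0 → 0 < b v v) (φ : V →L[ℝ] ℝ) (w : V) :
    b (b.inverse φ) w = φ w := by
  obtain ⟨e, rfl⟩ := isInvertible_of_form_pos hp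
  rw [ContinuousLinearMap.inverse_equiv]
  simp

theorem inverse_form_apply (hp : ∀ v, v ≠ 0 → 0 < b v v) (v : V) : b.inverse (b v) = v := by
  obtain ⟨e, rfl⟩ := isInvertible_of_form_pos hp
  rw [ContinuousLinearMap.inverse_equiv]
  simp

/-- The isomorphism of `V` with its dual given by `b` conjugates `S` into the transpose of `T`, and
a transpose has the same trace. The trace computations with the curvature tensor use this to turn
pair symmetry into an equality of traces. -/
theorem trace_eq_of_adjoint (hs : ∀ u v, b u v = b v u) (hp : ∀ v, v ≠ 0 → 0 < b v v)
    (T S : V →ₗ[ℝ] V) (h : ∀ u v, b (T u) v = b u (S v)) :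
    LinearMap.trace ℝ V T = LinearMap.trace ℝ V S := by
  have hinj : Function.Injective
      ((ContinuousLinearMap.coeLM ℝ : (V →L[ℝ] ℝ) →ₗ[ℝ] Module.Dual ℝ V) ∘ₗ b.toLinearMap) := by
    intro u v huv
    exact eq_of_forall_form_eq hp fun w => congrArg (fun f : Module.Dual ℝ V => f w) huv
  let e := LinearEquiv.ofInjectiveOfFinrankEq _ hinj (Subspace.dual_finrank_eq (K := ℝ)).symm
  have he : ∀ u v, e u v = b u v := fun u v => rfl
  have : e.conj S = Module.Dual.transpose T := by
    ext φ v
    obtain ⟨u, rfl⟩ := e.surjective φ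
    rw [LinearEquiv.conj_apply_apply, e.symm_apply_apply, he, Module.Dual.transpose_apply,
      LinearMap.comp_apply, he, hs, ← h, hs]
  rw [← LinearMap.trace_transpose', ← this, LinearMap.trace_conj']

end ScalarProduct

/-! ### Hyper-Hermitian structures on a vector space -/

namespace IsHyperHermitianTriple

section

variable {V : Type*} [AddCommGroup V] [Module ℝ V] [TopologicalSpace V]
  {b : V →L[ℝ] V →L[ℝ] ℝ} {I J K : V →L[ℝ] V}

theorem IJ (h : IsHyperHermitianTriple b I J K) (v : V) : I (J v) = K v := by
  have := h.IJK (K v)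
  rw [h.K_sq, map_neg, map_neg] at this
  exact neg_injective this

theorem JK (h : IsHyperHermitianTriple b I J K) (v : V) : J (K v) = I v := by
  have := congrArg I (h.IJK v)
  rw [h.I_sq, map_neg] at this
  exact neg_injective this

theorem KJ (h : IsHyperHermitianTriple b I J K) (v : V) : K (J v) = -I v := by
  rw [← h.IJ, h.J_sq, map_neg]

theorem IK (h : IsHyperHermitianTriple b I J K) (v : V) : I (K v) = -J v := by
  rw [← h.IJ, h.I_sq]

theorem JI (h : IsHyperHermitianTriple b I J K) (v : V) : J (I v) = -K v := by
  rw [← h.JK, h.J_sq]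

theorem KI (h : IsHyperHermitianTriple b I J K) (v : V) : K (I v) = J v := by
  rw [← h.IJ, h.JI, map_neg, h.IK, neg_neg]

theorem rotate (h : IsHyperHermitianTriple b I J K) : IsHyperHermitianTriple b J K I where
  I_sq := h.J_sq
  J_sq := h.K_sq
  K_sq := h.I_sq
  IJK v := by rw [h.KI, h.J_sq]
  orthogonal_I := h.orthogonal_J
  orthogonal_J := h.orthogonal_K
  orthogonal_K := h.orthogonal_I

theorem skew_I (h : IsHyperHermitianTriple b I J K) (u v : V) : b (I u) v = -b u (I v) := by
  rw [← h.orthogonal_I u (I v), h.I_sq, map_neg, neg_neg]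

theorem skew_J (h : IsHyperHermitianTriple b I J K) (u v : V) : b (J u) v = -b u (J v) :=
  h.rotate.skew_I u v

theorem skew_K (h : IsHyperHermitianTriple b I J K) (u v : V) : b (K u) v = -b u (K v) :=
  h.rotate.rotate.skew_I u v

theorem form_I_self (h : IsHyperHermitianTriple b I J K) (hs : ∀ u v, b u v = b v u) (u : V) :
    b (I u) u = 0 := by
  have := h.skew_I u u
  rw [hs u (I u)] at this
  linarith

theorem form_J_self (h : IsHyperHermitianTriple b I J K) (hs : ∀ u v, b u v = b v u) (u : V) :
    b (J u) u = 0 :=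
  h.rotate.form_I_self hs u

theorem form_K_self (h : IsHyperHermitianTriple b I J K) (hs : ∀ u v, b u v = b v u) (u : V) :
    b (K u) u = 0 :=
  h.rotate.rotate.form_I_self hs u

theorem trace_K [FiniteDimensional ℝ V] (h : IsHyperHermitianTriple b I J K) :
    LinearMap.trace ℝ V K.toLinearMap = 0 := by
  have h1 : I.toLinearMap ∘ₗ J.toLinearMap = K.toLinearMap := by ext v; exact h.IJ v
  have h2 : J.toLinearMap ∘ₗ I.toLinearMap = -K.toLinearMap := by ext v; exact h.JI v
  have := LinearMap.trace_comp_comm' I.toLinearMap J.toLinearMap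
  rw [h1, h2, map_neg] at this
  linarith

theorem trace_I [FiniteDimensional ℝ V] (h : IsHyperHermitianTriple b I J K) :
    LinearMap.trace ℝ V I.toLinearMap = 0 :=
  h.rotate.trace_K

end

end IsHyperHermitianTriple

/-! ### The curvature tensor of a quaternionic Kähler manifold at a point -/

section Curvature

variable {V : Type*} [NormedAddCommGroup V] [NormedSpace ℝ V] {g : V →L[ℝ] V →L[ℝ] ℝ}
  {I J K : V →L[ℝ] V} {R : V →ₗ[ℝ] V →ₗ[ℝ] V →ₗ[ℝ] V}

/-- An algebraic curvature tensor on the Euclidean vector space `(V, g)`. -/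
structure IsCurvatureTensor (g : V →L[ℝ] V →L[ℝ] ℝ) (R : V →ₗ[ℝ] V →ₗ[ℝ] V →ₗ[ℝ] V) :
    Prop where
  swap : ∀ u v w, R u v w = -R v u w
  bianchi : ∀ u v w, R u v w + R v w u + R w u v = 0
  skew : ∀ u v w z, g (R u v w) z = -g (R u v z) w

/-- The commutators of a curvature tensor with `I`, `J`, `K` are the combinations of `I`, `J`, `K`
given by the forms `a`, `β`, `c`. -/
structure IsQuaternionicCurvature (I J K : V →L[ℝ] V) (R : V →ₗ[ℝ] V →ₗ[ℝ] V →ₗ[ℝ] V)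
    (a β c : V →ₗ[ℝ] V →ₗ[ℝ] ℝ) : Prop where
  comm_I : ∀ u v w, R u v (I w) - I (R u v w) = c u v • J w - β u v • K w
  comm_J : ∀ u v w, R u v (J w) - J (R u v w) = a u v • K w - c u v • I w
  comm_K : ∀ u v w, R u v (K w) - K (R u v w) = β u v • I w - a u v • J w

theorem IsQuaternionicCurvature.rotate {a β c : V →ₗ[ℝ] V →ₗ[ℝ] ℝ}
    (h : IsQuaternionicCurvature I J K R a β c) : IsQuaternionicCurvature J K I R β c a :=
  ⟨h.comm_J, h.comm_K, h.comm_I⟩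

namespace IsCurvatureTensor

/-- The classical octahedron argument: a linear combination of four Bianchi identities, simplified
by the two skew symmetries. -/
theorem pair_symm (hR : IsCurvatureTensor g R) (u v w z : V) :
    g (R u v w) z = g (R w z u) v := by
  have e : ∀ u v w z, g (R u v w) z + g (R v w u) z + g (R w u v) z = 0 := by
    intro u v w z
    have := congrArg (fun x => g x z) (hR.bianchi u v w)
    simpa using this
  have sw : ∀ u v w z, g (R u v w) z = -g (R v u w) z := by
    intro u v w z
    rw [hR.swap u v w, map_neg, neg_apply]
  have h1 := e u v w z
  have h2 := e v w z u
  have h3 := e w z u v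
  have h4 := e z u v w
  linarith [hR.skew u v w z, hR.skew v w u z, hR.skew w u v z, hR.skew v w z u, hR.skew w z v u,
    hR.skew z v w u, hR.skew w z u v, hR.skew z u w v, hR.skew u w z v, hR.skew z u v w,
    hR.skew u v z w, hR.skew v z u w, sw u v w z, sw v w u z, sw w u v z, sw z v w u, sw u w z v,
    sw v z u w, sw z u w v, sw z v u w, sw w u z v]

variable [FiniteDimensional ℝ V]

/-- The Ricci form of a curvature tensor. -/
def ricciForm (R : V →ₗ[ℝ] V →ₗ[ℝ] V →ₗ[ℝ] V) (v w : V) : ℝ :=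
  LinearMap.trace ℝ V (LinearMap.applyₗ w ∘ₗ R.flip v)

/-- Compose the commutator `[R, I] = c J - β K` with `J` on the right and take the trace: `I` is
traceless, and cyclicity turns `tr (I R J)` into `-tr (R K)`. -/
theorem trace_curvature_comp_K {a β c : V →ₗ[ℝ] V →ₗ[ℝ] ℝ} (h : IsHyperHermitianTriple g I J K)
    (hq : IsQuaternionicCurvature I J K R a β c) (u v : V) :
    2 * LinearMap.trace ℝ V (R u v ∘ₗ K.toLinearMap) = -(Module.finrank ℝ V * c u v) := by
  have h1 : R u v ∘ₗ K.toLinearMap - I.toLinearMap ∘ₗ (R u v ∘ₗ J.toLinearMap)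
      = -(c u v • LinearMap.id) + β u v • I.toLinearMap := by
    ext w
    have := hq.comm_I u v (J w)
    simp only [LinearMap.sub_apply, LinearMap.comp_apply, ContinuousLinearMap.coe_coe,
      LinearMap.add_apply, LinearMap.neg_apply, LinearMap.smul_apply, LinearMap.id_apply]
    rw [h.IJ, h.J_sq, h.KJ] at this
    rw [this]
    simp
  have h2 : LinearMap.trace ℝ V (I.toLinearMap ∘ₗ (R u v ∘ₗ J.toLinearMap))
      = -LinearMap.trace ℝ V (R u v ∘ₗ K.toLinearMap) := by
    rw [LinearMap.trace_comp_comm', ← map_neg]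
    congr 1
    ext w
    simp [h.JI]
  have h3 := congrArg (LinearMap.trace ℝ V) h1
  rw [map_sub, h2, map_add, map_neg, map_smul, map_smul, LinearMap.trace_id, h.trace_I] at h3
  simp only [smul_eq_mul] at h3
  linarith

/-- A second evaluation of the same trace. The Bianchi identity splits `R(u, v) K e` into two terms,
pair symmetry shows that they contribute equally (hence the factor 2), and moving `K` past `R`
produces the Ricci form and the correction terms. -/
theorem trace_curvature_comp_K_eq_ricci {a β c : V →ₗ[ℝ] V →ₗ[ℝ] ℝ}
    (hs : ∀ u v, g u v = g v u) (hp : ∀ v, v ≠ 0 → 0 < g v v)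
    (hR : IsCurvatureTensor g R) (h : IsHyperHermitianTriple g I J K)
    (hq : IsQuaternionicCurvature I J K R a β c) (u v : V) :
    LinearMap.trace ℝ V (R u v ∘ₗ K.toLinearMap)
      = 2 * (a u (J v) - β u (I v) - ricciForm R u (K v)) := by
  have h1 : R u v ∘ₗ K.toLinearMap = (LinearMap.applyₗ v ∘ₗ R u) ∘ₗ K.toLinearMap
      - (LinearMap.applyₗ u ∘ₗ R v) ∘ₗ K.toLinearMap := by
    ext e
    have := hR.bianchi u v (K e)
    rw [hR.swap (K e) u v] at this
    simp only [LinearMap.sub_apply, LinearMap.comp_apply, ContinuousLinearMap.coe_coe,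
      LinearMap.applyₗ_apply_apply]
    linear_combination (norm := module) this
  have h2 : LinearMap.trace ℝ V ((LinearMap.applyₗ u ∘ₗ R v) ∘ₗ K.toLinearMap)
      = LinearMap.trace ℝ V (-(K.toLinearMap ∘ₗ (LinearMap.applyₗ v ∘ₗ R u))) := by
    refine trace_eq_of_adjoint hs hp _ _ fun e f => ?_
    simp only [LinearMap.comp_apply, ContinuousLinearMap.coe_coe, LinearMap.applyₗ_apply_apply,
      LinearMap.neg_apply, map_neg]
    rw [hR.pair_symm, hs, h.skew_K]
  have h3 : K.toLinearMap ∘ₗ (LinearMap.applyₗ v ∘ₗ R u)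
      = -(LinearMap.applyₗ (K v) ∘ₗ R.flip u) - (β u).smulRight (I v) + (a u).smulRight (J v) := by
    ext e
    have := hq.comm_K u e v
    simp only [LinearMap.comp_apply, ContinuousLinearMap.coe_coe, LinearMap.applyₗ_apply_apply,
      LinearMap.neg_apply, LinearMap.sub_apply, LinearMap.add_apply, LinearMap.smulRight_apply,
      LinearMap.flip_apply]
    rw [hR.swap e u (K v)]
    linear_combination (norm := module) -this
  rw [h1, map_sub, h2, map_neg, LinearMap.trace_comp_comm', h3, map_add, map_sub, map_neg,
    LinearMap.trace_smulRight, LinearMap.trace_smulRight, ricciForm]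
  ring

theorem ricci_eq_of_quaternionic {n : ℕ} {a β c : V →ₗ[ℝ] V →ₗ[ℝ] ℝ}
    (hd : Module.finrank ℝ V = 4 * n)
    (hs : ∀ u v, g u v = g v u) (hp : ∀ v, v ≠ 0 → 0 < g v v)
    (hR : IsCurvatureTensor g R) (h : IsHyperHermitianTriple g I J K)
    (hq : IsQuaternionicCurvature I J K R a β c) (u v : V) :
    n * c u v = ricciForm R u (K v) + β u (I v) - a u (J v) := by
  have h1 := trace_curvature_comp_K h hq u v
  have h2 := trace_curvature_comp_K_eq_ricci hs hp hR h hq u v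
  rw [h2, hd] at h1
  push_cast at h1
  linarith

/-- If `n ≥ 2`, then the three curvature forms are determined by the Ricci form. -/
theorem curvatureForm_eq_ricci {n : ℕ} (hn : 2 ≤ n) {a β c : V →ₗ[ℝ] V →ₗ[ℝ] ℝ}
    (hd : Module.finrank ℝ V = 4 * n)
    (hs : ∀ u v, g u v = g v u) (hp : ∀ v, v ≠ 0 → 0 < g v v)
    (hR : IsCurvatureTensor g R) (h : IsHyperHermitianTriple g I J K)
    (hq : IsQuaternionicCurvature I J K R a β c) (u v : V) :
    (n + 2) * c u (K v) = -ricciForm R u v := by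
  have hneg : ∀ w, ricciForm R u (-w) = -ricciForm R u w := by
    intro w
    simp only [ricciForm, map_neg, LinearMap.neg_comp]
  have hc := ricci_eq_of_quaternionic hd hs hp hR h hq u (K v)
  have ha := ricci_eq_of_quaternionic hd hs hp hR h.rotate hq.rotate u (I v)
  have hb := ricci_eq_of_quaternionic hd hs hp hR h.rotate.rotate hq.rotate.rotate u (J v)
  rw [h.K_sq, h.IK, h.JK, hneg, map_neg] at hc
  rw [h.I_sq, h.JI, h.KI, hneg, map_neg] at ha
  rw [h.J_sq, h.KJ, h.IJ, hneg, map_neg] at hb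
  have hn' : (2 : ℝ) ≤ n := by exact_mod_cast hn
  -- In terms of `c(u, Kv)`, `a(u, Iv)`, `β(u, Jv)` the three cyclic identities differ only in which
  -- one carries the factor `n`. Their differences have the factor `n - 1`, so for `n ≥ 2` the three
  -- quantities agree; this is where dimension 4 is excluded.
  have h1 : (n - 1 : ℝ) * (c u (K v) - a u (I v)) = 0 := by linear_combination hc - ha
  have h2 : (n - 1 : ℝ) * (c u (K v) - β u (J v)) = 0 := by linear_combination hc - hb
  have h3 : (n - 1 : ℝ) ≠ 0 := by linarith
  have h4 := (mul_eq_zero.1 h1).resolve_left h3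
  have h5 := (mul_eq_zero.1 h2).resolve_left h3
  linear_combination hc + h4 + h5

theorem ricciForm_symm (hs : ∀ u v, g u v = g v u) (hp : ∀ v, v ≠ 0 → 0 < g v v)
    (hR : IsCurvatureTensor g R) (u v : V) : ricciForm R u v = ricciForm R v u := by
  refine trace_eq_of_adjoint hs hp _ _ fun e f => ?_
  simp only [LinearMap.comp_apply, LinearMap.applyₗ_apply_apply, LinearMap.flip_apply]
  rw [hR.pair_symm, hR.swap, map_neg, neg_apply, hR.skew, neg_neg, hs]

/-- The Ricci form of a quaternionic Kähler manifold of dimension at least `8` is a multiple of the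
metric. -/
theorem exists_ricciForm_eq {n : ℕ} (hn : 2 ≤ n) {a β c : V →ₗ[ℝ] V →ₗ[ℝ] ℝ}
    (hd : Module.finrank ℝ V = 4 * n)
    (hs : ∀ u v, g u v = g v u) (hp : ∀ v, v ≠ 0 → 0 < g v v)
    (hR : IsCurvatureTensor g R) (h : IsHyperHermitianTriple g I J K)
    (hq : IsQuaternionicCurvature I J K R a β c) :
    ∃ l : ℝ, ∀ u v, ricciForm R u v = l * g u v := by
  have hc := curvatureForm_eq_ricci hn hd hs hp hR h hq
  have ha := curvatureForm_eq_ricci hn hd hs hp hR h.rotate hq.rotate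
  have hsymm := ricciForm_symm hs hp hR
  have hn' : (0 : ℝ) < n + 2 := by positivity
  -- The form `a` is skew, because by the trace formula it is a multiple of `tr (R(u, v) I)`.
  -- Applied to `a(u, Iu)`, this makes the Ricci form `I`-invariant.
  have hI : ∀ u, ricciForm R (I u) (I u) = ricciForm R u u := by
    intro u
    have hanti : ∀ u v, a u v = -a v u := by
      intro u v
      have hc' := fun u v => ricci_eq_of_quaternionic hd hs hp hR h.rotate hq.rotate u v
      have t1 := trace_curvature_comp_K h.rotate hq.rotate u v
      have t2 := trace_curvature_comp_K h.rotate hq.rotate v u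
      have t3 : R u v ∘ₗ I.toLinearMap = -(R v u ∘ₗ I.toLinearMap) := by
        ext w
        exact hR.swap u v (I w)
      rw [t3, map_neg, hd] at t1
      rw [hd] at t2
      have : (4 * n : ℝ) ≠ 0 := by positivity
      push_cast at t1 t2
      apply mul_left_cancel₀ this
      linarith
    have h1 := ha (I u) (I u)
    have h2 := ha u u
    rw [h.I_sq, map_neg, hanti] at h1
    linarith
  have key : ∀ u z, g ((R u (K u)) z) (K z) + g ((R u (K u)) (I z)) (J z)
      = c u (K u) * g z z := by
    intro u z
    have := congrArg (fun x => g x (J z)) (hq.comm_I u (K u) z)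
    simp only [map_sub, sub_apply, map_smul, smul_apply, smul_eq_mul] at this
    rw [h.skew_I, h.IJ, h.orthogonal_J, ← h.orthogonal_J (K z), h.JK, h.J_sq, map_neg,
      h.form_I_self hs] at this
    linarith
  -- Adding the identities for the planes `(u, Ku)` and `(Iu, Ju)` makes the left-hand side
  -- symmetric in `u` and `z` by pair symmetry. The right-hand side is then symmetric too, so `c(u,
  -- Ku) / |u|²` is constant, and with it `Ric(u, u) / |u|²`.
  have key2 : ∀ u z, g ((R u (K u)) z) (K z) + g ((R u (K u)) (I z)) (J z)
      + (g ((R (I u) (J u)) z) (K z) + g ((R (I u) (J u)) (I z)) (J z))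
      = 2 * c u (K u) * g z z := by
    intro u z
    have h1 := key (I u) z
    rw [h.KI] at h1
    have h2 := hc (I u) (I u)
    have h3 := hc u u
    rw [h.KI, hI, ← h3] at h2
    have h4 := mul_left_cancel₀ hn'.ne' h2
    rw [h4] at h1
    rw [key, h1]
    ring
  have key3 : ∀ u z, c u (K u) * g z z = c z (K z) * g u u := by
    intro u z
    have h1 := key2 u z
    have h2 := key2 z u
    rw [hR.pair_symm z, hR.pair_symm z, hR.pair_symm (I z), hR.pair_symm (I z)] at h2
    linarith
  have key4 : ∀ u z, ricciForm R u u * g z z = ricciForm R z z * g u u := by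
    intro u z
    have h1 := hc u u
    have h2 := hc z z
    linear_combination (n + 2 : ℝ) * (-key3 u z) + h1 * g z z - h2 * g u u
  obtain ⟨z, hz⟩ : ∃ z : V, z ≠ 0 := by
    have : 0 < Module.finrank ℝ V := by omega
    have := Module.finrank_pos_iff.1 this
    exact exists_ne 0
  have hzz := (hp z hz).ne'
  have hdiag : ∀ u, ricciForm R u u = ricciForm R z z / g z z * g u u := by
    intro u
    rw [div_mul_eq_mul_div, eq_div_iff hzz, key4]
  refine ⟨ricciForm R z z / g z z, fun u v => ?_⟩
  -- Polarization, from the diagonal to all pairs of vectors.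
  have hadd : ∀ u v, ricciForm R (u + v) (u + v)
      = ricciForm R u u + ricciForm R u v + ricciForm R v u + ricciForm R v v := by
    intro u v
    simp only [ricciForm, map_add, LinearMap.comp_add, LinearMap.add_comp]
    ring
  have h1 := hadd u v
  rw [hdiag, hdiag u, hdiag v, hsymm v u] at h1
  simp only [map_add, add_apply] at h1
  rw [hs v u] at h1
  linarith

/-- The curvature forms of a quaternionic Kähler manifold of dimension `4 * n`, `n ≥ 2`. -/
theorem curvatureForm_eq {n : ℕ} (hn : 2 ≤ n) {a β c : V →ₗ[ℝ] V →ₗ[ℝ] ℝ} {l ν : ℝ}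
    (hd : Module.finrank ℝ V = 4 * n)
    (hs : ∀ u v, g u v = g v u) (hp : ∀ v, v ≠ 0 → 0 < g v v)
    (hR : IsCurvatureTensor g R) (h : IsHyperHermitianTriple g I J K)
    (hq : IsQuaternionicCurvature I J K R a β c)
    (hric : ∀ u v, ricciForm R u v = l * g u v) (hl : l = (n + 2) * ν) (u v : V) :
    c u v = -ν * g (K u) v := by
  have hn' : (n + 2 : ℝ) ≠ 0 := by positivity
  have h1 := curvatureForm_eq_ricci hn hd hs hp hR h hq u (K v)
  rw [hric, h.K_sq, map_neg, hl] at h1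
  apply mul_left_cancel₀ hn'
  rw [h.skew_K]
  linarith

end IsCurvatureTensor

/-- The curvature forms of a self-dual Einstein manifold of dimension four. -/
theorem curvatureForm_eq_of_commutes {a β c : V →ₗ[ℝ] V →ₗ[ℝ] ℝ} {ν : ℝ}
    (hs : ∀ u v, g u v = g v u) (hp : ∀ v, v ≠ 0 → 0 < g v v)
    (h : IsHyperHermitianTriple g I J K) (hq : IsQuaternionicCurvature I J K R a β c)
    (hC : ∀ u v w, R u v (I w) - ν • (g v (I w) • u - g u (I w) • v)
      = I (R u v w - ν • (g v w • u - g u w • v))) (u v : V) :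
    c u v = -ν * g (K u) v := by
  by_cases hu : u = 0
  · simp [hu]
  -- Both commutators are evaluated on `u` and paired with `J u`. The `K`-component drops out since
  -- `K u` is orthogonal to `J u`, and of the constant curvature part only the term with `g(u, u)`
  -- survives.
  have h1 := congrArg (fun x => g x (J u)) (hq.comm_I u v u)
  have h2 := congrArg (fun x => g x (J u)) (hC u v u)
  simp only [map_sub, sub_apply, map_smul, smul_apply, smul_eq_mul] at h1 h2
  have e1 : g u (J u) = 0 := by rw [hs, h.form_J_self hs]
  have e2 : g u (I u) = 0 := by rw [hs, h.form_I_self hs]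
  have e3 : g (I u) (J u) = 0 := by rw [h.skew_I, h.IJ, hs, h.form_K_self hs, neg_zero]
  have e4 : g (I v) (J u) = -g (K u) v := by rw [h.skew_I, h.IJ, hs]
  have e5 : g (K u) (J u) = 0 := by
    rw [← h.orthogonal_J, h.JK, h.J_sq, map_neg, h.form_I_self hs, neg_zero]
  rw [e1, e2, e3, e4] at h2
  rw [e5, h.orthogonal_J] at h1
  apply mul_right_cancel₀ (hp u hu).ne'
  linear_combination -h1 + h2

end Curvature


/-! ### The Levi-Civita connection in a chart -/

section LeviCivita

variable {E : Type*} [NormedAddCommGroup E] [NormedSpace ℝ E]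

theorem fderiv_fderiv_symm {F : Type*} [NormedAddCommGroup F] [NormedSpace ℝ F] {f : E → F} {x : E}
    (hf : ContDiffAt ℝ ∞ f x) (u v : E) :
    fderiv ℝ (fderiv ℝ f) x u v = fderiv ℝ (fderiv ℝ f) x v u := by
  have : IsSymmSndFDerivAt ℝ f x := hf.isSymmSndFDerivAt (by
    rw [minSmoothness_of_isRCLikeNormedField]; exact ENat.LEInfty.out)
  exact this u v

theorem ContDiffAt.hasFDerivAt_fderiv {F : Type*} [NormedAddCommGroup F] [NormedSpace ℝ F]
    {f : E → F} {x : E} (hf : ContDiffAt ℝ ∞ f x) :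
    HasFDerivAt (fderiv ℝ f) (fderiv ℝ (fderiv ℝ f) x) x :=
  ((hf.fderiv_right (m := 1) (WithTop.coe_le_coe.2 (le_top : (1 + 1 : ℕ∞) ≤ ⊤))).differentiableAt (by simp)).hasFDerivAt

/-- `g` is a smooth Riemannian metric on the set `U`. -/
structure IsMetricOn (U : Set E) (g : E → E →L[ℝ] E →L[ℝ] ℝ) : Prop where
  contDiffOn : ContDiffOn ℝ ∞ g U
  symm : ∀ x ∈ U, ∀ u v, g x u v = g x v u
  pos : ∀ x ∈ U, ∀ v, v ≠ 0 → 0 < g x v v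

namespace IsMetricOn

variable {U : Set E} {g : E → E →L[ℝ] E →L[ℝ] ℝ} {x : E}

theorem contDiffAt (hg : IsMetricOn U g) (hU : IsOpen U) (hx : x ∈ U) : ContDiffAt ℝ ∞ g x :=
  hg.contDiffOn.contDiffAt (hU.mem_nhds hx)

theorem hasFDerivAt (hg : IsMetricOn U g) (hU : IsOpen U) (hx : x ∈ U) :
    HasFDerivAt g (fderiv ℝ g x) x :=
  ((hg.contDiffAt hU hx).differentiableAt (by simp)).hasFDerivAt

theorem fderiv_symm (hg : IsMetricOn U g) (hU : IsOpen U) (hx : x ∈ U) (u v w : E) :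
    fderiv ℝ g x u v w = fderiv ℝ g x u w v := by
  have h1 := ((hg.hasFDerivAt hU hx).clm_apply (hasFDerivAt_const v x)).clm_apply
    (hasFDerivAt_const w x)
  have h2 := ((hg.hasFDerivAt hU hx).clm_apply (hasFDerivAt_const w x)).clm_apply
    (hasFDerivAt_const v x)
  have h3 : (fun y => g y v w) =ᶠ[nhds x] fun y => g y w v := by
    filter_upwards [hU.mem_nhds hx] with y hy using hg.symm y hy v w
  have := congrArg (fun f : E →L[ℝ] ℝ => f u) (h1.unique (h2.congr_of_eventuallyEq h3))
  simpa using this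

theorem christoffel_symm (hg : IsMetricOn U g) (hU : IsOpen U) (hx : x ∈ U) (u v : E) :
    christoffel g x u v = christoffel g x v u := by
  rw [christoffel_apply, christoffel_apply]
  congr 1
  ext w
  rw [koszul_apply, koszul_apply, hg.fderiv_symm hU hx w u v]
  ring

variable [FiniteDimensional ℝ E]

theorem form_christoffel (hg : IsMetricOn U g) (hx : x ∈ U) (u v w : E) :
    g x (christoffel g x u v) w = koszul g x u v w :=
  form_inverse_apply (hg.pos x hx) _ w

/-- The connection is metric; all the later covariant calculations replace derivatives of `g` by
Christoffel symbols through this formula. -/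
theorem fderiv_eq (hg : IsMetricOn U g) (hU : IsOpen U) (hx : x ∈ U) (u v w : E) :
    fderiv ℝ g x u v w = g x (christoffel g x u v) w + g x v (christoffel g x u w) := by
  rw [hg.symm x hx v, hg.form_christoffel hx, hg.form_christoffel hx, koszul_apply, koszul_apply,
    hg.fderiv_symm hU hx u v w, hg.fderiv_symm hU hx w, hg.fderiv_symm hU hx v u w]
  ring

theorem contDiffAt_inverse (hg : IsMetricOn U g) (hU : IsOpen U) (hx : x ∈ U) :
    ContDiffAt ℝ ∞ (fun y => (g y).inverse) x := by
  obtain ⟨e, he⟩ := isInvertible_of_form_pos (hg.pos x hx)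
  have := contDiffAt_map_inverse (𝕜 := ℝ) (n := ∞) e
  rw [he] at this
  exact this.comp x (hg.contDiffAt hU hx)

set_option synthInstance.maxHeartbeats 200000 in
theorem contDiffAt_christoffel (hg : IsMetricOn U g) (hU : IsOpen U) (hx : x ∈ U) :
    ContDiffAt ℝ ∞ (christoffel g) x := by
  have hd : ContDiffAt ℝ ∞ (fderiv ℝ g) x := (hg.contDiffAt hU hx).fderiv_right (by simp)
  have hk : ContDiffAt ℝ ∞ (koszul g) x := by
    unfold koszul
    have h1 : ContDiffAt ℝ ∞ (fun y => (fderiv ℝ g y).flip) x :=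
      (ContinuousLinearMap.flipₗᵢ ℝ E E (E →L[ℝ] ℝ)).contDiff.contDiffAt.comp x hd
    exact ((hd.add h1).sub (contDiffAt_const.clm_comp h1)).const_smul _
  exact ((ContinuousLinearMap.compL ℝ E (E →L[ℝ] ℝ) E).contDiff.contDiffAt.comp x
    (hg.contDiffAt_inverse hU hx)).clm_comp hk

theorem hasFDerivAt_christoffel (hg : IsMetricOn U g) (hU : IsOpen U) (hx : x ∈ U) :
    HasFDerivAt (christoffel g) (fderiv ℝ (christoffel g) x) x :=
  ((hg.contDiffAt_christoffel hU hx).differentiableAt (by simp)).hasFDerivAt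

theorem fderiv_christoffel_symm (hg : IsMetricOn U g) (hU : IsOpen U) (hx : x ∈ U) (u v w : E) :
    fderiv ℝ (christoffel g) x u v w = fderiv ℝ (christoffel g) x u w v := by
  have h1 := ((hg.hasFDerivAt_christoffel hU hx).clm_apply (hasFDerivAt_const v x)).clm_apply
    (hasFDerivAt_const w x)
  have h2 := ((hg.hasFDerivAt_christoffel hU hx).clm_apply (hasFDerivAt_const w x)).clm_apply
    (hasFDerivAt_const v x)
  have h3 : (fun y => christoffel g y v w) =ᶠ[nhds x] fun y => christoffel g y w v := by
    filter_upwards [hU.mem_nhds hx] with y hy using hg.christoffel_symm hU hy v w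
  have := congrArg (fun f : E →L[ℝ] E => f u) (h1.unique (h2.congr_of_eventuallyEq h3))
  simpa using this

end IsMetricOn

/-- The curvature tensor as a trilinear map. -/
def curvatureTensor (g : E → E →L[ℝ] E →L[ℝ] ℝ) (x : E) : E →ₗ[ℝ] E →ₗ[ℝ] E →ₗ[ℝ] E :=
  LinearMap.mk₂ ℝ (fun u v => (curvature g x u v).toLinearMap)
    (fun u u' v => by rw [curvature_add]; rfl)
    (fun c u v => by rw [curvature_smul]; rfl)
    (fun u v v' => by
      rw [curvature_swap g x (v + v'), curvature_add, neg_add, ← curvature_swap, ← curvature_swap]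
      rfl)
    (fun c u v => by
      rw [curvature_swap g x (c • v), curvature_smul, ← smul_neg, ← curvature_swap]
      rfl)

theorem curvatureTensor_apply (g : E → E →L[ℝ] E →L[ℝ] ℝ) (x u v w : E) :
    curvatureTensor g x u v w = curvature g x u v w := rfl

theorem ricciForm_curvatureTensor [FiniteDimensional ℝ E] (g : E → E →L[ℝ] E →L[ℝ] ℝ)
    (x v w : E) :
    IsCurvatureTensor.ricciForm (curvatureTensor g x) v w = ricci g x v w := rfl

namespace IsMetricOn

variable {U : Set E} {g : E → E →L[ℝ] E →L[ℝ] ℝ} {x : E} [FiniteDimensional ℝ E]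

theorem isCurvatureTensor (hg : IsMetricOn U g) (hU : IsOpen U) (hx : x ∈ U) :
    IsCurvatureTensor (g x) (curvatureTensor g x) where
  swap u v w := by
    rw [curvatureTensor_apply, curvature_swap]
    rfl
  bianchi u v w := by
    simp only [curvatureTensor_apply, curvature_apply]
    rw [hg.fderiv_christoffel_symm hU hx u w v, hg.fderiv_christoffel_symm hU hx w v u,
      hg.fderiv_christoffel_symm hU hx v u w, hg.christoffel_symm hU hx u w,
      hg.christoffel_symm hU hx w v, hg.christoffel_symm hU hx v u]
    abel
  skew z u v w := by
    -- Differentiating metric compatibility once more expresses the second derivative of `g` through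
    -- the connection. Its symmetry in `z` and `u` is the skew symmetry of the curvature operator.
    have key : ∀ z u, fderiv ℝ (fderiv ℝ g) x z u v w
        = fderiv ℝ g x z (christoffel g x u v) w + g x (fderiv ℝ (christoffel g) x z u v) w
          + (fderiv ℝ g x z v (christoffel g x u w)
            + g x v (fderiv ℝ (christoffel g) x z u w)) := by
      intro z u
      have h1 := (((ContDiffAt.hasFDerivAt_fderiv (hg.contDiffAt hU hx)).clm_apply
        (hasFDerivAt_const u x)).clm_apply (hasFDerivAt_const v x)).clm_apply
        (hasFDerivAt_const w x)
      have hG := hg.hasFDerivAt hU hx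
      have hC : ∀ v, HasFDerivAt (fun y => christoffel g y u v)
          (((fderiv ℝ (christoffel g) x).flip u).flip v) x := by
        intro v
        convert ((hg.hasFDerivAt_christoffel hU hx).clm_apply (hasFDerivAt_const u x)).clm_apply
          (hasFDerivAt_const v x) using 1
        ext z
        simp
      have h2 := ((hG.clm_apply (hC v)).clm_apply (hasFDerivAt_const w x)).add
        ((hG.clm_apply (hasFDerivAt_const v x)).clm_apply (hC w))
      have h3 : (fun y => fderiv ℝ g y u v w) =ᶠ[nhds x] fun y =>
          g y (christoffel g y u v) w + g y v (christoffel g y u w) := by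
        filter_upwards [hU.mem_nhds hx] with y hy using hg.fderiv_eq hU hy u v w
      have := congrArg (fun f : E →L[ℝ] ℝ => f z) (h1.unique (h2.congr_of_eventuallyEq h3))
      simp at this
      rw [this]
      ring
    have h1 := key z u
    have h2 := key u z
    rw [fderiv_fderiv_symm (hg.contDiffAt hU hx), h2] at h1
    simp only [hg.fderiv_eq hU hx] at h1
    rw [hg.symm x hx (curvatureTensor g x z u w) v]
    simp only [curvatureTensor_apply, curvature_apply, map_add, map_sub, add_apply, sub_apply]
    linarith

end IsMetricOn

/-- The curvature forms of the bundle spanned by `I`, `J`, `K` are determined by the connection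
forms `α`, `β`, `γ`. -/
theorem curvature_comp_sub [FiniteDimensional ℝ E] {U : Set E} {g : E → E →L[ℝ] E →L[ℝ] ℝ} {x : E}
    {I J K : E → E →L[ℝ] E} {α β γ : E → E →L[ℝ] ℝ} (hU : IsOpen U) (hx : x ∈ U)
    (hg : IsMetricOn U g) (hI : ContDiffOn ℝ ∞ I U) (hJ : ContDiffOn ℝ ∞ J U)
    (hK : ContDiffOn ℝ ∞ K U) (hβ : ContDiffOn ℝ ∞ β U)
    (hγ : ContDiffOn ℝ ∞ γ U)
    (dI : ∀ y ∈ U, ∀ u, covEnd g I y u = γ y u • J y - β y u • K y)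
    (dJ : ∀ y ∈ U, ∀ u, covEnd g J y u = α y u • K y - γ y u • I y)
    (dK : ∀ y ∈ U, ∀ u, covEnd g K y u = β y u • I y - α y u • J y) (u v w : E) :
    curvature g x u v (I x w) - I x (curvature g x u v w)
      = (extDerivOne γ x u v + (α x u * β x v - α x v * β x u)) • J x w
        - (extDerivOne β x u v + (γ x u * α x v - γ x v * α x u)) • K x w := by
  have hd : ∀ {A : E → E →L[ℝ] E}, ContDiffOn ℝ ∞ A U → HasFDerivAt A (fderiv ℝ A x) x :=
    fun hA => ((hA.contDiffAt (hU.mem_nhds hx)).differentiableAt (by simp)).hasFDerivAt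
  have hd' : ∀ {A : E → E →L[ℝ] ℝ}, ContDiffOn ℝ ∞ A U → HasFDerivAt A (fderiv ℝ A x) x :=
    fun hA => ((hA.contDiffAt (hU.mem_nhds hx)).differentiableAt (by simp)).hasFDerivAt
  have eI : ∀ y ∈ U, ∀ u w, fderiv ℝ I y u w = γ y u • J y w - β y u • K y w
      - christoffel g y u (I y w) + I y (christoffel g y u w) := by
    intro y hy u w
    have := congrArg (fun f : E →L[ℝ] E => f w) (dI y hy u)
    simp only [covEnd, sub_apply, add_apply, smul_apply, ContinuousLinearMap.comp_apply] at this
    rw [← this]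
    abel
  have eJ : ∀ u w, fderiv ℝ J x u w = α x u • K x w - γ x u • I x w
      - christoffel g x u (J x w) + J x (christoffel g x u w) := by
    intro u w
    have := congrArg (fun f : E →L[ℝ] E => f w) (dJ x hx u)
    simp only [covEnd, sub_apply, add_apply, smul_apply, ContinuousLinearMap.comp_apply] at this
    rw [← this]
    abel
  have eK : ∀ u w, fderiv ℝ K x u w = β x u • I x w - α x u • J x w
      - christoffel g x u (K x w) + K x (christoffel g x u w) := by
    intro u w
    have := congrArg (fun f : E →L[ℝ] E => f w) (dK x hx u)
    simp only [covEnd, sub_apply, add_apply, smul_apply, ContinuousLinearMap.comp_apply] at this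
    rw [← this]
    abel
  -- The equation for `∇I`, solved for the derivative of `I`, is differentiated again.
  -- Antisymmetrizing in `u`, `v` removes the second derivative of `I` and leaves the commutator of
  -- the curvature with `I`.
  have key : ∀ u v, fderiv ℝ (fderiv ℝ I) x u v w
      = fderiv ℝ γ x u v • J x w + γ x v • fderiv ℝ J x u w
        - (fderiv ℝ β x u v • K x w + β x v • fderiv ℝ K x u w)
        - (fderiv ℝ (christoffel g) x u v (I x w) + christoffel g x v (fderiv ℝ I x u w))
        + (fderiv ℝ I x u (christoffel g x v w) + I x (fderiv ℝ (christoffel g) x u v w)) := by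
    intro u v
    have h1 := ((ContDiffAt.hasFDerivAt_fderiv (hI.contDiffAt (hU.mem_nhds hx))).clm_apply
      (hasFDerivAt_const v x)).clm_apply (hasFDerivAt_const w x)
    have c0 := (hg.hasFDerivAt_christoffel hU hx).clm_apply (hasFDerivAt_const v x)
    have cI := (hd hI).clm_apply (hasFDerivAt_const w x)
    have h2 := ((((hd' hγ).clm_apply (hasFDerivAt_const v x)).smul
      ((hd hJ).clm_apply (hasFDerivAt_const w x))).sub
      (((hd' hβ).clm_apply (hasFDerivAt_const v x)).smul
        ((hd hK).clm_apply (hasFDerivAt_const w x)))).sub (c0.clm_apply cI)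
    have h2' := h2.add ((hd hI).clm_apply (c0.clm_apply (hasFDerivAt_const w x)))
    have h3 : (fun y => fderiv ℝ I y v w) =ᶠ[nhds x] fun y => γ y v • J y w - β y v • K y w
        - christoffel g y v (I y w) + I y (christoffel g y v w) := by
      filter_upwards [hU.mem_nhds hx] with y hy using eI y hy v w
    have := congrArg (fun f : E →L[ℝ] E => f u) (h1.unique (h2'.congr_of_eventuallyEq h3))
    simp at this
    rw [this]
    abel
  have h1 := key u v
  rw [fderiv_fderiv_symm (hI.contDiffAt (hU.mem_nhds hx)), key v u] at h1
  simp only [eI x hx, eJ, eK, smul_sub, smul_add, map_sub, map_add, map_smul] at h1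
  simp only [curvature_apply, map_add, map_sub, extDerivOne]
  rw [← sub_eq_zero] at h1 ⊢
  rw [← h1]
  module

end LeviCivita


/-! ### Hyper-Hermitian structures on open sets -/

section HyperHermitian

variable {E : Type*} [NormedAddCommGroup E] [NormedSpace ℝ E]

theorem covEnd_add (g : E → E →L[ℝ] E →L[ℝ] ℝ) (A : E → E →L[ℝ] E) (x u v : E) :
    covEnd g A x (u + v) = covEnd g A x u + covEnd g A x v := by
  simp only [covEnd, map_add, ContinuousLinearMap.add_comp, ContinuousLinearMap.comp_add]
  abel

theorem covEnd_smul (g : E → E →L[ℝ] E →L[ℝ] ℝ) (A : E → E →L[ℝ] E) (x : E) (c : ℝ) (u : E) :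
    covEnd g A x (c • u) = c • covEnd g A x u := by
  simp only [covEnd, map_smul, ContinuousLinearMap.smul_comp, ContinuousLinearMap.comp_smul,
    smul_sub, smul_add]

theorem covEnd_comp (g : E → E →L[ℝ] E →L[ℝ] ℝ) {A B : E → E →L[ℝ] E} {x : E}
    (hA : DifferentiableAt ℝ A x) (hB : DifferentiableAt ℝ B x) (u : E) :
    covEnd g (fun y => A y ∘L B y) x u = covEnd g A x u ∘L B x + A x ∘L covEnd g B x u := by
  have h := (hA.hasFDerivAt.clm_comp hB.hasFDerivAt).fderiv
  ext w
  simp only [covEnd, h]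
  simp
  abel

theorem covEnd_congr (g : E → E →L[ℝ] E →L[ℝ] ℝ) {A B : E → E →L[ℝ] E} {x : E}
    (h : A =ᶠ[nhds x] B) (u : E) : covEnd g A x u = covEnd g B x u := by
  rw [covEnd, covEnd, h.fderiv_eq, h.eq_of_nhds]

theorem covEnd_neg_id (g : E → E →L[ℝ] E →L[ℝ] ℝ) (x u : E) :
    covEnd g (fun _ => -ContinuousLinearMap.id ℝ E) x u = 0 := by
  ext w
  simp [covEnd]

/-- The vectors `v`, `I v`, `J v`, `K v` are pairwise orthogonal of equal length, so pairing the
relation with each of them isolates one coefficient. This is how identities between endomorphisms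
are turned into identities between connection forms. -/
theorem IsHyperHermitianTriple.linearIndependent {V : Type*} [NormedAddCommGroup V]
    [NormedSpace ℝ V] {b : V →L[ℝ] V →L[ℝ] ℝ} {I J K : V →L[ℝ] V}
    (h : IsHyperHermitianTriple b I J K)
    (hs : ∀ u v, b u v = b v u) (hp : ∀ v, v ≠ 0 → 0 < b v v) {v : V} (hv : v ≠ 0) {p q r s : ℝ}
    (h0 : p • v + q • I v + r • J v + s • K v = 0) : p = 0 ∧ q = 0 ∧ r = 0 ∧ s = 0 := by
  have hv' := (hp v hv).ne'
  have e1 := h.form_I_self hs v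
  have e2 := h.form_J_self hs v
  have e3 := h.form_K_self hs v
  have e4 : b (I v) (J v) = 0 := by rw [h.skew_I, h.IJ, hs, e3, neg_zero]
  have e5 : b (J v) (K v) = 0 := by rw [h.skew_J, h.JK, hs, e1, neg_zero]
  have e6 : b (K v) (I v) = 0 := by rw [h.skew_K, h.KI, hs, e2, neg_zero]
  have t : ∀ w, p * b v w + q * b (I v) w + r * b (J v) w + s * b (K v) w = 0 := by
    intro w
    have := congrArg (fun x => b x w) h0
    simpa using this
  have t1 := t v
  have t2 := t (I v)
  have t3 := t (J v)
  have t4 := t (K v)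
  rw [e1, e2, e3] at t1
  rw [hs v, e1, hs (J v), e4, e6, h.orthogonal_I] at t2
  rw [hs v, e2, e4, hs (K v), e5, h.orthogonal_J] at t3
  rw [hs v, e3, hs (I v), e6, e5, h.orthogonal_K] at t4
  simp only [mul_zero, add_zero, zero_add, mul_eq_zero, hv', or_false] at t1 t2 t3 t4
  exact ⟨t1, t2, t3, t4⟩

/-- `(g, I, J, K)` is a smooth almost hyper-Hermitian structure on the set `U`. -/
structure IsAlmostHyperHermitianOn (U : Set E) (g : E → E →L[ℝ] E →L[ℝ] ℝ)
    (I J K : E → E →L[ℝ] E) : Prop where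
  metric : IsMetricOn U g
  contDiffOn_I : ContDiffOn ℝ ∞ I U
  contDiffOn_J : ContDiffOn ℝ ∞ J U
  contDiffOn_K : ContDiffOn ℝ ∞ K U
  triple : ∀ x ∈ U, IsHyperHermitianTriple (g x) (I x) (J x) (K x)

namespace IsAlmostHyperHermitianOn

variable {U : Set E} {g : E → E →L[ℝ] E →L[ℝ] ℝ} {I J K : E → E →L[ℝ] E} {x : E}

theorem rotate (h : IsAlmostHyperHermitianOn U g I J K) : IsAlmostHyperHermitianOn U g J K I :=
  ⟨h.metric, h.contDiffOn_J, h.contDiffOn_K, h.contDiffOn_I, fun x hx => (h.triple x hx).rotate⟩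

theorem differentiableAt_I (h : IsAlmostHyperHermitianOn U g I J K) (hU : IsOpen U) (hx : x ∈ U) :
    DifferentiableAt ℝ I x :=
  (h.contDiffOn_I.contDiffAt (hU.mem_nhds hx)).differentiableAt (by simp)

theorem covEnd_I_comp_self (h : IsAlmostHyperHermitianOn U g I J K) (hU : IsOpen U) (hx : x ∈ U)
    (u w : E) : covEnd g I x u (I x w) + I x (covEnd g I x u w) = 0 := by
  have h1 : (fun y => I y ∘L I y) =ᶠ[nhds x] fun _ => -ContinuousLinearMap.id ℝ E := by
    filter_upwards [hU.mem_nhds hx] with y hy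
    ext w
    simp [(h.triple y hy).I_sq]
  have h2 := covEnd_comp g (h.differentiableAt_I hU hx) (h.differentiableAt_I hU hx) u
  rw [covEnd_congr g h1, covEnd_neg_id] at h2
  exact (congrArg (fun f : E →L[ℝ] E => f w) h2).symm

theorem covEnd_K (h : IsAlmostHyperHermitianOn U g I J K) (hU : IsOpen U) (hx : x ∈ U)
    (u w : E) : covEnd g K x u w = covEnd g I x u (J x w) + I x (covEnd g J x u w) := by
  have h1 : (fun y => I y ∘L J y) =ᶠ[nhds x] K := by
    filter_upwards [hU.mem_nhds hx] with y hy
    ext w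
    simp [(h.triple y hy).IJ]
  have h2 := covEnd_comp g (h.differentiableAt_I hU hx) (h.rotate.differentiableAt_I hU hx) u
  rw [covEnd_congr g h1] at h2
  exact congrArg (fun f : E →L[ℝ] E => f w) h2

/-- The connection forms of a parallel bundle `span {I, J, K}`, for one tangent vector. -/
theorem exists_covEnd_eq [Nontrivial E] (h : IsAlmostHyperHermitianOn U g I J K) (hU : IsOpen U)
    (hx : x ∈ U)
    (u : E) (hI : covEnd g I x u ∈ Submodule.span ℝ {I x, J x, K x})
    (hJ : covEnd g J x u ∈ Submodule.span ℝ {I x, J x, K x})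
    (hK : covEnd g K x u ∈ Submodule.span ℝ {I x, J x, K x}) :
    ∃ a b c : ℝ, covEnd g I x u = c • J x - b • K x ∧ covEnd g J x u = a • K x - c • I x ∧
      covEnd g K x u = b • I x - a • J x := by
  obtain ⟨v, hv⟩ := exists_ne (0 : E)
  have ht := h.triple x hx
  have hli := fun {p q r s : ℝ} =>
    ht.linearIndependent (h.metric.symm x hx) (h.metric.pos x hx) hv (p := p) (q := q) (r := r)
      (s := s)
  obtain ⟨i1, i2, i3, ei⟩ := Submodule.mem_span_triple.1 hI
  obtain ⟨j1, j2, j3, ej⟩ := Submodule.mem_span_triple.1 hJ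
  obtain ⟨k1, k2, k3, ek⟩ := Submodule.mem_span_triple.1 hK
  -- Differentiating `I² = -1`, `J² = -1` and `IJ = K` makes the matrix of coefficients of `∇I`,
  -- `∇J`, `∇K` skew.
  have r1 := h.covEnd_I_comp_self hU hx u v
  have r2 := h.rotate.covEnd_I_comp_self hU hx u v
  have r3 := h.covEnd_K hU hx u v
  rw [← ei] at r1
  rw [← ej] at r2
  rw [← ei, ← ej, ← ek] at r3
  simp only [add_apply, smul_apply, map_add, map_smul, ht.I_sq, ht.J_sq, ht.IJ, ht.JK,
    ht.KI, ht.JI, ht.IK, ht.KJ] at r1 r2 r3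
  have q1 := (hli (p := -2 * i1) (q := 0) (r := 0) (s := 0)
    (by rw [← r1]; module)).1
  have q2 := (hli (p := -2 * j2) (q := 0) (r := 0) (s := 0)
    (by rw [← r2]; module)).1
  rw [← sub_eq_zero] at r3
  obtain ⟨q3, q4, q5, q6⟩ := hli (p := i2 + j1) (q := k1 + i3) (r := k2 + j3) (s := k3 + i1 * 0 - i1 - j2)
    (by rw [← r3]; module)
  have e1 : i1 = 0 := by linarith
  have e2 : j2 = 0 := by linarith
  have e3 : k3 = 0 := by linarith
  have e4 : j1 = -i2 := by linarith
  have e5 : k1 = -i3 := by linarith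
  have e6 : k2 = -j3 := by linarith
  refine ⟨j3, -i3, i2, ?_, ?_, ?_⟩
  · rw [← ei, e1]; module
  · rw [← ej, e2, e4]; module
  · rw [← ek, e3, e5, e6]; module

/-- The consequence of the integrability of `I` for the connection forms. -/
theorem connectionForm_comp_of_integrable [FiniteDimensional ℝ E] [Nontrivial E]
    (h : IsAlmostHyperHermitianOn U g I J K) (hU : IsOpen U)
    (hx : x ∈ U) {β γ : E →ₗ[ℝ] ℝ} (hI : ∀ u, covEnd g I x u = γ u • J x - β u • K x)
    (hint : IsIntegrableAt I x) (u : E) : γ (I x u) = β u := by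
  by_cases hu : u = 0
  · simp [hu]
  have ht := h.triple x hx
  have hd : ∀ u v, fderiv ℝ (fun y => I y u) x v = fderiv ℝ I x v u := by
    intro u v
    rw [((h.differentiableAt_I hU hx).hasFDerivAt.clm_apply (hasFDerivAt_const u x)).fderiv]
    simp
  have e : ∀ u w, fderiv ℝ I x u w = γ u • J x w - β u • K x w
      - christoffel g x u (I x w) + I x (christoffel g x u w) := by
    intro u w
    have := congrArg (fun f : E →L[ℝ] E => f w) (hI u)
    simp only [covEnd, sub_apply, add_apply, smul_apply, ContinuousLinearMap.comp_apply] at this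
    rw [← this]
    abel
  -- In the Nijenhuis tensor at `(u, Ju)` all Christoffel terms cancel by symmetry. What remains is
  -- a combination of `u`, `I u`, `J u`, `K u`, and its `u`-component is `β u - γ (I u)`.
  have h1 := hint u (J x u)
  simp only [VectorField.lieBracket, hd, fderiv_fun_const, Pi.zero_apply, zero_apply, e, map_sub,
    map_add, map_smul, ht.IJ, ht.IK, ht.J_sq, ht.KJ, ht.I_sq, map_neg] at h1
  rw [h.metric.christoffel_symm hU hx (K x u) (I x u),
    h.metric.christoffel_symm hU hx (J x u) (I x u),
    h.metric.christoffel_symm hU hx (J x u) u,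
    h.metric.christoffel_symm hU hx (K x u) u] at h1
  have h2 := ht.linearIndependent (h.metric.symm x hx) (h.metric.pos x hx) hu
    (p := β u - γ (I x u)) (q := β (I x u) + γ u) (r := β (J x u) - γ (K x u))
    (s := β (K x u) + γ (J x u)) (by rw [← h1]; module)
  linarith [h2.1]

end IsAlmostHyperHermitianOn

end HyperHermitian


/-! ### The Lee form -/

section LeeForm

variable {E : Type*} [NormedAddCommGroup E] [NormedSpace ℝ E]
  {U : Set E} {g : E → E →L[ℝ] E →L[ℝ] ℝ} {I J K : E → E →L[ℝ] E} {x : E}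

theorem leeForm_apply [FiniteDimensional ℝ E] (g : E → E →L[ℝ] E →L[ℝ] ℝ) (I : E → E →L[ℝ] E)
    (x v : E) (T : E →ₗ[ℝ] E) (hT : ∀ u, T u = I x (covEnd g I x u v)) :
    leeForm g I x v = 1 / 2 * LinearMap.trace ℝ E T := by
  have : T = { toFun := fun u => I x (covEnd g I x u v)
               map_add' := fun a b => by simp [covEnd]; abel
               map_smul' := fun c a => by simp [covEnd, smul_sub] } := by
    ext u
    exact hT u
  rw [this]
  rfl

/-- The covariant derivatives of the complex structures of a hyper-Hermitian manifold with
parallel bundle `span {I, J, K}`, in terms of the Lee form. -/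
theorem IsAlmostHyperHermitianOn.covEnd_eq_leeForm [FiniteDimensional ℝ E] [Nontrivial E]
    (h : IsAlmostHyperHermitianOn U g I J K) (hU : IsOpen U) (hx : x ∈ U)
    (hI : ∀ u, covEnd g I x u ∈ Submodule.span ℝ {I x, J x, K x})
    (hJ : ∀ u, covEnd g J x u ∈ Submodule.span ℝ {I x, J x, K x})
    (hK : ∀ u, covEnd g K x u ∈ Submodule.span ℝ {I x, J x, K x})
    (nI : IsIntegrableAt I x) (nJ : IsIntegrableAt J x) (nK : IsIntegrableAt K x) :
    (∀ u, covEnd g I x u = -leeForm g I x (K x u) • J x + leeForm g I x (J x u) • K x) ∧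
    (∀ u, covEnd g J x u = -leeForm g I x (I x u) • K x + leeForm g I x (K x u) • I x) ∧
    (∀ u, covEnd g K x u = -leeForm g I x (J x u) • I x + leeForm g I x (I x u) • J x) := by
  have ht := h.triple x hx
  obtain ⟨v, hv⟩ := exists_ne (0 : E)
  have hli := fun {p q r s : ℝ} =>
    ht.linearIndependent (h.metric.symm x hx) (h.metric.pos x hx) hv (p := p) (q := q) (r := r)
      (s := s)
  choose a b c e1 e2 e3 using fun u => h.exists_covEnd_eq hU hx u (hI u) (hJ u) (hK u)
  -- The connection forms were chosen separately for each tangent vector; their linearity is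
  -- recovered from that of `u ↦ ∇_u I` and `u ↦ ∇_u J` by linear independence.
  have lin1 : ∀ u u', c (u + u') = c u + c u' ∧ b (u + u') = b u + b u' := by
    intro u u'
    have := congrArg (fun f : E →L[ℝ] E => f v) (covEnd_add g I x u u')
    simp only [e1, sub_apply, add_apply, smul_apply] at this
    rw [← sub_eq_zero] at this
    obtain ⟨-, -, h1, h2⟩ := hli (p := 0) (q := 0) (r := c (u + u') - (c u + c u'))
      (s := b u + b u' - b (u + u')) (by rw [← this]; module)
    constructor <;> linarith
  have lin2 : ∀ u u', a (u + u') = a u + a u' := by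
    intro u u'
    have := congrArg (fun f : E →L[ℝ] E => f v) (covEnd_add g J x u u')
    simp only [e2, sub_apply, add_apply, smul_apply] at this
    rw [← sub_eq_zero] at this
    obtain ⟨-, -, -, h2⟩ := hli (p := 0) (q := c u + c u' - c (u + u')) (r := 0)
      (s := a (u + u') - (a u + a u')) (by rw [← this]; module)
    linarith
  have lin3 : ∀ (t : ℝ) u, c (t • u) = t * c u ∧ b (t • u) = t * b u := by
    intro t u
    have := congrArg (fun f : E →L[ℝ] E => f v) (covEnd_smul g I x t u)
    simp only [e1, sub_apply, smul_apply] at this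
    rw [← sub_eq_zero] at this
    obtain ⟨-, -, h1, h2⟩ := hli (p := 0) (q := 0) (r := c (t • u) - t * c u)
      (s := t * b u - b (t • u)) (by rw [← this]; module)
    constructor <;> linarith
  have lin4 : ∀ (t : ℝ) u, a (t • u) = t * a u := by
    intro t u
    have := congrArg (fun f : E →L[ℝ] E => f v) (covEnd_smul g J x t u)
    simp only [e2, sub_apply, smul_apply] at this
    rw [← sub_eq_zero] at this
    obtain ⟨-, -, -, h2⟩ := hli (p := 0) (q := t * c u - c (t • u)) (r := 0)
      (s := a (t • u) - t * a u) (by rw [← this]; module)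
    linarith
  let a' : E →ₗ[ℝ] ℝ := ⟨⟨a, lin2⟩, lin4⟩
  let b' : E →ₗ[ℝ] ℝ := ⟨⟨b, fun u u' => (lin1 u u').2⟩, fun t u => (lin3 t u).2⟩
  let c' : E →ₗ[ℝ] ℝ := ⟨⟨c, fun u u' => (lin1 u u').1⟩, fun t u => (lin3 t u).1⟩
  have r1 : ∀ u, c (I x u) = b u :=
    h.connectionForm_comp_of_integrable hU hx (β := b') (γ := c') e1 nI
  have r2 : ∀ u, a (J x u) = c u :=
    h.rotate.connectionForm_comp_of_integrable hU hx (β := c') (γ := a') e2 nJ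
  have r3 : ∀ u, b (K x u) = a u :=
    h.rotate.rotate.connectionForm_comp_of_integrable hU hx (β := a') (γ := b') e3 nK
  have hneg : ∀ u, c (-u) = -c u := fun u => map_neg c' u
  -- Since `I (∇_w I) u = c(w) K u + b(w) J u`, half the trace is `(c (Ku) + b (Ju)) / 2`. The two
  -- summands agree, because integrability gives `b = c ∘ I`.
  have lee : ∀ u, leeForm g I x u = c (K x u) := by
    intro u
    rw [leeForm_apply g I x u (c'.smulRight (K x u) + b'.smulRight (J x u)), map_add,
      LinearMap.trace_smulRight, LinearMap.trace_smulRight]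
    · change 1 / 2 * (c (K x u) + b (J x u)) = _
      rw [← r1, ht.IJ]
      ring
    · intro w
      rw [e1]
      simp only [LinearMap.add_apply, LinearMap.smulRight_apply, sub_apply, smul_apply, map_sub,
        map_smul, ht.IJ, ht.IK, smul_neg, sub_neg_eq_add]
      rfl
  have k1 : ∀ u, leeForm g I x (K x u) = -c u := by
    intro u
    rw [lee, ht.K_sq, hneg]
  have k2 : ∀ u, leeForm g I x (J x u) = -b u := by
    intro u
    rw [lee, ht.KJ, hneg, r1]
  have k3 : ∀ u, leeForm g I x (I x u) = -a u := by
    intro u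
    rw [lee, ht.KI, ← r3, ← r1, ht.IK, hneg, neg_neg]
  refine ⟨fun u => ?_, fun u => ?_, fun u => ?_⟩
  · rw [e1, k1, k2]; module
  · rw [e2, k1, k3]; module
  · rw [e3, k2, k3]; module

/-- Instead of the trace, the component of `∇I` along `J` is used: for a fixed `w ≠ 0` the pairing
of `(∇_{Kv} I) w` with `J w` is the Lee form at `v` times `g(w, w)`, which is visibly smooth. -/
theorem IsAlmostHyperHermitianOn.contDiffOn_leeForm [FiniteDimensional ℝ E] [Nontrivial E]
    (h : IsAlmostHyperHermitianOn U g I J K) (hU : IsOpen U)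
    (hI : ∀ x ∈ U, ∀ u,
      covEnd g I x u = -leeForm g I x (K x u) • J x + leeForm g I x (J x u) • K x) :
    ContDiffOn ℝ ∞ (leeForm g I) U := by
  obtain ⟨w, hw⟩ := exists_ne (0 : E)
  rw [contDiffOn_clm_apply]
  intro v
  have key : ∀ x ∈ U, leeForm g I x v = g x (covEnd g I x (K x v) w) (J x w) / g x w w := by
    intro x hx
    have ht := h.triple x hx
    rw [eq_div_iff (h.metric.pos x hx w hw).ne', hI x hx, ht.K_sq]
    simp only [add_apply, smul_apply, map_add, map_neg, map_smul, smul_eq_mul, neg_neg]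
    rw [ht.orthogonal_J, ht.skew_K, ht.KJ, map_neg, h.metric.symm x hx w (I x w),
      ht.form_I_self (h.metric.symm x hx)]
    ring
  intro x hx
  have hg := h.metric.contDiffAt hU hx
  have hΓ := h.metric.contDiffAt_christoffel hU hx
  have cI := h.contDiffOn_I.contDiffAt (hU.mem_nhds hx)
  have cJ := h.contDiffOn_J.contDiffAt (hU.mem_nhds hx)
  have cK := h.contDiffOn_K.contDiffAt (hU.mem_nhds hx)
  have cdI : ContDiffAt ℝ ∞ (fderiv ℝ I) x := cI.fderiv_right (by simp)
  have cw : ∀ z : E, ContDiffAt ℝ ∞ (fun _ : E => z) x := fun z => contDiffAt_const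
  have cKv := cK.clm_apply (cw v)
  have cc : ContDiffAt ℝ ∞ (fun x => covEnd g I x (K x v) w) x := by
    have := (((cdI.clm_apply cKv).clm_apply (cw w)).add
      ((hΓ.clm_apply cKv).clm_apply (cI.clm_apply (cw w)))).sub
      (cI.clm_apply ((hΓ.clm_apply cKv).clm_apply (cw w)))
    exact this
  have := ((hg.clm_apply cc).clm_apply (cJ.clm_apply (cw w))).div
    ((hg.clm_apply (cw w)).clm_apply (cw w)) (h.metric.pos x hx w hw).ne'
  exact (this.congr_of_eventuallyEq (by
    filter_upwards [hU.mem_nhds hx] with y hy using key y hy)).contDiffWithinAt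

/-- `ψ` is the negative of the Lee form of a hyper-Hermitian quaternionic Kähler structure on `U`
with reduced scalar curvature `ν`: it is characterized up to first order by the curvature of the
connection forms `ψ ∘ I`, `ψ ∘ J`, `ψ ∘ K`. -/
structure IsHHqKOn (U : Set E) (g : E → E →L[ℝ] E →L[ℝ] ℝ) (I J K : E → E →L[ℝ] E)
    (ψ : E → E →L[ℝ] ℝ) (ν : ℝ) : Prop extends IsAlmostHyperHermitianOn U g I J K where
  contDiffOn_ψ : ContDiffOn ℝ ∞ ψ U
  curv_I : ∀ x ∈ U, ∀ u v, extDerivOne (fun y => ψ y ∘L I y) x u v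
    = -ν * g x (I x u) v - (ψ x (J x u) * ψ x (K x v) - ψ x (J x v) * ψ x (K x u))
  curv_J : ∀ x ∈ U, ∀ u v, extDerivOne (fun y => ψ y ∘L J y) x u v
    = -ν * g x (J x u) v - (ψ x (K x u) * ψ x (I x v) - ψ x (K x v) * ψ x (I x u))
  curv_K : ∀ x ∈ U, ∀ u v, extDerivOne (fun y => ψ y ∘L K y) x u v
    = -ν * g x (K x u) v - (ψ x (I x u) * ψ x (J x v) - ψ x (I x v) * ψ x (J x u))

/-- `extDerivOne` as a bilinear form, with a wedge product of two covectors added. -/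
def extDerivOneAddWedge (α : E → E →L[ℝ] ℝ) (p q : E →L[ℝ] ℝ) (x : E) : E →ₗ[ℝ] E →ₗ[ℝ] ℝ :=
  LinearMap.mk₂ ℝ (fun u v => extDerivOne α x u v + (p u * q v - p v * q u))
    (fun u u' v => by simp [extDerivOne]; ring)
    (fun c u v => by simp [extDerivOne]; ring)
    (fun u v v' => by simp [extDerivOne]; ring)
    (fun c u v => by simp [extDerivOne]; ring)

theorem extDerivOneAddWedge_apply (α : E → E →L[ℝ] ℝ) (p q : E →L[ℝ] ℝ) (x u v : E) :
    extDerivOneAddWedge α p q x u v = extDerivOne α x u v + (p u * q v - p v * q u) := rfl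

/-- The passage from the quaternionic Kähler condition to three first-order equations for `ψ`, the
only form in which it is used afterwards. The curvature of the connection forms `ψ ∘ I`, `ψ ∘ J`, `ψ
∘ K` has to be `-ν` times the Kähler forms. -/
theorem isHHqKOn_of_quaternionicKahler [FiniteDimensional ℝ E] [Nontrivial E] {n : ℕ} {ν : ℝ}
    (hd : Module.finrank ℝ E = 4 * n)
    (h : IsAlmostHyperHermitianOn U g I J K) (hU : IsOpen U)
    (hq : ∀ x ∈ U, IsQuaternionicKahlerAt n g I J K x)
    (nI : ∀ x ∈ U, IsIntegrableAt I x) (nJ : ∀ x ∈ U, IsIntegrableAt J x)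
    (nK : ∀ x ∈ U, IsIntegrableAt K x)
    (hscal : ∀ x ∈ U, scalarCurvature g x = 4 * n * (n + 2) * ν) :
    IsHHqKOn U g I J K (fun x => -leeForm g I x) ν := by
  have hn0 : 0 < n := by
    have : 0 < Module.finrank ℝ E := Module.finrank_pos
    omega
  have hcov := fun x (hx : x ∈ U) => h.covEnd_eq_leeForm hU hx (hq x hx).parallel_I
    (hq x hx).parallel_J (hq x hx).parallel_K (nI x hx) (nJ x hx) (nK x hx)
  have hlee : ContDiffOn ℝ ∞ (fun x => -leeForm g I x) U :=
    (h.contDiffOn_leeForm hU fun x hx => (hcov x hx).1).neg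
  set ψ : E → E →L[ℝ] ℝ := fun x => -leeForm g I x with hψ
  have hψ' : ∀ x u, leeForm g I x u = -ψ x u := fun x u => by simp [hψ]
  have cI : ContDiffOn ℝ ∞ (fun y => ψ y ∘L I y) U := hlee.clm_comp h.contDiffOn_I
  have cJ : ContDiffOn ℝ ∞ (fun y => ψ y ∘L J y) U := hlee.clm_comp h.contDiffOn_J
  have cK : ContDiffOn ℝ ∞ (fun y => ψ y ∘L K y) U := hlee.clm_comp h.contDiffOn_K
  have dI : ∀ y ∈ U, ∀ u,
      covEnd g I y u = (ψ y ∘L K y) u • J y - (ψ y ∘L J y) u • K y := by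
    intro y hy u
    rw [(hcov y hy).1, hψ', hψ']
    simp only [ContinuousLinearMap.comp_apply]
    module
  have dJ : ∀ y ∈ U, ∀ u,
      covEnd g J y u = (ψ y ∘L I y) u • K y - (ψ y ∘L K y) u • I y := by
    intro y hy u
    rw [(hcov y hy).2.1, hψ', hψ']
    simp only [ContinuousLinearMap.comp_apply]
    module
  have dK : ∀ y ∈ U, ∀ u,
      covEnd g K y u = (ψ y ∘L J y) u • I y - (ψ y ∘L I y) u • J y := by
    intro y hy u
    rw [(hcov y hy).2.2, hψ', hψ']
    simp only [ContinuousLinearMap.comp_apply]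
    module
  have main : ∀ x ∈ U, ∀ u v,
      (extDerivOneAddWedge (fun y => ψ y ∘L I y) (ψ x ∘L J x) (ψ x ∘L K x) x u v
        = -ν * g x (I x u) v) ∧
      (extDerivOneAddWedge (fun y => ψ y ∘L J y) (ψ x ∘L K x) (ψ x ∘L I x) x u v
        = -ν * g x (J x u) v) ∧
      (extDerivOneAddWedge (fun y => ψ y ∘L K y) (ψ x ∘L I x) (ψ x ∘L J x) x u v
        = -ν * g x (K x u) v) := by
    intro x hx
    have ht := h.triple x hx
    have hs := h.metric.symm x hx
    have hp := h.metric.pos x hx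
    have hR := h.metric.isCurvatureTensor hU hx
    have hQ : IsQuaternionicCurvature (I x) (J x) (K x) (curvatureTensor g x)
        (extDerivOneAddWedge (fun y => ψ y ∘L I y) (ψ x ∘L J x) (ψ x ∘L K x) x)
        (extDerivOneAddWedge (fun y => ψ y ∘L J y) (ψ x ∘L K x) (ψ x ∘L I x) x)
        (extDerivOneAddWedge (fun y => ψ y ∘L K y) (ψ x ∘L I x) (ψ x ∘L J x) x) :=
      ⟨fun u v w => by
        simpa only [curvatureTensor_apply, extDerivOneAddWedge_apply] using
          curvature_comp_sub hU hx h.metric h.contDiffOn_I h.contDiffOn_J h.contDiffOn_K cJ cK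
            dI dJ dK u v w,
      fun u v w => by
        simpa only [curvatureTensor_apply, extDerivOneAddWedge_apply] using
          curvature_comp_sub hU hx h.metric h.contDiffOn_J h.contDiffOn_K h.contDiffOn_I cK cI
            dJ dK dI u v w,
      fun u v w => by
        simpa only [curvatureTensor_apply, extDerivOneAddWedge_apply] using
          curvature_comp_sub hU hx h.metric h.contDiffOn_K h.contDiffOn_I h.contDiffOn_J cI cJ
            dK dI dJ u v w⟩
    intro u v
    by_cases hn : n = 1
    -- For `n = 1` the scalar curvature is `4 · 1 · 3 ν = 12 ν`.
    · have hsc : scalarCurvature g x / 12 = ν := by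
        rw [hscal x hx, hn]
        push_cast
        ring
      have comm : ∀ {A : E →L[ℝ] E},
          (∀ u v w, weylEinsteinFour g x u v (A w) = A (weylEinsteinFour g x u v w)) →
          ∀ u v w, curvatureTensor g x u v (A w) - ν • (g x v (A w) • u - g x u (A w) • v)
            = A (curvatureTensor g x u v w - ν • (g x v w • u - g x u w • v)) := by
        intro A hA u v w
        have := hA u v w
        simp only [weylEinsteinFour, hsc, sub_apply, smul_apply,
          ContinuousLinearMap.smulRight_apply] at this
        exact this
      exact ⟨curvatureForm_eq_of_commutes hs hp ht.rotate hQ.rotate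
          (comm ((hq x hx).selfDual_J hn)) u v,
        curvatureForm_eq_of_commutes hs hp ht.rotate.rotate hQ.rotate.rotate
          (comm ((hq x hx).selfDual_K hn)) u v,
        curvatureForm_eq_of_commutes hs hp ht hQ (comm ((hq x hx).selfDual_I hn)) u v⟩
    · have hn2 : 2 ≤ n := by omega
      obtain ⟨l, hl⟩ := hR.exists_ricciForm_eq hn2 hd hs hp ht hQ
      -- The trace of `l` times the identity is `4 n l`, to be compared with `4 n (n + 2) ν`.
      have hl' : l = (n + 2) * ν := by
        have h1 := hscal x hx
        have h2 : (g x).inverse.toLinearMap ∘ₗ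
            (LinearMap.toContinuousLinearMap (𝕜 := ℝ) (E := E) (F' := ℝ)).toLinearMap ∘ₗ ricci g x
            = l • LinearMap.id := by
          ext u
          simp only [LinearMap.comp_apply, LinearMap.smul_apply, LinearMap.id_apply]
          have : LinearMap.toContinuousLinearMap (ricci g x u) = l • g x u := by
            ext v
            simpa [ricciForm_curvatureTensor] using hl u v
          change (g x).inverse (LinearMap.toContinuousLinearMap (ricci g x u)) = _
          rw [this, map_smul, inverse_form_apply hp]
        rw [scalarCurvature, h2, map_smul, LinearMap.trace_id, hd] at h1
        push_cast at h1
        have : (4 * n : ℝ) ≠ 0 := by positivity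
        apply mul_left_cancel₀ this
        rw [smul_eq_mul] at h1
        linarith
      exact ⟨hR.curvatureForm_eq hn2 hd hs hp ht.rotate hQ.rotate hl hl' u v,
        hR.curvatureForm_eq hn2 hd hs hp ht.rotate.rotate hQ.rotate.rotate hl hl' u v,
        hR.curvatureForm_eq hn2 hd hs hp ht hQ hl hl' u v⟩
  refine ⟨h, hlee, fun x hx u v => ?_, fun x hx u v => ?_, fun x hx u v => ?_⟩
  · exact eq_sub_of_add_eq (main x hx u v).1
  · exact eq_sub_of_add_eq (main x hx u v).2.1
  · exact eq_sub_of_add_eq (main x hx u v).2.2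

end LeeForm


/-! ### Superposition and integral operators on spaces of continuous maps -/

section Superposition

universe u

variable {κ : Type*} [TopologicalSpace κ] [CompactSpace κ]
  {E F : Type u} [NormedAddCommGroup E] [NormedSpace ℝ E] [NormedAddCommGroup F] [NormedSpace ℝ F]

/-- Pointwise application of a continuous family of continuous linear maps. -/
def pointwiseApply (κ : Type*) [TopologicalSpace κ] [CompactSpace κ] (E F : Type*)
    [NormedAddCommGroup E] [NormedSpace ℝ E] [NormedAddCommGroup F] [NormedSpace ℝ F] :
    C(κ, E →L[ℝ] F) →L[ℝ] C(κ, E) →L[ℝ] C(κ, F) :=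
  LinearMap.mkContinuous₂
    (LinearMap.mk₂ ℝ (fun A h => ⟨fun t => A t (h t), by fun_prop⟩)
      (fun A A' h => by ext t; simp) (fun c A h => by ext t; simp)
      (fun A h h' => by ext t; simp) (fun c A h => by ext t; simp))
    1 fun A h => by
      rw [one_mul, ContinuousMap.norm_le _ (by positivity)]
      intro t
      exact (A t).le_of_opNorm_le_of_le (A.norm_coe_le_norm t) (h.norm_coe_le_norm t)

@[simp]
theorem pointwiseApply_apply (A : C(κ, E →L[ℝ] F)) (h : C(κ, E)) (t : κ) :
    pointwiseApply κ E F A h t = A t (h t) := rfl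

theorem norm_pointwiseApply_le (A : C(κ, E →L[ℝ] F)) (h : C(κ, E)) :
    ‖pointwiseApply κ E F A h‖ ≤ ‖A‖ * ‖h‖ := by
  rw [ContinuousMap.norm_le _ (by positivity)]
  intro t
  exact (A t).le_of_opNorm_le_of_le (A.norm_coe_le_norm t) (h.norm_coe_le_norm t)

/-- The image of `c` is compact, so `f'` is uniformly continuous near it; the mean value inequality
then gives a remainder estimate which is uniform in the point of `κ`. -/
theorem hasFDerivAt_comp_continuousMap (f : C(E, F)) (f' : C(E, E →L[ℝ] F))
    (h : ∀ x, HasFDerivAt f (f' x) x) (c : C(κ, E)) :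
    HasFDerivAt (fun c : C(κ, E) => f.comp c) (pointwiseApply κ E F (f'.comp c)) c := by
  refine HasFDerivAt.of_isLittleO (Asymptotics.isLittleO_iff.2 fun ε hε => ?_)
  have hK : IsCompact (Set.range c) := isCompact_range c.continuous
  obtain ⟨δ, hδ, hδ'⟩ := Metric.mem_uniformity_dist.1 (hK.uniformContinuousAt_of_continuousAt f'
    (fun a _ => f'.continuous.continuousAt) (Metric.dist_mem_uniformity hε))
  filter_upwards [Metric.ball_mem_nhds c hδ] with d hd
  rw [ContinuousMap.norm_le _ (by positivity)]
  intro t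
  have hdt : d t ∈ Metric.ball (c t) δ :=
    (ContinuousMap.dist_apply_le_dist t).trans_lt hd
  have := Convex.norm_image_sub_le_of_norm_fderiv_le' (𝕜 := ℝ) (f := f) (φ := f' (c t)) (C := ε)
    (s := Metric.ball (c t) δ) (x := c t) (y := d t)
    (fun x _ => (h x).differentiableAt) (fun x hx => ?_) (convex_ball _ _)
    (Metric.mem_ball_self hδ) hdt
  · refine this.trans ?_
    gcongr
    exact (d - c).norm_coe_le_norm t
  · rw [(h x).fderiv, ← dist_eq_norm, dist_comm]
    exact (hδ' (dist_comm x (c t) ▸ hx) (Set.mem_range_self t)).le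

/-- The derivative of a superposition operator is the superposition operator of `fderiv ℝ f`,
followed by a bounded linear map. Hence the induction on the order, with the target space left
arbitrary; the common universe allows `F` to be replaced by `E →L[ℝ] F`. -/
theorem contDiff_comp_continuousMap_nat (n : ℕ) : ∀ {F : Type u} [NormedAddCommGroup F]
    [NormedSpace ℝ F] (f : C(E, F)), ContDiff ℝ ∞ f →
      ContDiff ℝ n (fun c : C(κ, E) => f.comp c) := by
  induction n with
  | zero =>
    intro F _ _ f _
    exact contDiff_zero.2 f.continuous_postcomp
  | succ n ih =>
    intro F _ _ f hf
    have hf' : ContDiff ℝ ∞ (fderiv ℝ f) := hf.fderiv_right (by simp)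
    have h := ih ⟨fderiv ℝ f, hf'.continuous⟩ hf'
    refine contDiff_succ_iff_hasFDerivAt.2 ⟨_, (pointwiseApply κ E F).contDiff.comp h, fun c => ?_⟩
    exact hasFDerivAt_comp_continuousMap f ⟨fderiv ℝ f, hf'.continuous⟩
      (fun x => (hf.differentiable (by simp) x).hasFDerivAt) c

/-- The superposition operator `c ↦ f ∘ c` of a smooth map `f` is smooth. -/
theorem contDiff_comp_continuousMap (f : C(E, F)) (hf : ContDiff ℝ ∞ f) :
    ContDiff ℝ ∞ (fun c : C(κ, E) => f.comp c) :=
  contDiff_infty.2 fun n => contDiff_comp_continuousMap_nat n f hf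

/-- The constant maps. -/
def constCLM (κ : Type*) [TopologicalSpace κ] [CompactSpace κ] (E : Type*)
    [NormedAddCommGroup E] [NormedSpace ℝ E] : E →L[ℝ] C(κ, E) :=
  LinearMap.mkContinuous
    { toFun := fun x => ContinuousMap.const κ x
      map_add' := fun x y => rfl
      map_smul' := fun c x => rfl } 1 fun x => by
    rw [one_mul, ContinuousMap.norm_le _ (norm_nonneg x)]
    intro t
    exact le_rfl

@[simp]
theorem constCLM_apply (x : E) (t : κ) : constCLM κ E x t = x := rfl

theorem norm_constCLM_le (x : E) : ‖constCLM κ E x‖ ≤ ‖x‖ := by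
  rw [ContinuousMap.norm_le _ (norm_nonneg x)]
  intro t
  exact le_rfl

/-- The operator `h ↦ ∫₀ᵗ h` on `C([0, 1], E)`. -/
def primitiveCLM (E : Type*) [NormedAddCommGroup E] [NormedSpace ℝ E] :
    C(unitInterval, E) →L[ℝ] C(unitInterval, E) :=
  LinearMap.mkContinuous
    { toFun := fun h => ⟨fun t => ∫ x in (0 : ℝ)..t, Set.IccExtend zero_le_one h x,
        (intervalIntegral.continuous_primitive
          (fun a b => (h.continuous.Icc_extend').intervalIntegrable a b) 0).comp
          continuous_subtype_val⟩
      map_add' := fun h h' => by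
        ext t
        exact intervalIntegral.integral_add ((h.continuous.Icc_extend').intervalIntegrable _ _)
          ((h'.continuous.Icc_extend').intervalIntegrable _ _)
      map_smul' := fun c h => by
        ext t
        exact intervalIntegral.integral_smul c _ } 1 fun h => by
    rw [one_mul, ContinuousMap.norm_le _ (norm_nonneg h)]
    intro t
    refine (intervalIntegral.norm_integral_le_of_norm_le_const
      (C := ‖h‖) fun x _ => h.norm_coe_le_norm _).trans ?_
    rw [sub_zero, abs_of_nonneg t.2.1]
    exact mul_le_of_le_one_right (norm_nonneg h) t.2.2

theorem primitiveCLM_apply (h : C(unitInterval, E)) (t : unitInterval) :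
    primitiveCLM E h t = ∫ x in (0 : ℝ)..t, Set.IccExtend zero_le_one h x := rfl

theorem norm_primitiveCLM_le (h : C(unitInterval, E)) : ‖primitiveCLM E h‖ ≤ ‖h‖ := by
  refine (ContinuousLinearMap.le_of_opNorm_le _ (c := 1) ?_ h).trans_eq (one_mul _)
  exact LinearMap.mkContinuous_norm_le _ zero_le_one _

end Superposition


/-! ### Flows of commuting vector fields -/

section Flow

universe u

variable {E P : Type u} [NormedAddCommGroup E] [NormedSpace ℝ E]
  [NormedAddCommGroup P] [NormedSpace ℝ P]

/-- The right-hand side of the integral equation `c = x + ∫ X(c) s` for the integral curve `c` of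
the vector field `X(·) s` with initial value `x`, where `z = (x, s)`. -/
def flowOperator (X : C(E, P →L[ℝ] E)) (z : (E × P) × C(unitInterval, E)) : C(unitInterval, E) :=
  constCLM unitInterval E z.1.1 + primitiveCLM E
    (pointwiseApply unitInterval P E (X.comp z.2) (constCLM unitInterval P z.1.2))

theorem contDiff_flowOperator (X : C(E, P →L[ℝ] E)) (hX : ContDiff ℝ ∞ X) :
    ContDiff ℝ ∞ (flowOperator X) := by
  have h1 : ContDiff ℝ ∞ (fun z : (E × P) × C(unitInterval, E) => X.comp z.2) :=
    (contDiff_comp_continuousMap X hX).comp contDiff_snd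
  have h2 : ContDiff ℝ ∞ (fun z : (E × P) × C(unitInterval, E) => constCLM unitInterval P z.1.2) :=
    (constCLM unitInterval P).contDiff.comp contDiff_fst.snd
  have h3 : ContDiff ℝ ∞ (fun z : (E × P) × C(unitInterval, E) => constCLM unitInterval E z.1.1) :=
    (constCLM unitInterval E).contDiff.comp contDiff_fst.fst
  exact h3.add ((primitiveCLM E).contDiff.comp
    (((pointwiseApply unitInterval P E).contDiff.comp h1).clm_apply h2))

/-- The integral curves of the vector fields `X(·) s`, for small `s`, depend smoothly on the initial
value and on `s`. -/
theorem exists_flowCurve [CompleteSpace E] [CompleteSpace P] (X : C(E, P →L[ℝ] E))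
    (hX : ContDiff ℝ ∞ X) (x₀ : E) :
    ∃ c : E × P → C(unitInterval, E), (∀ᶠ z in nhds (x₀, 0), ContDiffAt ℝ ∞ c z) ∧
      (∀ᶠ z in nhds (x₀, 0), c z = flowOperator X (z, c z)) ∧
      ∀ᶠ x in nhds x₀, c (x, 0) = constCLM unitInterval E x := by
  let G : (E × P) × C(unitInterval, E) → C(unitInterval, E) := fun z => z.2 - flowOperator X z
  have hG : ContDiff ℝ ∞ G := contDiff_snd.sub (contDiff_flowOperator X hX)
  let v₀ : (E × P) × C(unitInterval, E) := ((x₀, 0), constCLM unitInterval E x₀)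
  have hG0 : ∀ x c, G ((x, 0), c) = c - constCLM unitInterval E x := by
    intro x c
    simp [G, flowOperator]
  -- For `s = 0` the integral term disappears, so `G` is a translation in `c` and its partial
  -- derivative is the identity.
  have hd : fderiv ℝ G v₀ ∘L .inr ℝ (E × P) C(unitInterval, E)
      = ContinuousLinearMap.id ℝ C(unitInterval, E) := by
    have h1 : HasFDerivAt (fun c : C(unitInterval, E) => G ((x₀, 0), c))
        (fderiv ℝ G v₀ ∘L .inr ℝ (E × P) C(unitInterval, E)) (constCLM unitInterval E x₀) :=
      HasFDerivAt.comp _ (g := G) ((hG.differentiable (by simp) v₀).hasFDerivAt)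
        (hasFDerivAt_prodMk_right _ _)
    have h2 : HasFDerivAt (fun c : C(unitInterval, E) => G ((x₀, 0), c))
        (ContinuousLinearMap.id ℝ C(unitInterval, E)) (constCLM unitInterval E x₀) := by
      simp only [hG0]
      exact (hasFDerivAt_id _).sub_const _
    exact h1.unique h2
  have hinv : (fderiv ℝ G v₀ ∘L .inr ℝ (E × P) C(unitInterval, E)).IsInvertible := by
    rw [hd]
    exact ⟨ContinuousLinearEquiv.refl ℝ _, rfl⟩
  have hGat : ContDiffAt ℝ ∞ G v₀ := hG.contDiffAt
  have hne : (∞ : ℕ∞ω) ≠ 0 := by simp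
  have hv : G v₀ = 0 := by simp [v₀, hG0]
  have hGeq : ∀ᶠ z in nhds (x₀, 0), G (z, hGat.implicitFunction hne hinv z) = 0 := by
    filter_upwards [hGat.eventually_apply_implicitFunction hne hinv] with z hz
    rw [hz, hv]
  have hself : hGat.implicitFunction hne hinv (x₀, 0) = constCLM unitInterval E x₀ :=
    hGat.implicitFunction_apply_self hne hinv
  have hiff := hGat.eventually_apply_eq_iff_implicitFunction hne hinv
  have hsm := hGat.contDiffAt_implicitFunction hne hinv
  generalize hGat.implicitFunction hne hinv = c at *
  refine ⟨c, ?_, ?_, ?_⟩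
  -- `C^∞` at a point does not spread to a neighbourhood by itself. The implicit function theorem is
  -- therefore applied again at each nearby point, where the partial derivative is still invertible,
  -- and local uniqueness identifies the new solution with `c`.
  · have hcont : ∀ᶠ z in nhds (x₀, (0 : P)), ContinuousAt c z := by
      filter_upwards [(hsm.of_le (m := 1) (by simp)).eventually (by simp)] with z hz
      exact hz.continuousAt
    have hinv' : ∀ᶠ z in nhds (x₀, (0 : P)),
        (fderiv ℝ G (z, c z) ∘L .inr ℝ (E × P) C(unitInterval, E)).IsInvertible := by
      have h1 : ContinuousAt (fun z =>
          fderiv ℝ G (z, c z) ∘L .inr ℝ (E × P) C(unitInterval, E)) (x₀, (0 : P)) := by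
        have h2 : ContinuousAt (fun z => fderiv ℝ G (z, c z)) (x₀, (0 : P)) :=
          (hG.continuous_fderiv (by simp)).continuousAt.comp
            (continuousAt_id.prodMk hsm.continuousAt)
        exact h2.clm_comp continuousAt_const
      refine h1.eventually (p := fun f => f.IsInvertible) ?_
      have := ContinuousLinearEquiv.nhds (ContinuousLinearEquiv.refl ℝ C(unitInterval, E))
      beta_reduce
      rw [hself]
      change ∀ᶠ f in nhds (fderiv ℝ G v₀ ∘L .inr ℝ (E × P) C(unitInterval, E)), _
      rw [hd]
      filter_upwards [this] with f hf
      exact hf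
    filter_upwards [hcont, hinv', hGeq, hGeq.eventually_nhds] with z h1 h2 h3 h4
    have hGz : ContDiffAt ℝ ∞ G (z, c z) := hG.contDiffAt
    have h5 := hGz.eventually_apply_eq_iff_implicitFunction hne h2
    have h6 : ContinuousAt (fun z' => (z', c z')) z := continuousAt_id.prodMk h1
    refine (hGz.contDiffAt_implicitFunction hne h2).congr_of_eventuallyEq ?_
    filter_upwards [h6.eventually h5, h4] with z' h7 h8
    exact (h7.1 (by rw [h8, h3])).symm
  · filter_upwards [hGeq] with z hz
    exact sub_eq_zero.1 hz
  · have h2 : Filter.Tendsto (fun x : E => ((x, (0 : P)), constCLM unitInterval E x)) (nhds x₀)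
        (nhds v₀) :=
      ((continuous_id.prodMk continuous_const).prodMk
        (constCLM unitInterval E).continuous).tendsto x₀
    filter_upwards [h2.eventually hiff] with x hx
    exact hx.1 (by rw [hv, hG0, sub_self])

/-- The variation of the integral curve of `X(·) s` at time `τ`, in the direction of `p`, is
`τ • X(·) p`, if the vector fields commute. -/
theorem variation_eq [CompleteSpace E] (X : C(E, P →L[ℝ] E))
    (X' : C(E, E →L[ℝ] P →L[ℝ] E))
    (hX' : ∀ x, HasFDerivAt X (X' x) x) {x : E} {s : P} {c : C(unitInterval, E)}
    (hc : c = flowOperator X ((x, s), c))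
    (hcomm : ∀ t, ∀ p q, X' (c t) (X (c t) p) q = X' (c t) (X (c t) q) p)
    (hsmall : ‖X'.comp c‖ * ‖s‖ < 1) (p : P) (w : C(unitInterval, E))
    (hw : w = primitiveCLM E (pointwiseApply unitInterval P E
      (pointwiseApply unitInterval E (P →L[ℝ] E) (X'.comp c) w) (constCLM unitInterval P s)
      + pointwiseApply unitInterval P E (X.comp c) (constCLM unitInterval P p))) (t : unitInterval) :
    w t = (t : ℝ) • X (c t) p := by
  -- The candidate `τ • X(c τ) p` solves the same linearized integral equation as `w`: its
  -- derivative is `X(c) p + τ X'(c)(X(c) s) p`, and commutation exchanges `s` and `p` in the last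
  -- term.
  let y : C(unitInterval, E) := ⟨fun t => (t : ℝ) • X (c t) p, by fun_prop⟩
  have hy : y = primitiveCLM E (pointwiseApply unitInterval P E
      (pointwiseApply unitInterval E (P →L[ℝ] E) (X'.comp c) y) (constCLM unitInterval P s)
      + pointwiseApply unitInterval P E (X.comp c) (constCLM unitInterval P p)) := by
    let h : C(unitInterval, E) := pointwiseApply unitInterval P E (X.comp c)
      (constCLM unitInterval P s)
    let ch : ℝ → E := fun τ => x + ∫ r in (0 : ℝ)..τ, Set.IccExtend zero_le_one h r
    have hcont : Continuous (Set.IccExtend zero_le_one h) := h.continuous.Icc_extend'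
    have hch : ∀ τ, HasDerivAt ch (Set.IccExtend zero_le_one h τ) τ := fun τ =>
      (intervalIntegral.integral_hasDerivAt_right (hcont.intervalIntegrable _ _)
        (hcont.stronglyMeasurableAtFilter _ _) hcont.continuousAt).const_add x
    have hch' : ∀ t : unitInterval, ch t = c t := by
      intro t
      have := congrArg (fun f : C(unitInterval, E) => f t) hc
      exact this.symm
    ext t
    have hderiv : ∀ τ ∈ Set.uIcc (0 : ℝ) t, HasDerivAt (fun τ => τ • X (ch τ) p)
        (τ • X' (ch τ) (Set.IccExtend zero_le_one h τ) p + X (ch τ) p) τ := by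
      intro τ _
      have h1 := (hX' (ch τ)).comp_hasDerivAt τ (hch τ)
      have h2 := h1.clm_apply (hasDerivAt_const τ p)
      simpa using (hasDerivAt_id τ).fun_smul h2
    have hchc : Continuous ch := continuous_iff_continuousAt.2 fun τ => (hch τ).continuousAt
    have hint := intervalIntegral.integral_eq_sub_of_hasDerivAt hderiv
      (Continuous.intervalIntegrable (by fun_prop) _ _)
    rw [zero_smul, sub_zero, hch'] at hint
    rw [primitiveCLM_apply]
    refine hint.symm.trans (intervalIntegral.integral_congr fun τ hτ => ?_)
    rw [Set.uIcc_of_le t.2.1] at hτ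
    have hτ1 : τ ∈ Set.Icc (0 : ℝ) 1 := ⟨hτ.1, hτ.2.trans t.2.2⟩
    have e1 := hch' ⟨τ, hτ1⟩
    simp only [Set.IccExtend_of_mem zero_le_one _ hτ1]
    simp only at e1
    rw [e1]
    simp [h, y, hcomm _ s p]
  -- The difference of the two solutions is a fixed point of a linear operator of norm less than 1,
  -- because `‖X' ∘ c‖ ‖s‖ < 1`; so it vanishes.
  have hd : w - y = primitiveCLM E (pointwiseApply unitInterval P E
      (pointwiseApply unitInterval E (P →L[ℝ] E) (X'.comp c) (w - y))
      (constCLM unitInterval P s)) := by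
    conv_lhs => rw [hw, hy]
    rw [← map_sub]
    congr 1
    simp only [map_sub, sub_apply]
    abel
  have hn : ‖w - y‖ ≤ ‖X'.comp c‖ * ‖s‖ * ‖w - y‖ := by
    conv_lhs => rw [hd]
    refine (norm_primitiveCLM_le _).trans ((norm_pointwiseApply_le _ _).trans ?_)
    calc _ ≤ (‖X'.comp c‖ * ‖w - y‖) * ‖s‖ := by
          gcongr
          · exact norm_pointwiseApply_le _ _
          · exact norm_constCLM_le s
      _ = _ := by ring
  have h0 : ‖w - y‖ = 0 := by
    by_contra hne
    have : 0 < ‖w - y‖ := lt_of_le_of_ne (norm_nonneg _) (Ne.symm hne)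
    nlinarith
  rw [sub_eq_zero.1 (norm_eq_zero.1 h0)]
  rfl

/-- The time one map of the vector fields `X(·) s`, where the fields commute on `U`. -/
theorem exists_flow [CompleteSpace E] [CompleteSpace P] (X : C(E, P →L[ℝ] E))
    (hX : ContDiff ℝ ∞ X) {U : Set E} (hU : IsOpen U)
    (hcomm : ∀ x ∈ U, ∀ p q, fderiv ℝ X x (X x p) q = fderiv ℝ X x (X x q) p) {x₀ : E}
    (hx₀ : x₀ ∈ U) :
    ∃ Φ : E × P → E, (∀ᶠ z in nhds (x₀, 0), ContDiffAt ℝ ∞ Φ z) ∧ (∀ᶠ x in nhds x₀, Φ (x, 0) = x) ∧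
      ∀ᶠ z in nhds (x₀, 0), ∀ p, fderiv ℝ Φ z (0, p) = X (Φ z) p := by
  obtain ⟨c, hc, hceq, hc0⟩ := exists_flowCurve X hX x₀
  have hX'c : ContDiff ℝ ∞ (fderiv ℝ X) := hX.fderiv_right (by simp)
  let X' : C(E, E →L[ℝ] P →L[ℝ] E) := ⟨fderiv ℝ X, hX'c.continuous⟩
  have hX' : ∀ x, HasFDerivAt X (X' x) x := fun x => (hX.differentiable (by simp) x).hasFDerivAt
  let ev : C(unitInterval, E) →L[ℝ] E := ContinuousMap.evalCLM ℝ 1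
  have hbase : c (x₀, 0) = constCLM unitInterval E x₀ := hc0.self_of_nhds
  have hc1 := hc.self_of_nhds
  refine ⟨fun z => ev (c z), ?_, ?_, ?_⟩
  · filter_upwards [hc] with z hz
    exact ev.contDiff.contDiffAt.comp _ hz
  · filter_upwards [hc0] with x hx
    rw [hx]
    rfl
  · have hdiff : ∀ᶠ z in nhds (x₀, (0 : P)), DifferentiableAt ℝ c z := by
      filter_upwards [hc] with z hz
      exact hz.differentiableAt (by simp)
    have hmem : ∀ᶠ z in nhds (x₀, (0 : P)), ∀ t, c z t ∈ U := by
      have hop : IsOpen {f : C(unitInterval, E) | Set.MapsTo f Set.univ U} :=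
        ContinuousMap.isOpen_setOfPred_mapsTo isCompact_univ hU
      have : c (x₀, 0) ∈ {f : C(unitInterval, E) | Set.MapsTo f Set.univ U} := by
        rw [hbase]
        intro t _
        exact hx₀
      filter_upwards [hc1.continuousAt.eventually (hop.mem_nhds this)] with z hz t
      exact hz (Set.mem_univ t)
    have hsmall : ∀ᶠ z in nhds (x₀, (0 : P)), ‖X'.comp (c z)‖ * ‖z.2‖ < 1 := by
      have h1 : ContinuousAt (fun z : E × P => ‖X'.comp (c z)‖ * ‖z.2‖) (x₀, 0) :=
        ((X'.continuous_postcomp.continuousAt.comp hc1.continuousAt).norm).mul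
          continuousAt_snd.norm
      refine h1.eventually_lt continuousAt_const ?_
      simp
    filter_upwards [hdiff, hmem, hsmall, hceq.eventually_nhds, hceq] with z h1 h2 h3 h4 h5 p
    have hcz : HasFDerivAt c (fderiv ℝ c z) z := h1.hasFDerivAt
    have e1 : HasFDerivAt (fun z => X.comp (c z)) _ z :=
      (hasFDerivAt_comp_continuousMap X X' hX' (c z)).comp z hcz
    have e2 := ((pointwiseApply unitInterval P E).hasFDerivAt.comp z e1).clm_apply
      ((constCLM unitInterval P).hasFDerivAt.comp z hasFDerivAt_snd)
    have e3 : HasFDerivAt (fun z => flowOperator X (z, c z)) _ z :=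
      ((constCLM unitInterval E).hasFDerivAt.comp z hasFDerivAt_fst).add
        ((primitiveCLM E).hasFDerivAt.comp z e2)
    have e4 := hcz.unique (e3.congr_of_eventuallyEq h4)
    have e5 := congrArg (fun f : E × P →L[ℝ] C(unitInterval, E) => f (0, p)) e4
    simp only [add_apply, ContinuousLinearMap.comp_apply,
      ContinuousLinearMap.coe_fst', ContinuousLinearMap.coe_snd', map_zero, zero_add,
      ContinuousLinearMap.flip_apply] at e5
    -- The derivative of the curve in the direction `p` solves the linearized equation; at time 1
    -- the factor in `variation_eq` is 1.
    have e6 := variation_eq X X' hX' (x := z.1) (s := z.2) (c := c z) h5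
      (fun t p q => hcomm _ (h2 t) p q) h3 p (fderiv ℝ c z (0, p))
      (by rw [add_comm]; exact e5) 1
    have e7 := (ev.hasFDerivAt.comp z hcz).fderiv
    have e8 : fderiv ℝ (fun z => ev (c z)) z (0, p) = ev (fderiv ℝ c z (0, p)) := by
      rw [show (fun z => ev (c z)) = ev ∘ c from rfl, e7]
      rfl
    rw [e8]
    change (fderiv ℝ c z (0, p)) 1 = _
    rw [e6]
    simp
    rfl

end Flow


/-! ### Straightening commuting vector fields -/

section Straightening

universe u

/-- A smooth map on an open set coincides near a point with a smooth map defined everywhere. -/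
theorem exists_contDiff_eventuallyEq {E G : Type*} [NormedAddCommGroup E] [NormedSpace ℝ E]
    [HasContDiffBump E] [FiniteDimensional ℝ E] [NormedAddCommGroup G] [NormedSpace ℝ G]
    {U : Set E} (hU : IsOpen U) {f : E → G} (hf : ContDiffOn ℝ ∞ f U) {x₀ : E} (hx₀ : x₀ ∈ U) :
    ∃ h : E → G, ContDiff ℝ ∞ h ∧ h =ᶠ[nhds x₀] f := by
  obtain ⟨r, hr, hrU⟩ := Metric.nhds_basis_closedBall.mem_iff.1 (hU.mem_nhds hx₀)
  let b : ContDiffBump x₀ := ⟨r / 2, r, by positivity, by linarith⟩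
  refine ⟨fun x => b x • f x, ?_, ?_⟩
  · refine contDiff_iff_contDiffAt.2 fun x => ?_
    by_cases hx : x ∈ U
    · exact b.contDiffAt.smul (hf.contDiffAt (hU.mem_nhds hx))
    · have hx' : x ∈ (tsupport b)ᶜ := by
        rw [b.tsupport_eq]
        exact fun h => hx (hrU h)
      have : (fun x => b x • f x) =ᶠ[nhds x] fun _ => 0 := by
        filter_upwards [(isClosed_tsupport b).isOpen_compl.mem_nhds hx'] with y hy
        rw [image_eq_zero_of_notMem_tsupport hy, zero_smul]
      exact contDiffAt_const.congr_of_eventuallyEq this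
  · filter_upwards [b.eventuallyEq_one] with x hx
    simp [hx]

variable {E P F : Type u} [NormedAddCommGroup E] [NormedSpace ℝ E] [FiniteDimensional ℝ E]
  [NormedAddCommGroup P] [NormedSpace ℝ P]
  [NormedAddCommGroup F] [NormedSpace ℝ F] [FiniteDimensional ℝ F]

theorem exists_complement (X : P →L[ℝ] E) (hX : Function.Injective X)
    (hd : Module.finrank ℝ E = Module.finrank ℝ P + Module.finrank ℝ F) :
    ∃ L : F →L[ℝ] E, ∀ p q, X p + L q = 0 → p = 0 ∧ q = 0 := by
  obtain ⟨C, hC⟩ := Submodule.exists_isCompl (LinearMap.range X.toLinearMap)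
  have h1 := Submodule.finrank_add_eq_of_isCompl hC
  rw [LinearMap.finrank_range_of_inj hX, hd] at h1
  have h2 : Module.finrank ℝ F = Module.finrank ℝ C := by omega
  let e := LinearEquiv.ofFinrankEq F C h2
  refine ⟨LinearMap.toContinuousLinearMap (C.subtype ∘ₗ e.toLinearMap), fun p q h => ?_⟩
  have h3 : X p ∈ LinearMap.range X.toLinearMap ⊓ C := by
    refine ⟨⟨p, rfl⟩, ?_⟩
    rw [eq_neg_of_add_eq_zero_left h]
    exact C.neg_mem (e q).2
  rw [hC.inf_eq_bot, Submodule.mem_bot] at h3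
  refine ⟨hX (by rw [h3, map_zero]), ?_⟩
  rw [h3, zero_add] at h
  exact e.injective (Subtype.ext (by simpa using h))

/-- Commuting vector fields `X(·) p` which are linearly independent at `x₀` are coordinate vector
fields. Moreover the coordinates can be chosen such that those which come from `P` extend a given
map `κ` to a subspace of `P` whose derivative along the fields is a projection `ρ`. -/
theorem exists_straightening [FiniteDimensional ℝ P] [HasContDiffBump E] {U : Set E} (hU : IsOpen U) {X : E → P →L[ℝ] E}
    (hX : ContDiffOn ℝ ∞ X U)
    (hcomm : ∀ x ∈ U, ∀ p q, fderiv ℝ X x (X x p) q = fderiv ℝ X x (X x q) p)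
    {κ : E → P} (hκ : ContDiffOn ℝ ∞ κ U) {ρ : P →L[ℝ] P} (hκρ : ∀ x ∈ U, ρ (κ x) = κ x)
    (hκX : ∀ x ∈ U, ∀ p, fderiv ℝ κ x (X x p) = ρ p)
    {x₀ : E} (hx₀ : x₀ ∈ U) (hinj : Function.Injective (X x₀))
    (hd : Module.finrank ℝ E = Module.finrank ℝ P + Module.finrank ℝ F) :
    ∃ (Φ : OpenPartialHomeomorph (P × F) E) (B : Set P) (V : Set F) (s₀ : P),
      IsOpen B ∧ Convex ℝ B ∧ s₀ ∈ B ∧ IsOpen V ∧ Φ.source = B ×ˢ V ∧ x₀ ∈ Φ.target ∧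
      Φ.target ⊆ U ∧ ContDiffOn ℝ ∞ Φ Φ.source ∧ ContDiffOn ℝ ∞ Φ.symm Φ.target ∧
      (∀ z ∈ Φ.source, ∀ p, fderiv ℝ Φ z (p, 0) = X (Φ z) p) ∧
      ∀ z ∈ Φ.source, κ (Φ z) = ρ z.1 := by
  obtain ⟨L, hL⟩ := exists_complement (F := F) (X x₀) hinj hd
  -- The flow is constructed for globally smooth fields, so `X` is replaced by a global field with
  -- the same germ at `x₀`; commutation is needed only on `W`.
  obtain ⟨Y, hY, hYX⟩ := exists_contDiff_eventuallyEq hU hX hx₀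
  obtain ⟨W, hWsub, hW, hx₀W⟩ := eventually_nhds_iff.1 (hYX.and (hU.mem_nhds hx₀))
  have hYd : ∀ x ∈ W, fderiv ℝ Y x = fderiv ℝ X x := by
    intro x hx
    apply Filter.EventuallyEq.fderiv_eq
    filter_upwards [hW.mem_nhds hx] with y hy using (hWsub y hy).1
  obtain ⟨φ, hφ, hφ0, hφX⟩ := exists_flow ⟨Y, hY.continuous⟩ hY hW (x₀ := x₀) (by
    intro x hx p q
    change fderiv ℝ Y x (Y x p) q = fderiv ℝ Y x (Y x q) p
    rw [hYd x hx, (hWsub x hx).1]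
    exact hcomm x (hWsub x hx).2 p q) hx₀W
  have hκat : ∀ x ∈ U, ContDiffAt ℝ ∞ κ x := fun x hx => hκ.contDiffAt (hU.mem_nhds hx)
  -- The point with coordinates `(s, y)` is reached from the transversal point `x₀ + L y` by flowing
  -- with parameter `s - κ (x₀ + L y)` rather than `s`. The shift is what gives `κ ∘ ψ = ρ s`.
  let A : P × F → E × P := fun z => (x₀ + L z.2, z.1 - κ (x₀ + L z.2))
  let ψ : P × F → E := fun z => φ (A z)
  let z₀ : P × F := (κ x₀, 0)
  have hAz₀ : A z₀ = (x₀, 0) := by simp [A, z₀]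
  have hψz₀ : ψ z₀ = x₀ := by
    change φ (A z₀) = x₀
    rw [hAz₀]
    exact hφ0.self_of_nhds
  have hline : ContDiff ℝ ∞ (fun z : P × F => x₀ + L z.2) :=
    contDiff_const.add (L.contDiff.comp contDiff_snd)
  have hUev : ∀ᶠ z in nhds z₀, x₀ + L z.2 ∈ U := by
    refine hline.continuous.continuousAt.eventually ?_
    simpa [z₀] using hU.mem_nhds hx₀
  have hAcd : ∀ᶠ z in nhds z₀, ContDiffAt ℝ ∞ A z := by
    filter_upwards [hUev] with z hz
    exact hline.contDiffAt.prodMk (contDiffAt_fst.sub ((hκat _ hz).comp z hline.contDiffAt))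
  have hAcont : Filter.Tendsto A (nhds z₀) (nhds (x₀, 0)) := by
    rw [← hAz₀]
    exact hAcd.self_of_nhds.continuousAt
  have hψcd : ∀ᶠ z in nhds z₀, ContDiffAt ℝ ∞ ψ z := by
    filter_upwards [hAcd, hAcont.eventually hφ] with z h1 h2
    exact h2.comp z h1
  have hψfd : ∀ᶠ z in nhds z₀, fderiv ℝ ψ z = fderiv ℝ φ (A z) ∘L fderiv ℝ A z := by
    filter_upwards [hAcd, hAcont.eventually hφ] with z h1 h2
    exact fderiv_comp z (h2.differentiableAt (by simp)) (h1.differentiableAt (by simp))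
  have hAfd : ∀ᶠ z in nhds z₀, ∀ p q, fderiv ℝ A z (p, q)
      = (L q, p - fderiv ℝ κ (x₀ + L z.2) (L q)) := by
    filter_upwards [hUev] with z hz p q
    have h1 : HasFDerivAt (fun z : P × F => x₀ + L z.2) (L ∘L .snd ℝ P F) z :=
      (L.hasFDerivAt.comp z hasFDerivAt_snd).const_add x₀
    have h2 := ((hκat _ hz).differentiableAt (by simp)).hasFDerivAt.comp z h1
    have h3 : HasFDerivAt A _ z := h1.prodMk (hasFDerivAt_fst.sub h2)
    rw [h3.fderiv]
    simp
  have hψX : ∀ᶠ z in nhds z₀, ψ z ∈ W ∧ ∀ p, fderiv ℝ ψ z (p, 0) = X (ψ z) p := by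
    have hmem : ∀ᶠ z in nhds z₀, ψ z ∈ W := by
      refine hψcd.self_of_nhds.continuousAt.eventually ?_
      rw [hψz₀]
      exact hW.mem_nhds hx₀W
    filter_upwards [hψfd, hAfd, hAcont.eventually hφX, hmem] with z h1 h2 h3 h4
    refine ⟨h4, fun p => ?_⟩
    rw [h1, ContinuousLinearMap.comp_apply, h2, map_zero, map_zero, sub_zero, h3]
    change Y (ψ z) p = _
    rw [(hWsub _ h4).1]
  have hfd0 : ∀ p q, fderiv ℝ ψ z₀ (p, q) = X x₀ (p - fderiv ℝ κ x₀ (L q)) + L q := by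
    intro p q
    have h1 : ∀ v : E, fderiv ℝ φ (x₀, 0) (v, 0) = v := by
      intro v
      have h2 : HasFDerivAt (fun x : E => φ (x, 0))
          (fderiv ℝ φ (x₀, 0) ∘L .inl ℝ E P) x₀ :=
        HasFDerivAt.comp x₀ (g := φ)
          (hφ.self_of_nhds.differentiableAt (by simp)).hasFDerivAt (hasFDerivAt_prodMk_left x₀ 0)
      have h3 : HasFDerivAt (fun x : E => φ (x, 0)) (ContinuousLinearMap.id ℝ E) x₀ :=
        (hasFDerivAt_id x₀).congr_of_eventuallyEq hφ0
      exact congrArg (fun f : E →L[ℝ] E => f v) (h2.unique h3)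
    have hz2 : x₀ + L z₀.2 = x₀ := by simp [z₀]
    rw [hψfd.self_of_nhds, ContinuousLinearMap.comp_apply, hAfd.self_of_nhds, hAz₀, hz2]
    have h4 : (L q, p - fderiv ℝ κ x₀ (L q)) = ((0 : E), p - fderiv ℝ κ x₀ (L q)) + (L q, 0) := by
      simp
    rw [h4, map_add, h1, hφX.self_of_nhds, hφ0.self_of_nhds]
    change Y x₀ _ + _ = _
    rw [(hWsub _ hx₀W).1]
  have hbij : ∀ z, fderiv ℝ ψ z₀ z = 0 → z = 0 := by
    rintro ⟨p, q⟩ h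
    rw [hfd0] at h
    obtain ⟨h1, h2⟩ := hL _ _ h
    rw [h2, map_zero, map_zero, sub_zero] at h1
    rw [h1, h2]
    rfl
  have hfr : Module.finrank ℝ (P × F) = Module.finrank ℝ E := by
    rw [hd, Module.finrank_prod]
  have hequiv : ∃ e : (P × F) ≃L[ℝ] E, (e : (P × F) →L[ℝ] E) = fderiv ℝ ψ z₀ := by
    refine ⟨(LinearEquiv.ofInjectiveOfFinrankEq (fderiv ℝ ψ z₀).toLinearMap
      ((injective_iff_map_eq_zero _).2 hbij) hfr).toContinuousLinearEquiv, ?_⟩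
    ext z
    · rfl
    · rfl
  obtain ⟨e₀, he₀⟩ := hequiv
  have hψ₀ := hψcd.self_of_nhds
  have hder : HasFDerivAt ψ (e₀ : (P × F) →L[ℝ] E) z₀ := by
    rw [he₀]
    exact (hψ₀.differentiableAt (by simp)).hasFDerivAt
  let Ψ := hψ₀.toOpenPartialHomeomorph ψ hder (by simp)
  have hΨ : ∀ z, Ψ z = ψ z := fun z => rfl
  have hinvert : ∀ᶠ z in nhds z₀, ∃ e : (P × F) ≃L[ℝ] E, (e : (P × F) →L[ℝ] E) = fderiv ℝ ψ z := by
    have h1 : ContinuousAt (fderiv ℝ ψ) z₀ :=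
      (hψ₀.fderiv_right (m := 0) (by simp)).continuousAt
    have h2 := ContinuousLinearEquiv.nhds e₀
    rw [he₀] at h2
    filter_upwards [h1.eventually h2] with z hz
    exact hz
  have hsrc : ∀ᶠ z in nhds z₀, z ∈ Ψ.source :=
    Ψ.open_source.mem_nhds (hψ₀.mem_toOpenPartialHomeomorph_source hder (by simp))
  obtain ⟨r, hr, hball⟩ := Metric.eventually_nhds_iff_ball.1
    (hsrc.and (hψcd.and (hψX.and (hinvert.and hUev))))
  have hev : ∀ᶠ y in nhds (0 : F), φ (x₀ + L y, 0) = x₀ + L y ∧ κ (x₀ + L y) ∈ Metric.ball (κ x₀) r := by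
    have h1 : Filter.Tendsto (fun y : F => x₀ + L y) (nhds 0) (nhds x₀) := by
      have : Continuous (fun y : F => x₀ + L y) := by fun_prop
      simpa using this.tendsto 0
    exact (h1.eventually hφ0).and
      ((h1.eventually ((hκat x₀ hx₀).continuousAt.eventually (Metric.ball_mem_nhds _ hr))))
  obtain ⟨r', hr', hball'⟩ := Metric.eventually_nhds_iff_ball.1 hev
  let B := Metric.ball (κ x₀) r
  let V := Metric.ball (0 : F) (min r r')
  have hBV : ∀ z ∈ B ×ˢ V, z ∈ Metric.ball z₀ r := by
    rintro ⟨s, y⟩ ⟨hs, hy⟩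
    rw [← ball_prod_same]
    exact ⟨hs, Metric.ball_subset_ball (min_le_left _ _) hy⟩
  have hopen : IsOpen (B ×ˢ V) := Metric.isOpen_ball.prod Metric.isOpen_ball
  let Φ := Ψ.restrOpen (B ×ˢ V) hopen
  have hΦs : Φ.source = B ×ˢ V := by
    rw [OpenPartialHomeomorph.restrOpen_source]
    exact Set.inter_eq_right.2 fun z hz => (hball z (hBV z hz)).1
  have hΦ : ∀ z, Φ z = ψ z := fun z => rfl
  have hΦ' : (Φ : P × F → E) = ψ := rfl
  have hgood : ∀ z ∈ Φ.source, z ∈ Metric.ball z₀ r := fun z hz => hBV z (hΦs ▸ hz)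
  refine ⟨Φ, B, V, κ x₀, Metric.isOpen_ball, convex_ball _ _, Metric.mem_ball_self hr,
    Metric.isOpen_ball, hΦs, ?_, ?_, ?_, ?_, ?_, ?_⟩
  · have hz₀ : z₀ ∈ Φ.source := by
      rw [hΦs]
      exact ⟨Metric.mem_ball_self hr, Metric.mem_ball_self (lt_min hr hr')⟩
    rw [← hψz₀]
    exact Φ.map_source hz₀
  · intro x hx
    have h1 := Φ.map_target hx
    have h2 := (hball _ (hgood _ h1)).2.2.1.1
    rw [← hΦ, Φ.right_inv hx] at h2
    exact (hWsub x h2).2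
  · intro z hz
    exact (hball z (hgood z hz)).2.1.contDiffWithinAt
  · intro x hx
    have h1 := hball _ (hgood _ (Φ.map_target hx))
    obtain ⟨e, he⟩ := h1.2.2.2.1
    have h2 : HasFDerivAt Φ (e : (P × F) →L[ℝ] E) (Φ.symm x) := by
      rw [he]
      exact (h1.2.1.differentiableAt (by simp)).hasFDerivAt
    exact (Φ.contDiffAt_symm hx h2 h1.2.1).contDiffWithinAt
  · intro z hz p
    exact (hball z (hgood z hz)).2.2.1.2 p
  · rintro ⟨s, y⟩ hz
    have hz' : (s, y) ∈ B ×ˢ V := hΦs ▸ hz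
    have hy := hball' y (Metric.ball_subset_ball (min_le_right _ _) hz'.2)
    have hUy : ∀ s' ∈ B, φ (x₀ + L y, s' - κ (x₀ + L y)) ∈ U := fun s' hs' =>
      (hWsub _ (hball (s', y) (hBV _ ⟨hs', hz'.2⟩)).2.2.1.1).2
    -- Along the fields `κ` has derivative `ρ`, so `κ (ψ (s', y)) - ρ s'` is constant in `s'`. At
    -- `s' = κ (x₀ + L y)` the flow parameter is zero, and the value there is 0 because `ρ` fixes
    -- the values of `κ`.
    have hder : ∀ s' ∈ B, HasFDerivWithinAt (fun s' => κ (ψ (s', y)) - ρ s') (0 : P →L[ℝ] P) B s' := by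
      intro s' hs'
      have h1 := hball (s', y) (hBV _ ⟨hs', hz'.2⟩)
      have h2 : HasFDerivAt (fun s' => ψ (s', y)) (fderiv ℝ ψ (s', y) ∘L .inl ℝ P F) s' :=
        HasFDerivAt.comp s' (g := ψ)
          (h1.2.1.differentiableAt (by simp)).hasFDerivAt (hasFDerivAt_prodMk_left s' y)
      have h3 := (((hκat _ (hUy s' hs')).differentiableAt (by simp)).hasFDerivAt.comp s' h2).sub
        ρ.hasFDerivAt
      refine (h3.hasFDerivWithinAt (s := B)).congr_fderiv (ContinuousLinearMap.ext fun p => ?_)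
      change fderiv ℝ κ (ψ (s', y)) (fderiv ℝ ψ (s', y) (p, 0)) - ρ p = 0
      rw [h1.2.2.1.2]
      exact sub_eq_zero.2 (hκX _ (hUy s' hs') p)
    have hconst := (convex_ball (κ x₀) r).is_const_of_fderivWithin_eq_zero
      (f := fun s' => κ (ψ (s', y)) - ρ s') (𝕜 := ℝ)
      (fun s' hs' => (hder s' hs').differentiableWithinAt)
      (fun s' hs' => (hder s' hs').fderivWithin
        (Metric.isOpen_ball.uniqueDiffWithinAt hs')) hz'.1 hy.2
    have hbase : ψ (κ (x₀ + L y), y) = x₀ + L y := by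
      change φ (x₀ + L y, κ (x₀ + L y) - κ (x₀ + L y)) = _
      rw [sub_self, hy.1]
    simp only [hbase] at hconst
    have hUy0 := (hball (s, y) (hBV _ hz')).2.2.2.2
    rw [hκρ _ hUy0, sub_self] at hconst
    exact sub_eq_zero.1 hconst

end Straightening


/-! ### Almost hyper-Hermitian structures with closed Kähler forms -/

section HyperKahler

variable {E : Type*} [NormedAddCommGroup E] [NormedSpace ℝ E] [FiniteDimensional ℝ E]
  {U : Set E} {g : E → E →L[ℝ] E →L[ℝ] ℝ} {I J K : E → E →L[ℝ] E} {α β γ : E → E →L[ℝ] ℝ} {x : E}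

namespace IsAlmostHyperHermitianOn

/-- Differentiating `dα = Ω_I` relates second derivatives of `α` to the covariant derivative of
`Ω_I`. In this form closedness of `Ω_I` is the symmetry of the second derivative of `α`. -/
theorem covEnd_of_primitive (h : IsAlmostHyperHermitianOn U g I J K) (hU : IsOpen U)
    (hα : IsKahlerPrimitiveOn U g I α) (hx : x ∈ U) (u v w : E) :
    fderiv ℝ (fderiv ℝ α) x u v w - fderiv ℝ (fderiv ℝ α) x u w v
      = g x (covEnd g I x u v) w + g x (I x (christoffel g x u v)) w
        + g x (I x v) (christoffel g x u w) := by
  have hαx := hα.contDiffOn.contDiffAt (hU.mem_nhds hx)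
  have h1 := fun v w => ((ContDiffAt.hasFDerivAt_fderiv hαx).clm_apply
    (hasFDerivAt_const v x)).clm_apply (hasFDerivAt_const w x)
  have h2 := ((h.metric.hasFDerivAt hU hx).clm_apply
    ((h.differentiableAt_I hU hx).hasFDerivAt.clm_apply (hasFDerivAt_const v x))).clm_apply
    (hasFDerivAt_const w x)
  have h3 : (fun y => g y (I y v) w) =ᶠ[nhds x] fun y => fderiv ℝ α y v w - fderiv ℝ α y w v := by
    filter_upwards [hU.mem_nhds hx] with y hy using (hα.extDeriv_eq y hy v w).symm
  have h4 := congrArg (fun f : E →L[ℝ] ℝ => f u)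
    (h2.unique (((h1 v w).fun_sub (h1 w v)).congr_of_eventuallyEq h3))
  simp at h4
  rw [← h4, h.metric.fderiv_eq hU hx]
  simp only [covEnd, sub_apply, add_apply, ContinuousLinearMap.comp_apply, map_add, map_sub]
  ring

theorem covEnd_skew_of_primitive (h : IsAlmostHyperHermitianOn U g I J K) (hU : IsOpen U)
    (hα : IsKahlerPrimitiveOn U g I α) (hx : x ∈ U) (u v w : E) :
    g x (covEnd g I x u v) w = -g x (covEnd g I x u w) v := by
  have h1 := h.covEnd_of_primitive hU hα hx u v w
  have h2 := h.covEnd_of_primitive hU hα hx u w v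
  have ht := h.triple x hx
  have hs := h.metric.symm x hx
  linarith [ht.skew_I (christoffel g x u v) w, ht.skew_I (christoffel g x u w) v,
    hs (I x w) (christoffel g x u v), hs (I x v) (christoffel g x u w)]

/-- This is `dΩ_I = 0` written with a torsion-free connection. In the cyclic sum the second
derivatives of `α` cancel in pairs and the Christoffel terms cancel by skewness of `I`. -/
theorem covEnd_cyclic_of_primitive (h : IsAlmostHyperHermitianOn U g I J K) (hU : IsOpen U)
    (hα : IsKahlerPrimitiveOn U g I α) (hx : x ∈ U) (u v w : E) :
    g x (covEnd g I x u v) w + g x (covEnd g I x v w) u + g x (covEnd g I x w u) v = 0 := by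
  have h1 := h.covEnd_of_primitive hU hα hx u v w
  have h2 := h.covEnd_of_primitive hU hα hx v w u
  have h3 := h.covEnd_of_primitive hU hα hx w u v
  have ht := h.triple x hx
  have hs := h.metric.symm x hx
  have hαx := hα.contDiffOn.contDiffAt (hU.mem_nhds hx)
  have e1 := congrArg (fun f : E →L[ℝ] ℝ => f w) (fderiv_fderiv_symm hαx u v)
  have e2 := congrArg (fun f : E →L[ℝ] ℝ => f u) (fderiv_fderiv_symm hαx v w)
  have e3 := congrArg (fun f : E →L[ℝ] ℝ => f v) (fderiv_fderiv_symm hαx w u)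
  rw [h.metric.christoffel_symm hU hx v u] at h2
  rw [h.metric.christoffel_symm hU hx w u, h.metric.christoffel_symm hU hx w v] at h3
  linarith [ht.skew_I (christoffel g x u v) w, ht.skew_I (christoffel g x v w) u,
    ht.skew_I (christoffel g x u w) v, hs (I x w) (christoffel g x u v),
    hs (I x u) (christoffel g x v w), hs (I x v) (christoffel g x u w)]

/-- Hitchin's lemma: an almost hyper-Hermitian structure with closed Kähler forms is parallel. -/
theorem covEnd_eq_zero_of_primitives (h : IsAlmostHyperHermitianOn U g I J K) (hU : IsOpen U)
    (hα : IsKahlerPrimitiveOn U g I α) (hβ : IsKahlerPrimitiveOn U g J β)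
    (hγ : IsKahlerPrimitiveOn U g K γ) (hx : x ∈ U) (u : E) : covEnd g I x u = 0 := by
  have ht := h.triple x hx
  have sI := h.covEnd_skew_of_primitive hU hα hx
  have cI := h.covEnd_cyclic_of_primitive hU hα hx
  have sJ := h.rotate.covEnd_skew_of_primitive hU hβ hx
  have cJ := h.rotate.covEnd_cyclic_of_primitive hU hβ hx
  have sK := h.rotate.rotate.covEnd_skew_of_primitive hU hγ hx
  have cK := h.rotate.rotate.covEnd_cyclic_of_primitive hU hγ hx
  have aI : ∀ u v w, g x (covEnd g I x u (I x v)) w = g x (covEnd g I x u v) (I x w) := by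
    intro u v w
    have := congrArg (fun z => g x z w) (h.covEnd_I_comp_self hU hx u v)
    simp only [map_add, add_apply, map_zero, zero_apply] at this
    linarith [ht.skew_I (covEnd g I x u v) w]
  have eK : ∀ u v w, g x (covEnd g K x u v) w
      = g x (covEnd g I x u (J x v)) w - g x (covEnd g J x u v) (I x w) := by
    intro u v w
    have := congrArg (fun z => g x z w) (h.covEnd_K hU hx u v)
    simp only [map_add, add_apply] at this
    linarith [ht.skew_I (covEnd g J x u v) w]
  have eK' : ∀ u v w, g x (covEnd g K x u v) w
      = g x (covEnd g I x u v) (J x w) - g x (covEnd g J x u (I x v)) w := by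
    intro u v w
    linarith [eK u w v, sK u v w, sI u (J x w) v, sJ u w (I x v)]
  -- Closedness of `Ω_J` and `Ω_K` implies integrability of `I`: the identity says that `(∇_{Iu} I)
  -- v + (∇_u I) I v` is symmetric in `u` and `v`, a form of the vanishing of the Nijenhuis tensor.
  have key : ∀ u v w, g x (covEnd g I x (I x u) v) (J x w) + g x (covEnd g I x u (I x v)) (J x w)
      = g x (covEnd g I x (I x v) u) (J x w) + g x (covEnd g I x v (I x u)) (J x w) := by
    intro u v w
    have h1 := cJ u v w
    have h2 := cJ (I x u) (I x v) w
    have h3 := cK (I x u) v w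
    have h4 := cK u (I x v) w
    have e1 := eK' w (I x u) v
    have e2 := eK w u (I x v)
    have e3 := eK' u (I x v) w
    have e4 := eK' (I x u) v w
    have e5 := eK v w (I x u)
    have e6 := eK (I x v) w u
    have e7 := eK' w u (I x v)
    have e8 := aI w u (J x v)
    simp only [ht.I_sq, ht.IJ, ht.JI, map_neg, neg_apply] at e1 e2 e3 e5 e7 e8
    linarith [sI v (J x w) (I x u), sI (I x v) (J x w) u]
  have key' : ∀ u v w, g x (covEnd g I x (I x u) v) w + g x (covEnd g I x u (I x v)) w
      = g x (covEnd g I x (I x v) u) w + g x (covEnd g I x v (I x u)) w := by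
    intro u v w
    have := key u v (-J x w)
    simpa only [map_neg, ht.J_sq, neg_neg] using this
  -- Paired with `w`, this expression is symmetric in `u`, `v` and skew in `v`, `w`; such a
  -- trilinear form is zero.
  have M : ∀ u v w, g x (covEnd g I x (I x u) v) w + g x (covEnd g I x u (I x v)) w = 0 := by
    intro u v w
    linarith [key' u v w, key' v w u, key' w u v, sI (I x u) v w, sI (I x v) w u, sI (I x w) u v,
      aI u v w, aI v w u, aI w u v, sI u (I x v) w, sI v (I x w) u, sI w (I x u) v,
      aI u w v, aI v u w, aI w v u, sI u (I x w) v, sI v (I x u) w, sI w (I x v) u]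
  -- The remaining step from integrable with closed form to Kähler: two instances of `dΩ_I = 0` are
  -- added, and `M` cancels everything except twice the desired term.
  have zero : ∀ u v w, g x (covEnd g I x u v) (I x w) = 0 := by
    intro u v w
    linarith [cI (I x w) u v, cI w u (I x v), M w u v, M v w u, aI v w u, aI u v w, aI w u v]
  ext v
  refine eq_zero_of_forall_form_eq_zero (h.metric.pos x hx) fun w => ?_
  have := zero u v (-I x w)
  rwa [map_neg, ht.I_sq, neg_neg] at this

theorem isHyperKahlerOn_of_primitives (h : IsAlmostHyperHermitianOn U g I J K) (hU : IsOpen U)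
    (hα : IsKahlerPrimitiveOn U g I α) (hβ : IsKahlerPrimitiveOn U g J β)
    (hγ : IsKahlerPrimitiveOn U g K γ) : IsHyperKahlerOn U g I J K where
  contDiffOn_g := h.metric.contDiffOn
  contDiffOn_I := h.contDiffOn_I
  contDiffOn_J := h.contDiffOn_J
  contDiffOn_K := h.contDiffOn_K
  symm := h.metric.symm
  pos := h.metric.pos
  triple := h.triple
  parallel_I _ hx u := h.covEnd_eq_zero_of_primitives hU hα hβ hγ hx u
  parallel_J _ hx u := h.rotate.covEnd_eq_zero_of_primitives hU hβ hγ hα hx u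
  parallel_K _ hx u := h.rotate.rotate.covEnd_eq_zero_of_primitives hU hγ hα hβ hx u

end IsAlmostHyperHermitianOn

end HyperKahler


/-! ### The fields dual to the Lee form -/

section Fields

variable {E : Type*} [NormedAddCommGroup E] [NormedSpace ℝ E]
  {U : Set E} {g : E → E →L[ℝ] E →L[ℝ] ℝ} {I J K : E → E →L[ℝ] E} {ψ : E → E →L[ℝ] ℝ}
  {ν : ℝ} {t : E → ℝ} {x : E}

/-- A hyper-Hermitian quaternionic Kähler structure with `ν < 0`, exact Lee form
`-ψ = -d (log t)`, and `|ψ|² = -ν`. -/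
structure IsExactHHqKOn (U : Set E) (g : E → E →L[ℝ] E →L[ℝ] ℝ) (I J K : E → E →L[ℝ] E)
    (ψ : E → E →L[ℝ] ℝ) (ν : ℝ) (t : E → ℝ) : Prop extends IsHHqKOn U g I J K ψ ν where
  neg : ν < 0
  normSq : ∀ x ∈ U, covectorNormSq g x (ψ x) = -ν
  contDiffOn_t : ContDiffOn ℝ ∞ t U
  t_pos : ∀ x ∈ U, 0 < t x
  hasFDerivAt_t : ∀ x ∈ U, HasFDerivAt t (t x • ψ x) x

/-- The `1`-form `t ψ ∘ A`. -/
def scaledForm (t : E → ℝ) (ψ : E → E →L[ℝ] ℝ) (A : E → E →L[ℝ] E) (x : E) : E →L[ℝ] ℝ :=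
  t x • (ψ x ∘L A x)

/-- The vector which is dual to `ψ`. -/
def dualVector (g : E → E →L[ℝ] E →L[ℝ] ℝ) (ψ : E → E →L[ℝ] ℝ) (x : E) : E :=
  (g x).inverse (ψ x)

/-- The vector fields `-(1 / (ν t)) (Ψ, -I Ψ, -J Ψ, -K Ψ)`, where `Ψ` is dual to `ψ`. -/
def leeFields (g : E → E →L[ℝ] E →L[ℝ] ℝ) (I J K : E → E →L[ℝ] E) (ψ : E → E →L[ℝ] ℝ)
    (ν : ℝ) (t : E → ℝ) (x : E) : EuclideanSpace ℝ (Fin 4) →L[ℝ] E :=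
  (-(1 / (ν * t x))) •
    ((EuclideanSpace.proj (0 : Fin 4) : EuclideanSpace ℝ (Fin 4) →L[ℝ] ℝ).smulRight
        (dualVector g ψ x)
      - (EuclideanSpace.proj (1 : Fin 4) : EuclideanSpace ℝ (Fin 4) →L[ℝ] ℝ).smulRight
        (I x (dualVector g ψ x))
      - (EuclideanSpace.proj (2 : Fin 4) : EuclideanSpace ℝ (Fin 4) →L[ℝ] ℝ).smulRight
        (J x (dualVector g ψ x))
      - (EuclideanSpace.proj (3 : Fin 4) : EuclideanSpace ℝ (Fin 4) →L[ℝ] ℝ).smulRight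
        (K x (dualVector g ψ x)))

theorem leeFields_apply (g : E → E →L[ℝ] E →L[ℝ] ℝ) (I J K : E → E →L[ℝ] E)
    (ψ : E → E →L[ℝ] ℝ) (ν : ℝ) (t : E → ℝ) (x : E) (p : EuclideanSpace ℝ (Fin 4)) :
    leeFields g I J K ψ ν t x p = (-(1 / (ν * t x))) •
      (p 0 • dualVector g ψ x - p 1 • I x (dualVector g ψ x) - p 2 • J x (dualVector g ψ x)
        - p 3 • K x (dualVector g ψ x)) := rfl

/-- The transverse metric `t (g + (1 / ν) (ψ² + (ψ I)² + (ψ J)² + (ψ K)²))`. -/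
def transverseForm (g : E → E →L[ℝ] E →L[ℝ] ℝ) (I J K : E → E →L[ℝ] E) (ψ : E → E →L[ℝ] ℝ)
    (ν : ℝ) (t : E → ℝ) (x : E) : E →L[ℝ] E →L[ℝ] ℝ :=
  t x • (g x + (1 / ν) • ((ψ x).smulRight (ψ x) + (ψ x ∘L I x).smulRight (ψ x ∘L I x)
    + (ψ x ∘L J x).smulRight (ψ x ∘L J x) + (ψ x ∘L K x).smulRight (ψ x ∘L K x)))

theorem transverseForm_apply (g : E → E →L[ℝ] E →L[ℝ] ℝ) (I J K : E → E →L[ℝ] E)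
    (ψ : E → E →L[ℝ] ℝ) (ν : ℝ) (t : E → ℝ) (x u v : E) :
    transverseForm g I J K ψ ν t x u v = t x * (g x u v + 1 / ν * (ψ x u * ψ x v
      + ψ x (I x u) * ψ x (I x v) + ψ x (J x u) * ψ x (J x v) + ψ x (K x u) * ψ x (K x v))) := rfl

theorem transverseForm_rotate (g : E → E →L[ℝ] E →L[ℝ] ℝ) (I J K : E → E →L[ℝ] E)
    (ψ : E → E →L[ℝ] ℝ) (ν : ℝ) (t : E → ℝ) :
    transverseForm g J K I ψ ν t = transverseForm g I J K ψ ν t := by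
  ext x u v
  rw [transverseForm_apply, transverseForm_apply]
  ring

namespace IsExactHHqKOn

theorem rotate (h : IsExactHHqKOn U g I J K ψ ν t) : IsExactHHqKOn U g J K I ψ ν t :=
  { h with
    toIsHHqKOn := ⟨h.toIsAlmostHyperHermitianOn.rotate, h.contDiffOn_ψ, h.curv_J, h.curv_K,
      h.curv_I⟩ }

theorem extDerivOne_scaledForm (h : IsExactHHqKOn U g I J K ψ ν t) (hU : IsOpen U) (hx : x ∈ U)
    (u v : E) :
    extDerivOne (scaledForm t ψ I) x u v = t x * (-ν * g x (I x u) v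
      + (ψ x u * ψ x (I x v) - ψ x v * ψ x (I x u))
      - (ψ x (J x u) * ψ x (K x v) - ψ x (J x v) * ψ x (K x u))) := by
  have h1 : DifferentiableAt ℝ (fun y => ψ y ∘L I y) x :=
    ((h.contDiffOn_ψ.clm_comp h.contDiffOn_I).contDiffAt (hU.mem_nhds hx)).differentiableAt
      (by simp)
  have h2 : HasFDerivAt (scaledForm t ψ I) _ x := (h.hasFDerivAt_t x hx).smul h1.hasFDerivAt
  have h3 := h.curv_I x hx u v
  rw [extDerivOne] at h3 ⊢
  rw [h2.fderiv]
  simp only [add_apply, smul_apply, ContinuousLinearMap.smulRight_apply, smul_eq_mul,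
    ContinuousLinearMap.comp_apply]
  linear_combination t x * h3

theorem extDerivOne_scaledForm_id (h : IsExactHHqKOn U g I J K ψ ν t) (hU : IsOpen U)
    (hx : x ∈ U) (u v : E) :
    extDerivOne (scaledForm t ψ fun _ => ContinuousLinearMap.id ℝ E) x u v = 0 := by
  have h1 : (scaledForm t ψ fun _ => ContinuousLinearMap.id ℝ E) =ᶠ[nhds x] fderiv ℝ t := by
    filter_upwards [hU.mem_nhds hx] with y hy
    rw [(h.hasFDerivAt_t y hy).fderiv]
    rfl
  rw [extDerivOne, h1.fderiv_eq, fderiv_fderiv_symm (h.contDiffOn_t.contDiffAt (hU.mem_nhds hx)),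
    sub_self]

theorem contDiffOn_scaledForm (h : IsExactHHqKOn U g I J K ψ ν t) {A : E → E →L[ℝ] E}
    (hA : ContDiffOn ℝ ∞ A U) : ContDiffOn ℝ ∞ (scaledForm t ψ A) U :=
  h.contDiffOn_t.smul (h.contDiffOn_ψ.clm_comp hA)

theorem form_dualVector [FiniteDimensional ℝ E]
    (h : IsExactHHqKOn U g I J K ψ ν t) (hx : x ∈ U) (v : E) :
    g x (dualVector g ψ x) v = ψ x v :=
  form_inverse_apply (h.metric.pos x hx) _ _

theorem apply_dualVector (h : IsExactHHqKOn U g I J K ψ ν t) (hx : x ∈ U) :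
    ψ x (dualVector g ψ x) = -ν :=
  h.normSq x hx

theorem apply_I_dualVector [FiniteDimensional ℝ E]
    (h : IsExactHHqKOn U g I J K ψ ν t) (hx : x ∈ U) :
    ψ x (I x (dualVector g ψ x)) = 0 := by
  rw [← h.form_dualVector hx, h.metric.symm x hx,
    (h.triple x hx).form_I_self (h.metric.symm x hx)]

theorem form_I_dualVector [FiniteDimensional ℝ E]
    (h : IsExactHHqKOn U g I J K ψ ν t) (hx : x ∈ U) (v : E) :
    g x (I x (dualVector g ψ x)) v = -ψ x (I x v) := by
  rw [(h.triple x hx).skew_I, h.form_dualVector hx]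

/-- The condition `|ψ|² = -ν` enters here: along the line of `Ψ` the term with `Ω_I` cancels against
the two wedge products. -/
theorem extDerivOne_scaledForm_leeFields [FiniteDimensional ℝ E]
    (h : IsExactHHqKOn U g I J K ψ ν t) (hU : IsOpen U)
    (hx : x ∈ U) (p : EuclideanSpace ℝ (Fin 4)) (v : E) :
    extDerivOne (scaledForm t ψ I) x (leeFields g I J K ψ ν t x p) v = 0 := by
  have ht := h.triple x hx
  rw [h.extDerivOne_scaledForm hU hx, leeFields_apply]
  simp only [map_smul, map_sub, smul_apply, sub_apply, smul_eq_mul, ht.I_sq, ht.J_sq, ht.K_sq,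
    ht.IJ, ht.JK, ht.KI, ht.JI, ht.KJ, ht.IK, map_neg, neg_apply, h.form_dualVector hx,
    h.apply_dualVector hx, h.apply_I_dualVector hx, h.rotate.apply_I_dualVector hx,
    h.rotate.rotate.apply_I_dualVector hx, h.form_I_dualVector hx, h.rotate.form_I_dualVector hx,
    h.rotate.rotate.form_I_dualVector hx]
  ring

/-- The normalization `-(1 / (ν t))` and the signs in `leeFields` are chosen for this duality: `ψ(Ψ)
= -ν`, and `ψ` vanishes on `I Ψ`, `J Ψ`, `K Ψ`. -/
theorem scaledForm_leeFields [FiniteDimensional ℝ E]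
    (h : IsExactHHqKOn U g I J K ψ ν t) (hx : x ∈ U)
    (p : EuclideanSpace ℝ (Fin 4)) :
    scaledForm t ψ (fun _ => ContinuousLinearMap.id ℝ E) x (leeFields g I J K ψ ν t x p) = p 0 ∧
    scaledForm t ψ I x (leeFields g I J K ψ ν t x p) = p 1 ∧
    scaledForm t ψ J x (leeFields g I J K ψ ν t x p) = p 2 ∧
    scaledForm t ψ K x (leeFields g I J K ψ ν t x p) = p 3 := by
  have ht := h.triple x hx
  have h1 := (h.t_pos x hx).ne'
  have h2 := h.neg.ne
  simp only [scaledForm, leeFields_apply, smul_apply, ContinuousLinearMap.comp_apply,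
    ContinuousLinearMap.id_apply, map_smul, map_sub, smul_eq_mul, ht.I_sq, ht.J_sq,
    ht.K_sq, ht.IJ, ht.JK, ht.KI, ht.JI, ht.KJ, ht.IK, map_neg,
    h.apply_dualVector hx, h.apply_I_dualVector hx, h.rotate.apply_I_dualVector hx,
    h.rotate.rotate.apply_I_dualVector hx]
  refine ⟨?_, ?_, ?_, ?_⟩ <;> field_simp <;> ring

theorem leeFields_injective [FiniteDimensional ℝ E]
    (h : IsExactHHqKOn U g I J K ψ ν t) (hx : x ∈ U) :
    Function.Injective (leeFields g I J K ψ ν t x) := by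
  intro p q hpq
  have h1 := h.scaledForm_leeFields hx p
  have h2 := h.scaledForm_leeFields hx q
  rw [hpq] at h1
  ext i
  fin_cases i
  · exact h1.1.symm.trans h2.1
  · exact h1.2.1.symm.trans h2.2.1
  · exact h1.2.2.1.symm.trans h2.2.2.1
  · exact h1.2.2.2.symm.trans h2.2.2.2

theorem exists_leeFields_eq_I [FiniteDimensional ℝ E]
    (h : IsExactHHqKOn U g I J K ψ ν t) (hx : x ∈ U)
    (p : EuclideanSpace ℝ (Fin 4)) :
    ∃ q, I x (leeFields g I J K ψ ν t x p) = leeFields g I J K ψ ν t x q := by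
  have ht := h.triple x hx
  refine ⟨!₂[p 1, -p 0, -p 3, p 2], ?_⟩
  simp only [leeFields_apply, map_smul, map_sub, ht.I_sq, ht.IJ, ht.IK]
  simp
  module

theorem exists_leeFields_eq_J [FiniteDimensional ℝ E]
    (h : IsExactHHqKOn U g I J K ψ ν t) (hx : x ∈ U)
    (p : EuclideanSpace ℝ (Fin 4)) :
    ∃ q, J x (leeFields g I J K ψ ν t x p) = leeFields g I J K ψ ν t x q := by
  have ht := h.triple x hx
  refine ⟨!₂[p 2, p 3, -p 0, -p 1], ?_⟩
  simp only [leeFields_apply, map_smul, map_sub, ht.J_sq, ht.JI, ht.JK]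
  simp
  module

theorem exists_leeFields_eq_K [FiniteDimensional ℝ E]
    (h : IsExactHHqKOn U g I J K ψ ν t) (hx : x ∈ U)
    (p : EuclideanSpace ℝ (Fin 4)) :
    ∃ q, K x (leeFields g I J K ψ ν t x p) = leeFields g I J K ψ ν t x q := by
  obtain ⟨q, hq⟩ := h.exists_leeFields_eq_J hx p
  obtain ⟨r, hr⟩ := h.exists_leeFields_eq_I hx q
  exact ⟨r, by rw [← (h.triple x hx).IJ, hq, hr]⟩

theorem transverseForm_triple (h : IsExactHHqKOn U g I J K ψ ν t) (hx : x ∈ U) :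
    IsHyperHermitianTriple (transverseForm g I J K ψ ν t x) (I x) (J x) (K x) := by
  have key : ∀ {I J K : E → E →L[ℝ] E}, IsExactHHqKOn U g I J K ψ ν t → ∀ u v,
      transverseForm g I J K ψ ν t x (I x u) (I x v) = transverseForm g I J K ψ ν t x u v := by
    intro I J K h u v
    have ht := h.triple x hx
    rw [transverseForm_apply, transverseForm_apply, ht.orthogonal_I]
    simp only [ht.I_sq, ht.JI, ht.KI, map_neg]
    ring
  have ht := h.triple x hx
  refine ⟨ht.I_sq, ht.J_sq, ht.K_sq, ht.IJK, key h, ?_, ?_⟩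
  · intro u v
    have := key h.rotate u v
    rwa [transverseForm_rotate] at this
  · intro u v
    have := key h.rotate.rotate u v
    rwa [transverseForm_rotate, transverseForm_rotate] at this

theorem transverseForm_symm (h : IsExactHHqKOn U g I J K ψ ν t) (hx : x ∈ U) (u v : E) :
    transverseForm g I J K ψ ν t x u v = transverseForm g I J K ψ ν t x v u := by
  rw [transverseForm_apply, transverseForm_apply, h.metric.symm x hx]
  ring

theorem transverseForm_leeFields [FiniteDimensional ℝ E]
    (h : IsExactHHqKOn U g I J K ψ ν t) (hx : x ∈ U)
    (p : EuclideanSpace ℝ (Fin 4)) (v : E) :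
    transverseForm g I J K ψ ν t x (leeFields g I J K ψ ν t x p) v = 0 := by
  have ht := h.triple x hx
  have h2 := h.neg.ne
  rw [transverseForm_apply, leeFields_apply]
  simp only [map_smul, map_sub, smul_apply, sub_apply, smul_eq_mul, ht.I_sq, ht.J_sq, ht.K_sq,
    ht.IJ, ht.JK, ht.KI, ht.JI, ht.KJ, ht.IK, map_neg, h.form_dualVector hx,
    h.apply_dualVector hx, h.apply_I_dualVector hx, h.rotate.apply_I_dualVector hx,
    h.rotate.rotate.apply_I_dualVector hx, h.form_I_dualVector hx, h.rotate.form_I_dualVector hx,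
    h.rotate.rotate.form_I_dualVector hx]
  field_simp
  ring

theorem transverseForm_pos [FiniteDimensional ℝ E]
    (h : IsExactHHqKOn U g I J K ψ ν t) (hx : x ∈ U) (v : E)
    (hv : ∀ p, v ≠ leeFields g I J K ψ ν t x p) : 0 < transverseForm g I J K ψ ν t x v v := by
  -- By duality these are the coordinates of the component of `v` along the fields. The rest `w` is
  -- annihilated by `ψ`, `ψI`, `ψJ`, `ψK`, so the transverse form of `w` is just `t g(w, w)`.
  let p : EuclideanSpace ℝ (Fin 4) := !₂[t x * ψ x v, t x * ψ x (I x v), t x * ψ x (J x v),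
    t x * ψ x (K x v)]
  let w := v - leeFields g I J K ψ ν t x p
  have hw : w ≠ 0 := sub_ne_zero.2 (hv p)
  have h1 : transverseForm g I J K ψ ν t x v v = transverseForm g I J K ψ ν t x w w := by
    simp only [w, map_sub, sub_apply, h.transverseForm_leeFields hx]
    rw [h.transverseForm_symm hx v (leeFields g I J K ψ ν t x p), h.transverseForm_leeFields hx]
    ring
  have htx := h.t_pos x hx
  obtain ⟨e0, e1, e2, e3⟩ := h.scaledForm_leeFields hx p
  have f0 : ψ x w = 0 := by
    have : t x * ψ x w = 0 := by
      simp only [w, map_sub, mul_sub]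
      exact sub_eq_zero.2 e0.symm
    exact (mul_eq_zero.1 this).resolve_left htx.ne'
  have f1 : ψ x (I x w) = 0 := by
    have : t x * ψ x (I x w) = 0 := by
      simp only [w, map_sub, mul_sub]
      exact sub_eq_zero.2 e1.symm
    exact (mul_eq_zero.1 this).resolve_left htx.ne'
  have f2 : ψ x (J x w) = 0 := by
    have : t x * ψ x (J x w) = 0 := by
      simp only [w, map_sub, mul_sub]
      exact sub_eq_zero.2 e2.symm
    exact (mul_eq_zero.1 this).resolve_left htx.ne'
  have f3 : ψ x (K x w) = 0 := by
    have : t x * ψ x (K x w) = 0 := by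
      simp only [w, map_sub, mul_sub]
      exact sub_eq_zero.2 e3.symm
    exact (mul_eq_zero.1 this).resolve_left htx.ne'
  rw [h1, transverseForm_apply, f0, f1, f2, f3]
  have := h.metric.pos x hx w hw
  simp only [mul_zero, add_zero]
  positivity

/-- The derivatives of the scaled forms are the transverse Kähler forms, up to the factor `-ν`. -/
theorem extDerivOne_scaledForm_eq_transverseForm (h : IsExactHHqKOn U g I J K ψ ν t)
    (hU : IsOpen U) (hx : x ∈ U) (u v : E) :
    extDerivOne (scaledForm t ψ I) x u v = -ν * transverseForm g I J K ψ ν t x (I x u) v := by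
  have ht := h.triple x hx
  have h2 := h.neg.ne
  rw [h.extDerivOne_scaledForm hU hx, transverseForm_apply]
  simp only [ht.I_sq, ht.JI, ht.KI, map_neg]
  field_simp
  ring

theorem contDiffOn_leeFields [FiniteDimensional ℝ E]
    (h : IsExactHHqKOn U g I J K ψ ν t) (hU : IsOpen U) :
    ContDiffOn ℝ ∞ (leeFields g I J K ψ ν t) U := by
  intro x hx
  have hn := hU.mem_nhds hx
  have h1 : ContDiffAt ℝ ∞ (dualVector g ψ) x :=
    (h.metric.contDiffAt_inverse hU hx).clm_apply (h.contDiffOn_ψ.contDiffAt hn)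
  have h2 : ContDiffAt ℝ ∞ (fun y => -(1 / (ν * t y))) x :=
    (contDiffAt_const.div (contDiffAt_const.mul (h.contDiffOn_t.contDiffAt hn))
      (mul_ne_zero h.neg.ne (h.t_pos x hx).ne')).neg
  have h3 : ∀ (i : Fin 4) {f : E → E}, ContDiffAt ℝ ∞ f x → ContDiffAt ℝ ∞ (fun y =>
      (EuclideanSpace.proj i : EuclideanSpace ℝ (Fin 4) →L[ℝ] ℝ).smulRight (f y)) x :=
    fun i f hf => contDiffAt_const.smulRight hf
  exact (h2.smul ((((h3 0 h1).sub
    (h3 1 ((h.contDiffOn_I.contDiffAt hn).clm_apply h1))).sub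
    (h3 2 ((h.contDiffOn_J.contDiffAt hn).clm_apply h1))).sub
    (h3 3 ((h.contDiffOn_K.contDiffAt hn).clm_apply h1)))).contDiffWithinAt

end IsExactHHqKOn

/-- Vector fields on which a `1`-form `θ` is constant, and which are in the kernel of `dθ`: their
brackets are in the kernels of `θ` and of `dθ`. -/
theorem bracket_mem_kernel {P : Type*} [NormedAddCommGroup P] [NormedSpace ℝ P] (hU : IsOpen U)
    {θ : E → E →L[ℝ] ℝ} {X : E → P →L[ℝ] E} {l : P → ℝ} (hθ : ContDiffOn ℝ ∞ θ U)
    (hX : ContDiffOn ℝ ∞ X U) (hl : ∀ x ∈ U, ∀ p, θ x (X x p) = l p)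
    (hk : ∀ x ∈ U, ∀ p v, extDerivOne θ x (X x p) v = 0) (hx : x ∈ U) (p q : P) :
    θ x (fderiv ℝ X x (X x p) q - fderiv ℝ X x (X x q) p) = 0 ∧
    ∀ v, extDerivOne θ x (fderiv ℝ X x (X x p) q - fderiv ℝ X x (X x q) p) v = 0 := by
  have hn := hU.mem_nhds hx
  have hθ' := hθ.contDiffAt hn
  have dθ : HasFDerivAt θ (fderiv ℝ θ x) x := (hθ'.differentiableAt (by simp)).hasFDerivAt
  have ddθ := ContDiffAt.hasFDerivAt_fderiv hθ'
  have dX : ∀ q, HasFDerivAt (fun y => X y q) ((fderiv ℝ X x).flip q) x := by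
    intro q
    have := ((hX.contDiffAt hn).differentiableAt (by simp)).hasFDerivAt.clm_apply
      (hasFDerivAt_const q x)
    simpa using this
  -- The two hypotheses are identities on all of `U` and may be differentiated. Together with the
  -- symmetry of second derivatives they replace Cartan's formula for the bracket.
  have h1 : ∀ q u, fderiv ℝ θ x u (X x q) + θ x (fderiv ℝ X x u q) = 0 := by
    intro q u
    have e1 := dθ.clm_apply (dX q)
    have e2 : (fun y => θ y (X y q)) =ᶠ[nhds x] fun _ => l q := by
      filter_upwards [hn] with y hy using hl y hy q
    have e3 := congrArg (fun f : E →L[ℝ] ℝ => f u)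
      (e1.unique ((hasFDerivAt_const (l q) x).congr_of_eventuallyEq e2))
    simp at e3
    linarith
  have h2 : ∀ q u v, fderiv ℝ (fderiv ℝ θ) x u (X x q) v - fderiv ℝ (fderiv ℝ θ) x u v (X x q)
      + extDerivOne θ x (fderiv ℝ X x u q) v = 0 := by
    intro q u v
    have e1 := ((ddθ.clm_apply (dX q)).clm_apply (hasFDerivAt_const v x)).sub
      ((ddθ.clm_apply (hasFDerivAt_const v x)).clm_apply (dX q))
    have e2 : (fun y => fderiv ℝ θ y (X y q) v - fderiv ℝ θ y v (X y q)) =ᶠ[nhds x]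
        fun _ => (0 : ℝ) := by
      filter_upwards [hn] with y hy using hk y hy q v
    have e3 := congrArg (fun f : E →L[ℝ] ℝ => f u)
      (e1.unique ((hasFDerivAt_const (0 : ℝ) x).congr_of_eventuallyEq e2))
    simp at e3
    rw [extDerivOne]
    linarith
  constructor
  · have e1 := h1 q (X x p)
    have e2 := h1 p (X x q)
    have e3 := hk x hx p (X x q)
    rw [extDerivOne] at e3
    rw [map_sub]
    linarith
  · intro v
    have e1 := h2 q (X x p) v
    have e2 := h2 p (X x q) v
    have e3 := h2 q v (X x p)
    have e4 : extDerivOne θ x (fderiv ℝ X x v q) (X x p) = 0 := by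
      have := hk x hx p (fderiv ℝ X x v q)
      rw [extDerivOne] at this ⊢
      linarith
    have s1 := congrArg (fun f : E →L[ℝ] ℝ => f v) (fderiv_fderiv_symm hθ' (X x p) (X x q))
    have s2 := congrArg (fun f : E →L[ℝ] ℝ => f (X x q)) (fderiv_fderiv_symm hθ' (X x p) v)
    have s3 := congrArg (fun f : E →L[ℝ] ℝ => f (X x p)) (fderiv_fderiv_symm hθ' (X x q) v)
    simp only [extDerivOne, map_sub, sub_apply] at e1 e2 e4 ⊢
    rw [extDerivOne] at e3
    linarith

/-- The bracket of two of the fields is annihilated by `ψ`, `ψI`, `ψJ`, `ψK` and lies in the kernel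
of `d(t ψI)`. On the common kernel of the four forms `d(t ψI)` reduces to `-ν t Ω_I`, which is
nondegenerate. -/
theorem IsExactHHqKOn.leeFields_commute [FiniteDimensional ℝ E]
    (h : IsExactHHqKOn U g I J K ψ ν t) (hU : IsOpen U) (hx : x ∈ U)
    (p q : EuclideanSpace ℝ (Fin 4)) :
    fderiv ℝ (leeFields g I J K ψ ν t) x (leeFields g I J K ψ ν t x p) q
      = fderiv ℝ (leeFields g I J K ψ ν t) x (leeFields g I J K ψ ν t x q) p := by
  have ht := h.triple x hx
  have hX := h.contDiffOn_leeFields hU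
  have k0 := (bracket_mem_kernel hU (h.contDiffOn_scaledForm contDiffOn_const) hX
    (fun x hx p => (h.scaledForm_leeFields hx p).1)
    (fun x hx p v => h.extDerivOne_scaledForm_id hU hx _ v) hx p q).1
  obtain ⟨k1, kI⟩ := bracket_mem_kernel hU (h.contDiffOn_scaledForm h.contDiffOn_I) hX
    (fun x hx p => (h.scaledForm_leeFields hx p).2.1)
    (fun x hx p v => h.extDerivOne_scaledForm_leeFields hU hx p v) hx p q
  -- Rotating `I`, `J`, `K` permutes the components of `leeFields`, so the case of `I` cannot be
  -- rotated directly. Instead, `J` preserves the span of the fields, on which the transverse form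
  -- is degenerate.
  have hJ : ∀ x ∈ U, ∀ p v, extDerivOne (scaledForm t ψ J) x (leeFields g I J K ψ ν t x p) v = 0 := by
    intro x hx p v
    rw [h.rotate.extDerivOne_scaledForm_eq_transverseForm hU hx, transverseForm_rotate]
    obtain ⟨r, hr⟩ := h.exists_leeFields_eq_J hx p
    rw [hr, h.transverseForm_leeFields hx, mul_zero]
  have hK : ∀ x ∈ U, ∀ p v, extDerivOne (scaledForm t ψ K) x (leeFields g I J K ψ ν t x p) v = 0 := by
    intro x hx p v
    rw [h.rotate.rotate.extDerivOne_scaledForm_eq_transverseForm hU hx, transverseForm_rotate,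
      transverseForm_rotate]
    obtain ⟨r, hr⟩ := h.exists_leeFields_eq_K hx p
    rw [hr, h.transverseForm_leeFields hx, mul_zero]
  have k2 := (bracket_mem_kernel hU (h.contDiffOn_scaledForm h.contDiffOn_J) hX
    (fun x hx p => (h.scaledForm_leeFields hx p).2.2.1) hJ hx p q).1
  have k3 := (bracket_mem_kernel hU (h.contDiffOn_scaledForm h.contDiffOn_K) hX
    (fun x hx p => (h.scaledForm_leeFields hx p).2.2.2) hK hx p q).1
  rw [← sub_eq_zero]
  generalize fderiv ℝ (leeFields g I J K ψ ν t) x (leeFields g I J K ψ ν t x p) q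
      - fderiv ℝ (leeFields g I J K ψ ν t) x (leeFields g I J K ψ ν t x q) p = z at *
  have htx := (h.t_pos x hx).ne'
  have f0 : ψ x z = 0 := (mul_eq_zero.1 (show t x * ψ x z = 0 from k0)).resolve_left htx
  have f1 : ψ x (I x z) = 0 := (mul_eq_zero.1 (show t x * ψ x (I x z) = 0 from k1)).resolve_left htx
  have f2 : ψ x (J x z) = 0 := (mul_eq_zero.1 (show t x * ψ x (J x z) = 0 from k2)).resolve_left htx
  have f3 : ψ x (K x z) = 0 := (mul_eq_zero.1 (show t x * ψ x (K x z) = 0 from k3)).resolve_left htx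
  have hz : I x z = 0 := by
    refine eq_zero_of_forall_form_eq_zero (h.metric.pos x hx) fun w => ?_
    have := kI w
    rw [h.extDerivOne_scaledForm hU hx, f0, f1, f2, f3] at this
    have h2 := h.neg.ne
    simpa [htx, h2] using this
  have := ht.I_sq z
  rw [hz, map_zero] at this
  exact neg_eq_zero.1 this.symm

end Fields


/-! ### Descent along straightened vector fields -/

section Descent

/-- Through `r` the space `F` is the quotient of `E` by the span of the fields, with section `a`.
The form is degenerate along this span and `I`, `J`, `K` preserve it, so both pass to the quotient;
inserting `a ∘ r` changes a vector only by an element of the span. -/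
theorem IsHyperHermitianTriple.descend {E F P : Type*} [NormedAddCommGroup E] [NormedSpace ℝ E]
    [NormedAddCommGroup F] [NormedSpace ℝ F] [NormedAddCommGroup P] [NormedSpace ℝ P]
    {b : E →L[ℝ] E →L[ℝ] ℝ} {I J K : E →L[ℝ] E} (h : IsHyperHermitianTriple b I J K)
    {X : P →L[ℝ] E} {a : F →L[ℝ] E} {r : E →L[ℝ] F} (hra : ∀ q, r (a q) = q)
    (hrX : ∀ p, r (X p) = 0) (hdec : ∀ w, ∃ p, w = X p + a (r w)) (hs : ∀ u v, b u v = b v u)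
    (hb : ∀ p v, b (X p) v = 0) (hI : ∀ p, ∃ q, I (X p) = X q) (hJ : ∀ p, ∃ q, J (X p) = X q)
    (hK : ∀ p, ∃ q, K (X p) = X q) :
    IsHyperHermitianTriple (b.bilinearComp a a) (r ∘L I ∘L a) (r ∘L J ∘L a) (r ∘L K ∘L a) := by
  have hc : ∀ {A : E →L[ℝ] E}, (∀ p, ∃ q, A (X p) = X q) → ∀ w, r (A (a (r w))) = r (A w) := by
    intro A hA w
    obtain ⟨p, hp⟩ := hdec w
    obtain ⟨q, hq⟩ := hA p
    conv_rhs => rw [hp, map_add, hq, map_add, hrX, zero_add]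
  have hbr : ∀ v w, b (a (r v)) (a (r w)) = b v w := by
    intro v w
    obtain ⟨p, hp⟩ := hdec v
    obtain ⟨q, hq⟩ := hdec w
    conv_rhs => rw [hp, hq]
    simp only [map_add, add_apply, hb]
    rw [hs _ (X q), hb]
    ring
  refine ⟨fun v => ?_, fun v => ?_, fun v => ?_, fun v => ?_, fun u v => ?_, fun u v => ?_,
    fun u v => ?_⟩
  · change r (I (a (r (I (a v))))) = -v
    rw [hc hI, h.I_sq, map_neg, hra]
  · change r (J (a (r (J (a v))))) = -v
    rw [hc hJ, h.J_sq, map_neg, hra]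
  · change r (K (a (r (K (a v))))) = -v
    rw [hc hK, h.K_sq, map_neg, hra]
  · change r (I (a (r (J (a (r (K (a v)))))))) = -v
    rw [hc hI, h.IJ, hc hK, h.K_sq, map_neg, hra]
  · exact (hbr _ _).trans (h.orthogonal_I _ _)
  · exact (hbr _ _).trans (h.orthogonal_J _ _)
  · exact (hbr _ _).trans (h.orthogonal_K _ _)

/-- A hyper-Hermitian structure is determined by its Kähler forms. -/
theorem IsHyperHermitianTriple.form_eq {V : Type*} [NormedAddCommGroup V] [NormedSpace ℝ V]
    {b b' : V →L[ℝ] V →L[ℝ] ℝ} {I J K I' J' K' : V →L[ℝ] V} (h : IsHyperHermitianTriple b I J K)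
    (h' : IsHyperHermitianTriple b' I' J' K') (hp : ∀ v, v ≠ 0 → 0 < b v v)
    (hI : ∀ u v, b (I u) v = b' (I' u) v) (hJ : ∀ u v, b (J u) v = b' (J' u) v)
    (hK : ∀ u v, b (K u) v = b' (K' u) v) (u v : V) : b u v = b' u v := by
  have h1 : ∀ u, I u = I' u := by
    intro u
    -- Since `J I = -K` and `J' I' = -K'`, the forms of `J` and `K` determine `I`; the scalar
    -- product is then read off from `b (I (I u)) v = -b u v`.
    have h2 : J (I u) = J (I' u) := by
      refine eq_of_forall_form_eq hp fun w => ?_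
      rw [h.JI, hJ, h'.JI, map_neg, map_neg, neg_apply, neg_apply, hK]
    have h3 := congrArg J h2
    rw [h.J_sq, h.J_sq] at h3
    exact neg_injective h3
  have h2 : b (I (I u)) v = b' (I' (I' u)) v := by
    rw [hI, h1]
  rw [h.I_sq, h'.I_sq, map_neg, map_neg, neg_apply, neg_apply] at h2
  exact neg_injective h2

variable {E F P : Type*} [NormedAddCommGroup E] [NormedSpace ℝ E]
  [NormedAddCommGroup F] [NormedSpace ℝ F] [NormedAddCommGroup P] [NormedSpace ℝ P]

theorem extDerivOne_pullback {Φ : F → E} {θ : E → E →L[ℝ] ℝ} {z : F}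
    (hΦ : ContDiffAt ℝ ∞ Φ z) (hθ : DifferentiableAt ℝ θ (Φ z)) (u v : F) :
    extDerivOne (fun z => θ (Φ z) ∘L fderiv ℝ Φ z) z u v
      = extDerivOne θ (Φ z) (fderiv ℝ Φ z u) (fderiv ℝ Φ z v) := by
  have h1 := (hθ.hasFDerivAt.comp z (hΦ.differentiableAt (by simp)).hasFDerivAt).clm_comp
    (ContDiffAt.hasFDerivAt_fderiv hΦ)
  have h2 : fderiv ℝ (fun z => θ (Φ z) ∘L fderiv ℝ Φ z) z = _ := h1.fderiv
  rw [extDerivOne, h2]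
  simp [extDerivOne, fderiv_fderiv_symm hΦ v u]

theorem extDerivOne_congr {θ θ' : E → E →L[ℝ] ℝ} {x : E} (h : θ =ᶠ[nhds x] θ') (u v : E) :
    extDerivOne θ x u v = extDerivOne θ' x u v := by
  rw [extDerivOne, extDerivOne, h.fderiv_eq]

/-- `Φ : B × V → U` maps the coordinate vector fields of `B` to the vector fields `X`. -/
structure IsStraightening (U : Set E) (X : E → P →L[ℝ] E) (B : Set P) (V : Set F)
    (Φ : OpenPartialHomeomorph (P × F) E) : Prop where
  isOpen_B : IsOpen B
  convex_B : Convex ℝ B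
  isOpen_V : IsOpen V
  source_eq : Φ.source = B ×ˢ V
  target_subset : Φ.target ⊆ U
  contDiffOn : ContDiffOn ℝ ∞ Φ Φ.source
  contDiffOn_symm : ContDiffOn ℝ ∞ Φ.symm Φ.target
  fderiv_eq : ∀ z ∈ Φ.source, ∀ p, fderiv ℝ Φ z (p, 0) = X (Φ z) p

/-- The derivative of the slice `Φ (s, ·)`. -/
def sliceDeriv (Φ : P × F → E) (z : P × F) : F →L[ℝ] E :=
  fderiv ℝ Φ z ∘L .inr ℝ P F

/-- The pullback of a `1`-form to the slice `Φ (s, ·)`. -/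
def sliceForm (Φ : P × F → E) (θ : E → E →L[ℝ] ℝ) (s : P) (y : F) : F →L[ℝ] ℝ :=
  θ (Φ (s, y)) ∘L sliceDeriv Φ (s, y)

/-- The projection to `F` of the tangent vectors at `Φ z`. -/
def sliceProj (Φ : OpenPartialHomeomorph (P × F) E) (z : P × F) : E →L[ℝ] F :=
  .snd ℝ P F ∘L fderiv ℝ Φ.symm (Φ z)

namespace IsStraightening

variable {U : Set E} {X : E → P →L[ℝ] E} {B : Set P} {V : Set F}
  {Φ : OpenPartialHomeomorph (P × F) E} {z : P × F} {θ : E → E →L[ℝ] ℝ}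

theorem contDiffAt (h : IsStraightening U X B V Φ) (hz : z ∈ Φ.source) : ContDiffAt ℝ ∞ Φ z :=
  h.contDiffOn.contDiffAt (Φ.open_source.mem_nhds hz)

theorem contDiffAt_symm (h : IsStraightening U X B V Φ) (hz : z ∈ Φ.source) :
    ContDiffAt ℝ ∞ Φ.symm (Φ z) :=
  h.contDiffOn_symm.contDiffAt (Φ.open_target.mem_nhds (Φ.map_source hz))

theorem mem_source (h : IsStraightening U X B V Φ) {s : P} {y : F} (hs : s ∈ B) (hy : y ∈ V) :
    (s, y) ∈ Φ.source := by
  rw [h.source_eq]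
  exact ⟨hs, hy⟩

theorem mem_U (h : IsStraightening U X B V Φ) (hz : z ∈ Φ.source) : Φ z ∈ U :=
  h.target_subset (Φ.map_source hz)

theorem fderiv_symm_fderiv (h : IsStraightening U X B V Φ) (hz : z ∈ Φ.source) (v : P × F) :
    fderiv ℝ Φ.symm (Φ z) (fderiv ℝ Φ z v) = v := by
  have h1 : HasFDerivAt (fun z => Φ.symm (Φ z)) _ z :=
    ((h.contDiffAt_symm hz).differentiableAt (by simp)).hasFDerivAt.comp z
      ((h.contDiffAt hz).differentiableAt (by simp)).hasFDerivAt
  have h2 : (fun z => Φ.symm (Φ z)) =ᶠ[nhds z] id := by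
    filter_upwards [Φ.open_source.mem_nhds hz] with y hy using Φ.left_inv hy
  exact congrArg (fun f : (P × F) →L[ℝ] (P × F) => f v)
    (h1.unique ((hasFDerivAt_id z).congr_of_eventuallyEq h2))

theorem fderiv_fderiv_symm (h : IsStraightening U X B V Φ) (hz : z ∈ Φ.source) (v : E) :
    fderiv ℝ Φ z (fderiv ℝ Φ.symm (Φ z) v) = v := by
  have h0 : HasFDerivAt Φ (fderiv ℝ Φ z) (Φ.symm (Φ z)) := by
    rw [Φ.left_inv hz]
    exact ((h.contDiffAt hz).differentiableAt (by simp)).hasFDerivAt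
  have h1 : HasFDerivAt (fun x => Φ (Φ.symm x)) _ (Φ z) :=
    h0.comp (Φ z) ((h.contDiffAt_symm hz).differentiableAt (by simp)).hasFDerivAt
  have h2 : (fun x => Φ (Φ.symm x)) =ᶠ[nhds (Φ z)] id := by
    filter_upwards [Φ.open_target.mem_nhds (Φ.map_source hz)] with y hy using Φ.right_inv hy
  exact congrArg (fun f : E →L[ℝ] E => f v)
    (h1.unique ((hasFDerivAt_id (Φ z)).congr_of_eventuallyEq h2))

theorem fderiv_apply (h : IsStraightening U X B V Φ) (hz : z ∈ Φ.source) (p : P) (q : F) :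
    fderiv ℝ Φ z (p, q) = X (Φ z) p + sliceDeriv Φ z q := by
  rw [← h.fderiv_eq z hz, sliceDeriv, ContinuousLinearMap.comp_apply,
    ContinuousLinearMap.inr_apply, ← map_add]
  simp

theorem sliceProj_sliceDeriv (h : IsStraightening U X B V Φ) (hz : z ∈ Φ.source) (q : F) :
    sliceProj Φ z (sliceDeriv Φ z q) = q := by
  change (fderiv ℝ Φ.symm (Φ z) (fderiv ℝ Φ z (0, q))).2 = q
  rw [h.fderiv_symm_fderiv hz]

theorem sliceProj_field (h : IsStraightening U X B V Φ) (hz : z ∈ Φ.source) (p : P) :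
    sliceProj Φ z (X (Φ z) p) = 0 := by
  rw [← h.fderiv_eq z hz]
  change (fderiv ℝ Φ.symm (Φ z) (fderiv ℝ Φ z (p, 0))).2 = 0
  rw [h.fderiv_symm_fderiv hz]

theorem exists_eq_add (h : IsStraightening U X B V Φ) (hz : z ∈ Φ.source) (w : E) :
    ∃ p, w = X (Φ z) p + sliceDeriv Φ z (sliceProj Φ z w) := by
  refine ⟨(fderiv ℝ Φ.symm (Φ z) w).1, ?_⟩
  rw [← h.fderiv_apply hz]
  exact (h.fderiv_fderiv_symm hz w).symm

theorem contDiffOn_slice (h : IsStraightening U X B V Φ) {s : P} (hs : s ∈ B) :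
    ContDiffOn ℝ ∞ (fun y => Φ (s, y)) V :=
  h.contDiffOn.comp (contDiff_prodMk_right s).contDiffOn fun _ hy => h.mem_source hs hy

theorem contDiffOn_sliceDeriv (h : IsStraightening U X B V Φ) {s : P} (hs : s ∈ B) :
    ContDiffOn ℝ ∞ (fun y => sliceDeriv Φ (s, y)) V := by
  have h1 : ContDiffOn ℝ ∞ (fderiv ℝ Φ) Φ.source :=
    h.contDiffOn.fderiv_of_isOpen Φ.open_source (by simp)
  have h2 : ContDiffOn ℝ ∞ (fun y => fderiv ℝ Φ (s, y)) V :=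
    h1.comp (contDiff_prodMk_right s).contDiffOn fun _ hy => h.mem_source hs hy
  exact h2.clm_comp contDiffOn_const

theorem contDiffOn_sliceProj (h : IsStraightening U X B V Φ) {s : P} (hs : s ∈ B) :
    ContDiffOn ℝ ∞ (fun y => sliceProj Φ (s, y)) V := by
  have h1 : ContDiffOn ℝ ∞ (fderiv ℝ Φ.symm) Φ.target :=
    h.contDiffOn_symm.fderiv_of_isOpen Φ.open_target (by simp)
  have h2 : ContDiffOn ℝ ∞ (fun y => fderiv ℝ Φ.symm (Φ (s, y))) V :=
    h1.comp (h.contDiffOn_slice hs) fun _ hy => Φ.map_source (h.mem_source hs hy)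
  exact contDiffOn_const.clm_comp h2

theorem contDiffOn_sliceForm (h : IsStraightening U X B V Φ) (hθ : ContDiffOn ℝ ∞ θ U) {s : P}
    (hs : s ∈ B) : ContDiffOn ℝ ∞ (sliceForm Φ θ s) V :=
  (hθ.comp (h.contDiffOn_slice hs) fun _ hy => h.mem_U (h.mem_source hs hy)).clm_comp
    (h.contDiffOn_sliceDeriv hs)

theorem hasFDerivAt_pullback (h : IsStraightening U X B V Φ) (hU : IsOpen U)
    (hθ : ContDiffOn ℝ ∞ θ U) (hz : z ∈ Φ.source) :
    HasFDerivAt (fun z => θ (Φ z) ∘L fderiv ℝ Φ z)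
      (fderiv ℝ (fun z => θ (Φ z) ∘L fderiv ℝ Φ z) z) z := by
  have h1 := ((hθ.contDiffAt (hU.mem_nhds (h.mem_U hz))).differentiableAt (by simp)).comp z
    ((h.contDiffAt hz).differentiableAt (by simp))
  have h2 := (ContDiffAt.hasFDerivAt_fderiv (h.contDiffAt hz)).differentiableAt
  exact (h1.clm_comp h2).hasFDerivAt

theorem extDerivOne_sliceForm (h : IsStraightening U X B V Φ) (hU : IsOpen U)
    (hθ : ContDiffOn ℝ ∞ θ U) {s : P} {y : F} (hs : s ∈ B) (hy : y ∈ V) (q q' : F) :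
    extDerivOne (sliceForm Φ θ s) y q q'
      = extDerivOne θ (Φ (s, y)) (sliceDeriv Φ (s, y) q) (sliceDeriv Φ (s, y) q') := by
  have hz := h.mem_source hs hy
  have h1 := extDerivOne_pullback (h.contDiffAt hz)
    ((hθ.contDiffAt (hU.mem_nhds (h.mem_U hz))).differentiableAt (by simp)) (0, q) (0, q')
  have h2 : HasFDerivAt (sliceForm Φ θ s) _ y :=
    ((h.hasFDerivAt_pullback hU hθ hz).comp y (hasFDerivAt_prodMk_right s y)).clm_comp
      (hasFDerivAt_const (ContinuousLinearMap.inr ℝ P F) y)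
  rw [extDerivOne, h2.fderiv]
  simp only [sliceDeriv, ContinuousLinearMap.comp_apply, ContinuousLinearMap.inr_apply]
  rw [← h1, extDerivOne]
  simp

/-- A `1`-form which is constant on the fields `X`, with `X` in the kernel of its exterior
derivative, has the same pullback to all slices. -/
theorem sliceForm_eq (h : IsStraightening U X B V Φ) (hU : IsOpen U)
    (hθ : ContDiffOn ℝ ∞ θ U) {l : P → ℝ} (hl : ∀ x ∈ U, ∀ p, θ x (X x p) = l p)
    (hk : ∀ x ∈ U, ∀ p v, extDerivOne θ x (X x p) v = 0) {s s' : P} {y : F} (hs : s ∈ B)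
    (hs' : s' ∈ B) (hy : y ∈ V) : sliceForm Φ θ s y = sliceForm Φ θ s' y := by
  ext q
  have key : ∀ s ∈ B, HasFDerivAt (fun s => sliceForm Φ θ s y q) (0 : P →L[ℝ] ℝ) s := by
    intro s hs
    have hz := h.mem_source hs hy
    have hD := h.hasFDerivAt_pullback hU hθ hz
    have h0 : HasFDerivAt (fun s => θ (Φ (s, y)) ∘L fderiv ℝ Φ (s, y)) _ s :=
      HasFDerivAt.comp s (g := fun z => θ (Φ z) ∘L fderiv ℝ Φ z) hD (hasFDerivAt_prodMk_left s y)
    have h1 := h0.clm_apply (hasFDerivAt_const ((0 : P), q) s)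
    refine HasFDerivAt.congr_fderiv (f := fun s => sliceForm Φ θ s y q) h1
      (ContinuousLinearMap.ext fun p => ?_)
    -- The `p`-derivative of the pullback on `q` differs from the `q`-derivative of the pullback on
    -- `p` by `dθ(X p, ·)`. The latter vanishes by `hk`, and the `q`-derivative because the pullback
    -- on `p` is the constant `l p`.
    have h2 := hD.clm_apply (hasFDerivAt_const (p, (0 : F)) (s, y))
    have h3 : (fun z => (θ (Φ z) ∘L fderiv ℝ Φ z) (p, (0 : F))) =ᶠ[nhds (s, y)] fun _ => l p := by
      filter_upwards [Φ.open_source.mem_nhds hz] with w hw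
      rw [ContinuousLinearMap.comp_apply, h.fderiv_eq w hw, hl _ (h.mem_U hw)]
    have h4 := congrArg (fun f : (P × F) →L[ℝ] ℝ => f (0, q))
      (h2.unique ((hasFDerivAt_const (l p) _).congr_of_eventuallyEq h3))
    have h5 := extDerivOne_pullback (h.contDiffAt hz)
      ((hθ.contDiffAt (hU.mem_nhds (h.mem_U hz))).differentiableAt (by simp)) (p, 0) (0, q)
    rw [h.fderiv_eq _ hz, hk _ (h.mem_U hz), extDerivOne] at h5
    simp at h4
    simp
    linarith
  exact h.convex_B.is_const_of_fderivWithin_eq_zero (𝕜 := ℝ)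
    (f := fun s => sliceForm Φ θ s y q)
    (fun s hs => (key s hs).differentiableAt.differentiableWithinAt)
    (fun s hs => by rw [fderivWithin_eq_fderiv (h.isOpen_B.uniqueDiffWithinAt hs)
      (key s hs).differentiableAt, (key s hs).fderiv]) hs hs'

end IsStraightening

end Descent


/-! ### The local model -/

section LocalModel

theorem contDiffOn_bilinearComp {E F : Type*} [NormedAddCommGroup E] [NormedSpace ℝ E]
    [NormedAddCommGroup F] [NormedSpace ℝ F] {V : Set F} {b : F → E →L[ℝ] E →L[ℝ] ℝ}
    {a : F → F →L[ℝ] E} (hb : ContDiffOn ℝ ∞ b V) (ha : ContDiffOn ℝ ∞ a V) :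
    ContDiffOn ℝ ∞ (fun y => (b y).bilinearComp (a y) (a y)) V := by
  have h1 : ContDiffOn ℝ ∞ (fun y => (b y ∘L a y).flip) V :=
    (ContinuousLinearMap.flipₗᵢ ℝ F E ℝ).contDiff.comp_contDiffOn (hb.clm_comp ha)
  exact (ContinuousLinearMap.flipₗᵢ ℝ F F ℝ).contDiff.comp_contDiffOn (h1.clm_comp ha)

/-- The pullback of a field of bilinear forms to the slice `Φ (s, ·)`. -/
def sliceMetric {E F P : Type*} [NormedAddCommGroup E] [NormedSpace ℝ E] [NormedAddCommGroup F]
    [NormedSpace ℝ F] [NormedAddCommGroup P] [NormedSpace ℝ P] (Φ : P × F → E)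
    (b : E → E →L[ℝ] E →L[ℝ] ℝ) (s : P) (y : F) : F →L[ℝ] F →L[ℝ] ℝ :=
  (b (Φ (s, y))).bilinearComp (sliceDeriv Φ (s, y)) (sliceDeriv Φ (s, y))

/-- The projection of a field of endomorphisms to the slice `Φ (s, ·)`. -/
def sliceEnd {E F P : Type*} [NormedAddCommGroup E] [NormedSpace ℝ E] [NormedAddCommGroup F]
    [NormedSpace ℝ F] [NormedAddCommGroup P] [NormedSpace ℝ P]
    (Φ : OpenPartialHomeomorph (P × F) E) (A : E → E →L[ℝ] E) (s : P) (y : F) : F →L[ℝ] F :=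
  sliceProj Φ (s, y) ∘L A (Φ (s, y)) ∘L sliceDeriv Φ (s, y)

variable {E F : Type*} [NormedAddCommGroup E] [NormedSpace ℝ E] [NormedAddCommGroup F]
  [NormedSpace ℝ F] {U : Set E} {g : E → E →L[ℝ] E →L[ℝ] ℝ} {I J K : E → E →L[ℝ] E}
  {ψ : E → E →L[ℝ] ℝ} {ν : ℝ} {t : E → ℝ} {B : Set (EuclideanSpace ℝ (Fin 4))} {V : Set F}
  {Φ : OpenPartialHomeomorph (EuclideanSpace ℝ (Fin 4) × F) E}
  {s s' : EuclideanSpace ℝ (Fin 4)} {y : F}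

theorem IsStraightening.contDiffOn_sliceEnd {P : Type*} [NormedAddCommGroup P] [NormedSpace ℝ P]
    {X : E → P →L[ℝ] E} {B : Set P} {Φ : OpenPartialHomeomorph (P × F) E} {s : P}
    (hΦ : IsStraightening U X B V Φ) {A : E → E →L[ℝ] E}
    (hA : ContDiffOn ℝ ∞ A U) (hs : s ∈ B) : ContDiffOn ℝ ∞ (sliceEnd Φ A s) V :=
  (hΦ.contDiffOn_sliceProj hs).clm_comp
    ((hA.comp (hΦ.contDiffOn_slice hs) fun _ hy => hΦ.mem_U (hΦ.mem_source hs hy)).clm_comp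
      (hΦ.contDiffOn_sliceDeriv hs))

namespace IsExactHHqKOn

theorem contDiffOn_transverseForm (h : IsExactHHqKOn U g I J K ψ ν t) :
    ContDiffOn ℝ ∞ (transverseForm g I J K ψ ν t) U := by
  have h1 : ∀ {θ : E → E →L[ℝ] ℝ}, ContDiffOn ℝ ∞ θ U →
      ContDiffOn ℝ ∞ (fun x => (θ x).smulRight (θ x)) U := fun hθ => hθ.smulRight hθ
  have hψ := h.contDiffOn_ψ
  exact h.contDiffOn_t.smul (h.metric.contDiffOn.add (ContDiffOn.const_smul (1 / ν)
    ((((h1 hψ).add (h1 (hψ.clm_comp h.contDiffOn_I))).add (h1 (hψ.clm_comp h.contDiffOn_J))).add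
      (h1 (hψ.clm_comp h.contDiffOn_K)))))

theorem transverseForm_sliceDeriv_sliceProj [FiniteDimensional ℝ E]
    (h : IsExactHHqKOn U g I J K ψ ν t)
    (hΦ : IsStraightening U (leeFields g I J K ψ ν t) B V Φ) (hs : s ∈ B) (hy : y ∈ V) (u v : E) :
    transverseForm g I J K ψ ν t (Φ (s, y)) (sliceDeriv Φ (s, y) (sliceProj Φ (s, y) u)) v
      = transverseForm g I J K ψ ν t (Φ (s, y)) u v := by
  have hz := hΦ.mem_source hs hy
  obtain ⟨p, hp⟩ := hΦ.exists_eq_add hz u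
  conv_rhs => rw [hp]
  rw [map_add, add_apply, h.transverseForm_leeFields (hΦ.mem_U hz), zero_add]

theorem sliceMetric_triple [FiniteDimensional ℝ E]
    (h : IsExactHHqKOn U g I J K ψ ν t)
    (hΦ : IsStraightening U (leeFields g I J K ψ ν t) B V Φ) (hs : s ∈ B) (hy : y ∈ V) :
    IsHyperHermitianTriple (sliceMetric Φ (transverseForm g I J K ψ ν t) s y) (sliceEnd Φ I s y)
      (sliceEnd Φ J s y) (sliceEnd Φ K s y) := by
  have hz := hΦ.mem_source hs hy
  have hx := hΦ.mem_U hz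
  exact (h.transverseForm_triple hx).descend (hΦ.sliceProj_sliceDeriv hz) (hΦ.sliceProj_field hz)
    (hΦ.exists_eq_add hz) (h.transverseForm_symm hx) (h.transverseForm_leeFields hx)
    (h.exists_leeFields_eq_I hx) (h.exists_leeFields_eq_J hx) (h.exists_leeFields_eq_K hx)

theorem sliceMetric_pos [FiniteDimensional ℝ E]
    (h : IsExactHHqKOn U g I J K ψ ν t)
    (hΦ : IsStraightening U (leeFields g I J K ψ ν t) B V Φ) (hs : s ∈ B) (hy : y ∈ V) (q : F)
    (hq : q ≠ 0) : 0 < sliceMetric Φ (transverseForm g I J K ψ ν t) s y q q := by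
  have hz := hΦ.mem_source hs hy
  refine h.transverseForm_pos (hΦ.mem_U hz) _ fun p hp => hq ?_
  have h1 := hΦ.sliceProj_sliceDeriv hz q
  rw [← h1, ← hΦ.sliceProj_field hz p]
  exact congrArg _ hp

theorem isAlmostHyperHermitianOn_slice [FiniteDimensional ℝ E]
    (h : IsExactHHqKOn U g I J K ψ ν t)
    (hΦ : IsStraightening U (leeFields g I J K ψ ν t) B V Φ) (hs : s ∈ B) :
    IsAlmostHyperHermitianOn V (sliceMetric Φ (transverseForm g I J K ψ ν t) s) (sliceEnd Φ I s)
      (sliceEnd Φ J s) (sliceEnd Φ K s) where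
  metric :=
    { contDiffOn := contDiffOn_bilinearComp (h.contDiffOn_transverseForm.comp
        (hΦ.contDiffOn_slice hs) fun _ hy => hΦ.mem_U (hΦ.mem_source hs hy))
        (hΦ.contDiffOn_sliceDeriv hs)
      symm := fun _ hy _ _ => h.transverseForm_symm (hΦ.mem_U (hΦ.mem_source hs hy)) _ _
      pos := fun _ hy => h.sliceMetric_pos hΦ hs hy }
  contDiffOn_I := hΦ.contDiffOn_sliceEnd h.contDiffOn_I hs
  contDiffOn_J := hΦ.contDiffOn_sliceEnd h.contDiffOn_J hs
  contDiffOn_K := hΦ.contDiffOn_sliceEnd h.contDiffOn_K hs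
  triple := fun _ hy => h.sliceMetric_triple hΦ hs hy

theorem extDerivOne_slice [FiniteDimensional ℝ E]
    (h : IsExactHHqKOn U g I J K ψ ν t) (hU : IsOpen U)
    (hΦ : IsStraightening U (leeFields g I J K ψ ν t) B V Φ) (hs : s ∈ B) {A : E → E →L[ℝ] E}
    (hA : ContDiffOn ℝ ∞ A U) (hd : ∀ x ∈ U, ∀ u v, extDerivOne (scaledForm t ψ A) x u v
      = -ν * transverseForm g I J K ψ ν t x (A x u) v) (hy : y ∈ V) (q q' : F) :
    extDerivOne (sliceForm Φ (scaledForm t ψ A) s) y q q'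
      = -ν * sliceMetric Φ (transverseForm g I J K ψ ν t) s y (sliceEnd Φ A s y q) q' := by
  rw [hΦ.extDerivOne_sliceForm hU (h.contDiffOn_scaledForm hA) hs hy,
    hd _ (hΦ.mem_U (hΦ.mem_source hs hy))]
  congr 1
  exact (h.transverseForm_sliceDeriv_sliceProj hΦ hs hy _ _).symm

/-- The factor `-(1 / ν)` compensates `-ν` in the derivative of the scaled form. The descended
Kähler forms are thus exact, which is what Hitchin's lemma needs, and the same primitives appear in
the model. -/
theorem isKahlerPrimitiveOn_slice [FiniteDimensional ℝ E]
    (h : IsExactHHqKOn U g I J K ψ ν t) (hU : IsOpen U)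
    (hΦ : IsStraightening U (leeFields g I J K ψ ν t) B V Φ) (hs : s ∈ B) {A : E → E →L[ℝ] E}
    (hA : ContDiffOn ℝ ∞ A U) (hd : ∀ x ∈ U, ∀ u v, extDerivOne (scaledForm t ψ A) x u v
      = -ν * transverseForm g I J K ψ ν t x (A x u) v) :
    IsKahlerPrimitiveOn V (sliceMetric Φ (transverseForm g I J K ψ ν t) s) (sliceEnd Φ A s)
      (fun y => (-(1 / ν)) • sliceForm Φ (scaledForm t ψ A) s y) where
  contDiffOn := (hΦ.contDiffOn_sliceForm (h.contDiffOn_scaledForm hA) hs).const_smul _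
  extDeriv_eq := by
    intro y hy u v
    have h1 := ((hΦ.contDiffOn_sliceForm (h.contDiffOn_scaledForm hA) hs).contDiffAt
      (hΦ.isOpen_V.mem_nhds hy)).differentiableAt (by simp)
    have h2 := h.extDerivOne_slice hU hΦ hs hA hd hy u v
    have h3 := h.neg.ne
    rw [extDerivOne] at h2 ⊢
    rw [fderiv_fun_const_smul h1]
    simp only [smul_apply, smul_eq_mul]
    rw [← mul_sub, h2]
    field_simp

theorem extDerivOne_scaledForm_J_eq (h : IsExactHHqKOn U g I J K ψ ν t) (hU : IsOpen U) :
    ∀ x ∈ U, ∀ u v, extDerivOne (scaledForm t ψ J) x u v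
      = -ν * transverseForm g I J K ψ ν t x (J x u) v := by
  intro x hx u v
  rw [h.rotate.extDerivOne_scaledForm_eq_transverseForm hU hx, transverseForm_rotate]

theorem extDerivOne_scaledForm_K_eq (h : IsExactHHqKOn U g I J K ψ ν t) (hU : IsOpen U) :
    ∀ x ∈ U, ∀ u v, extDerivOne (scaledForm t ψ K) x u v
      = -ν * transverseForm g I J K ψ ν t x (K x u) v :=
  fun x hx u v => by
    rw [h.rotate.rotate.extDerivOne_scaledForm_eq_transverseForm hU hx, transverseForm_rotate,
      transverseForm_rotate]

/-- The pullbacks of the scaled forms and of the transverse metric do not depend on the slice. -/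
theorem sliceForm_scaledForm_eq [FiniteDimensional ℝ E]
    (h : IsExactHHqKOn U g I J K ψ ν t) (hU : IsOpen U)
    (hΦ : IsStraightening U (leeFields g I J K ψ ν t) B V Φ) (hs : s ∈ B) (hs' : s' ∈ B)
    (hy : y ∈ V) :
    sliceForm Φ (scaledForm t ψ I) s y = sliceForm Φ (scaledForm t ψ I) s' y ∧
    sliceForm Φ (scaledForm t ψ J) s y = sliceForm Φ (scaledForm t ψ J) s' y ∧
    sliceForm Φ (scaledForm t ψ K) s y = sliceForm Φ (scaledForm t ψ K) s' y := by
  refine ⟨hΦ.sliceForm_eq hU (h.contDiffOn_scaledForm h.contDiffOn_I)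
      (l := fun p => p 1) (fun x hx p => (h.scaledForm_leeFields hx p).2.1)
      (fun x hx p v => ?_) hs hs' hy,
    hΦ.sliceForm_eq hU (h.contDiffOn_scaledForm h.contDiffOn_J)
      (l := fun p => p 2) (fun x hx p => (h.scaledForm_leeFields hx p).2.2.1)
      (fun x hx p v => ?_) hs hs' hy,
    hΦ.sliceForm_eq hU (h.contDiffOn_scaledForm h.contDiffOn_K)
      (l := fun p => p 3) (fun x hx p => (h.scaledForm_leeFields hx p).2.2.2)
      (fun x hx p v => ?_) hs hs' hy⟩
  · exact h.extDerivOne_scaledForm_leeFields hU hx p v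
  · obtain ⟨r, hr⟩ := h.exists_leeFields_eq_J hx p
    rw [h.extDerivOne_scaledForm_J_eq hU x hx, hr, h.transverseForm_leeFields hx, mul_zero]
  · obtain ⟨r, hr⟩ := h.exists_leeFields_eq_K hx p
    rw [h.extDerivOne_scaledForm_K_eq hU x hx, hr, h.transverseForm_leeFields hx, mul_zero]

/-- The pulled back 1-forms do not depend on the slice, so neither do their exterior derivatives,
the Kähler forms; and these determine the metric by `form_eq`. No independence of `I`, `J`, `K` from
the slice has to be known beforehand. -/
theorem sliceMetric_eq [FiniteDimensional ℝ E]
    (h : IsExactHHqKOn U g I J K ψ ν t) (hU : IsOpen U)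
    (hΦ : IsStraightening U (leeFields g I J K ψ ν t) B V Φ) (hs : s ∈ B) (hs' : s' ∈ B)
    (hy : y ∈ V) (q q' : F) :
    sliceMetric Φ (transverseForm g I J K ψ ν t) s y q q'
      = sliceMetric Φ (transverseForm g I J K ψ ν t) s' y q q' := by
  have key : ∀ {A : E → E →L[ℝ] E}, ContDiffOn ℝ ∞ A U →
      (∀ x ∈ U, ∀ u v, extDerivOne (scaledForm t ψ A) x u v
        = -ν * transverseForm g I J K ψ ν t x (A x u) v) →
      (∀ y ∈ V, sliceForm Φ (scaledForm t ψ A) s y = sliceForm Φ (scaledForm t ψ A) s' y) →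
      ∀ u v, sliceMetric Φ (transverseForm g I J K ψ ν t) s y (sliceEnd Φ A s y u) v
        = sliceMetric Φ (transverseForm g I J K ψ ν t) s' y (sliceEnd Φ A s' y u) v := by
    intro A hA hd he u v
    have h1 := h.extDerivOne_slice hU hΦ hs hA hd hy u v
    have h2 := h.extDerivOne_slice hU hΦ hs' hA hd hy u v
    have h3 : sliceForm Φ (scaledForm t ψ A) s =ᶠ[nhds y] sliceForm Φ (scaledForm t ψ A) s' := by
      filter_upwards [hΦ.isOpen_V.mem_nhds hy] with w hw using he w hw
    rw [extDerivOne_congr h3, h2] at h1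
    exact (mul_left_cancel₀ (neg_ne_zero.2 h.neg.ne) h1).symm
  exact (h.sliceMetric_triple hΦ hs hy).form_eq (h.sliceMetric_triple hΦ hs' hy)
    (h.sliceMetric_pos hΦ hs hy)
    (key h.contDiffOn_I (fun x hx => h.extDerivOne_scaledForm_eq_transverseForm hU hx)
      fun y hy => (h.sliceForm_scaledForm_eq hU hΦ hs hs' hy).1)
    (key h.contDiffOn_J (h.extDerivOne_scaledForm_J_eq hU)
      fun y hy => (h.sliceForm_scaledForm_eq hU hΦ hs hs' hy).2.1)
    (key h.contDiffOn_K (h.extDerivOne_scaledForm_K_eq hU)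
      fun y hy => (h.sliceForm_scaledForm_eq hU hΦ hs hs' hy).2.2) q q'

/-- The definition of the transverse form is solved for `g`, after every form has been written in
the coordinates given by `Φ`. The reference slice `s` is fixed, while `z` may lie on any other one.
-/
theorem form_fderiv_eq_modelMetric [FiniteDimensional ℝ E]
    (h : IsExactHHqKOn U g I J K ψ ν t) (hU : IsOpen U)
    (hΦ : IsStraightening U (leeFields g I J K ψ ν t) B V Φ)
    (ht : ∀ z ∈ Φ.source, t (Φ z) = z.1 0) (hs : s ∈ B)
    {z : EuclideanSpace ℝ (Fin 4) × F} (hz : z ∈ Φ.source) (a b : EuclideanSpace ℝ (Fin 4) × F) :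
    g (Φ z) (fderiv ℝ Φ z a) (fderiv ℝ Φ z b)
      = modelMetric ν (sliceMetric Φ (transverseForm g I J K ψ ν t) s)
        (fun y => (-(1 / ν)) • sliceForm Φ (scaledForm t ψ I) s y)
        (fun y => (-(1 / ν)) • sliceForm Φ (scaledForm t ψ J) s y)
        (fun y => (-(1 / ν)) • sliceForm Φ (scaledForm t ψ K) s y) z a b := by
  have hx := hΦ.mem_U hz
  let pr : EuclideanSpace ℝ (Fin 4) →L[ℝ] ℝ := EuclideanSpace.proj 0
  obtain ⟨p, y⟩ := z
  have hpy : p ∈ B ∧ y ∈ V := by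
    have := hz
    rw [hΦ.source_eq] at this
    exact this
  have htp := ht _ hz
  have ht0 := (h.t_pos _ hx).ne'
  have hν := h.neg.ne
  -- Since `t ∘ Φ` is the first coordinate, `tψ` has no component along the slice; this is why `dt`
  -- appears in the model without a correction term.
  have e0 : ∀ q, ψ (Φ (p, y)) (sliceDeriv Φ (p, y) q) = 0 := by
    intro q
    have h1 := (h.hasFDerivAt_t _ hx).comp (p, y)
      ((hΦ.contDiffAt hz).differentiableAt (by simp)).hasFDerivAt
    have h2 : t ∘ Φ =ᶠ[nhds (p, y)] fun z => pr z.1 := by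
      filter_upwards [Φ.open_source.mem_nhds hz] with w hw using ht w hw
    have h3 := h1.unique
      ((pr.hasFDerivAt.comp (p, y) hasFDerivAt_fst).congr_of_eventuallyEq h2)
    have h4 := congrArg (fun f : (EuclideanSpace ℝ (Fin 4) × F) →L[ℝ] ℝ => f (0, q)) h3
    have h5 : t (Φ (p, y)) * ψ (Φ (p, y)) (sliceDeriv Φ (p, y) q) = 0 := by
      simpa [pr, sliceDeriv] using h4
    exact (mul_eq_zero.1 h5).resolve_left ht0
  obtain ⟨s1, s2, s3⟩ := h.sliceForm_scaledForm_eq hU hΦ hs hpy.1 hpy.2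
  have d : ∀ a : EuclideanSpace ℝ (Fin 4) × F,
      t (Φ (p, y)) * ψ (Φ (p, y)) (fderiv ℝ Φ (p, y) a) = a.1 0 ∧
      t (Φ (p, y)) * ψ (Φ (p, y)) (I (Φ (p, y)) (fderiv ℝ Φ (p, y) a))
        = a.1 1 + sliceForm Φ (scaledForm t ψ I) s y a.2 ∧
      t (Φ (p, y)) * ψ (Φ (p, y)) (J (Φ (p, y)) (fderiv ℝ Φ (p, y) a))
        = a.1 2 + sliceForm Φ (scaledForm t ψ J) s y a.2 ∧
      t (Φ (p, y)) * ψ (Φ (p, y)) (K (Φ (p, y)) (fderiv ℝ Φ (p, y) a))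
        = a.1 3 + sliceForm Φ (scaledForm t ψ K) s y a.2 := by
    intro a
    obtain ⟨l0, l1, l2, l3⟩ := h.scaledForm_leeFields hx a.1
    rw [s1, s2, s3, ← l0, ← l1, ← l2, ← l3, show a = (a.1, a.2) from rfl, hΦ.fderiv_apply hz]
    simp only [map_add, mul_add, e0, add_zero]
    exact ⟨rfl, rfl, rfl, rfl⟩
  have hg : transverseForm g I J K ψ ν t (Φ (p, y)) (fderiv ℝ Φ (p, y) a) (fderiv ℝ Φ (p, y) b)
      = sliceMetric Φ (transverseForm g I J K ψ ν t) s y a.2 b.2 := by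
    rw [h.sliceMetric_eq hU hΦ hs hpy.1 hpy.2, show a = (a.1, a.2) from rfl,
      show b = (b.1, b.2) from rfl, hΦ.fderiv_apply hz, hΦ.fderiv_apply hz]
    simp only [map_add, add_apply, h.transverseForm_leeFields hx, zero_add]
    rw [h.transverseForm_symm hx _ (leeFields g I J K ψ ν t (Φ (p, y)) b.1),
      h.transverseForm_leeFields hx, zero_add]
    rfl
  rw [transverseForm_apply] at hg
  obtain ⟨a0, a1, a2, a3⟩ := d a
  obtain ⟨b0, b1, b2, b3⟩ := d b
  rw [modelMetric]
  simp only [smul_apply, smul_eq_mul]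
  rw [← hg, ← a0, ← b0, ← htp]
  -- The overall sign in the model terms such as `-du + ν α` is irrelevant, since only products of
  -- two of them occur.
  have c : ∀ r q : ℝ, -r + ν * (-(1 / ν) * q) = -(r + q) := by
    intro r q
    field_simp
    ring
  simp only [c, ← a1, ← a2, ← a3, ← b1, ← b2, ← b3]
  field_simp
  ring

end IsExactHHqKOn

theorem IsExactHHqKOn.exists_local_model {E F : Type} [NormedAddCommGroup E] [NormedSpace ℝ E]
    [NormedAddCommGroup F] [NormedSpace ℝ F] [FiniteDimensional ℝ E] [FiniteDimensional ℝ F]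
    [HasContDiffBump E] {U : Set E} {g : E → E →L[ℝ] E →L[ℝ] ℝ} {I J K : E → E →L[ℝ] E}
    {ψ : E → E →L[ℝ] ℝ} {ν : ℝ} {t : E → ℝ} (h : IsExactHHqKOn U g I J K ψ ν t) (hU : IsOpen U)
    (hd : Module.finrank ℝ E = 4 + Module.finrank ℝ F) {x₀ : E} (hx₀ : x₀ ∈ U) :
    ∃ (V : Set F) (g' : F → F →L[ℝ] F →L[ℝ] ℝ) (I' J' K' : F → F →L[ℝ] F) (α β γ : F → F →L[ℝ] ℝ)
      (Φ : OpenPartialHomeomorph (EuclideanSpace ℝ (Fin 4) × F) E),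
      IsOpen V ∧ IsHyperKahlerOn V g' I' J' K' ∧ IsKahlerPrimitiveOn V g' I' α ∧
      IsKahlerPrimitiveOn V g' J' β ∧ IsKahlerPrimitiveOn V g' K' γ ∧ x₀ ∈ Φ.target ∧
      Φ.target ⊆ U ∧ Φ.source ⊆ modelDomain V ∧ ContDiffOn ℝ ∞ Φ Φ.source ∧
      ContDiffOn ℝ ∞ Φ.symm Φ.target ∧ ∀ x ∈ Φ.target, ∀ u v, g x u v
        = modelMetric ν g' α β γ (Φ.symm x) (fderiv ℝ Φ.symm x u) (fderiv ℝ Φ.symm x v) := by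
  let e₀ : EuclideanSpace ℝ (Fin 4) := EuclideanSpace.single 0 1
  let pr : EuclideanSpace ℝ (Fin 4) →L[ℝ] ℝ := EuclideanSpace.proj 0
  obtain ⟨Φ, B, V, s₀, hB, hBc, hs₀, hV, hsrc, hx₀Φ, hΦU, hΦ, hΦs, hΦX, hκ⟩ :=
    exists_straightening (F := F) hU (h.contDiffOn_leeFields hU)
      (fun x hx => h.leeFields_commute hU hx)
      -- With this `κ` and the projection to the first axis, the first coordinate becomes `t` itself
      -- instead of `t` up to a function on the slice. The derivative condition on `κ` is the
      -- duality of `tψ` with the fields.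
      (κ := fun x => t x • e₀) (h.contDiffOn_t.smul contDiffOn_const)
      (ρ := pr.smulRight e₀)
      (fun x hx => by simp [pr, e₀])
      (fun x hx p => by
        have h1 : HasFDerivAt (fun x => t x • e₀) _ x := (h.hasFDerivAt_t x hx).smul_const e₀
        rw [h1.fderiv, ContinuousLinearMap.smulRight_apply, ContinuousLinearMap.smulRight_apply]
        congr 1
        exact (h.scaledForm_leeFields hx p).1)
      hx₀ (h.leeFields_injective hx₀) (by simpa using hd)
  have ht : ∀ z ∈ Φ.source, t (Φ z) = z.1 0 := by
    intro z hz
    have := congrArg (fun p : EuclideanSpace ℝ (Fin 4) => p 0) (hκ z hz)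
    simpa [pr, e₀] using this
  have hst : IsStraightening U (leeFields g I J K ψ ν t) B V Φ :=
    ⟨hB, hBc, hV, hsrc, hΦU, hΦ, hΦs, hΦX⟩
  have hI := h.isKahlerPrimitiveOn_slice hU hst hs₀ h.contDiffOn_I
    fun x hx => h.extDerivOne_scaledForm_eq_transverseForm hU hx
  have hJ := h.isKahlerPrimitiveOn_slice hU hst hs₀ h.contDiffOn_J
    (h.extDerivOne_scaledForm_J_eq hU)
  have hK := h.isKahlerPrimitiveOn_slice hU hst hs₀ h.contDiffOn_K
    (h.extDerivOne_scaledForm_K_eq hU)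
  refine ⟨V, _, _, _, _, _, _, _, Φ, hV,
    (h.isAlmostHyperHermitianOn_slice hst hs₀).isHyperKahlerOn_of_primitives hV hI hJ hK,
    hI, hJ, hK, hx₀Φ, hΦU, fun z hz => ⟨?_, ?_⟩, hΦ, hΦs, fun x hx u v => ?_⟩
  · rw [← ht z hz]
    exact h.t_pos _ (hst.mem_U hz)
  · rw [hsrc] at hz
    exact hz.2
  · have hz := Φ.map_target hx
    have h1 := h.form_fderiv_eq_modelMetric hU hst ht hs₀ hz (fderiv ℝ Φ.symm x u)
      (fderiv ℝ Φ.symm x v)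
    have h2 := hst.fderiv_fderiv_symm hz
    rw [Φ.right_inv hx] at h1 h2
    rwa [h2, h2] at h1

end LocalModel


/-! ### Closed Lee forms -/

section ClosedLeeForm

variable {E : Type*} [NormedAddCommGroup E] [NormedSpace ℝ E] {U W : Set E}
  {g : E → E →L[ℝ] E →L[ℝ] ℝ} {I J K : E → E →L[ℝ] E} {ψ : E → E →L[ℝ] ℝ} {ν : ℝ}

theorem IsHHqKOn.mono (h : IsHHqKOn U g I J K ψ ν) (hW : W ⊆ U) : IsHHqKOn W g I J K ψ ν where
  metric := ⟨h.metric.contDiffOn.mono hW, fun x hx => h.metric.symm x (hW hx),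
    fun x hx => h.metric.pos x (hW hx)⟩
  contDiffOn_I := h.contDiffOn_I.mono hW
  contDiffOn_J := h.contDiffOn_J.mono hW
  contDiffOn_K := h.contDiffOn_K.mono hW
  triple := fun x hx => h.triple x (hW hx)
  contDiffOn_ψ := h.contDiffOn_ψ.mono hW
  curv_I := fun x hx => h.curv_I x (hW hx)
  curv_J := fun x hx => h.curv_J x (hW hx)
  curv_K := fun x hx => h.curv_K x (hW hx)

/-- The Poincaré lemma on a ball gives `ψ = df`, and `t = exp f` satisfies `t > 0` and `dt = t ψ`.
-/
theorem IsHHqKOn.exists_isExactHHqKOn (h : IsHHqKOn U g I J K ψ ν) (hU : IsOpen U) (hν : ν < 0)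
    (hnorm : ∀ x ∈ U, covectorNormSq g x (ψ x) = -ν)
    (hclosed : ∀ x ∈ U, ∀ u v, extDerivOne ψ x u v = 0) {x₀ : E} (hx₀ : x₀ ∈ U) :
    ∃ (W : Set E) (t : E → ℝ), IsOpen W ∧ x₀ ∈ W ∧ W ⊆ U ∧ IsExactHHqKOn W g I J K ψ ν t := by
  obtain ⟨r, hr, hrU⟩ := Metric.isOpen_iff.1 hU x₀ hx₀
  have h' := h.mono hrU
  obtain ⟨f, hf⟩ := (convex_ball x₀ r).exists_forall_hasFDerivAt_of_fderiv_symmetric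
    Metric.isOpen_ball (h'.contDiffOn_ψ.differentiableOn (by simp))
    (fun x hx u v => sub_eq_zero.1 (hclosed x (hrU hx) u v))
  have hfs : ContDiffOn ℝ ∞ f (Metric.ball x₀ r) := by
    refine (contDiffOn_infty_iff_fderiv_of_isOpen Metric.isOpen_ball).2
      ⟨fun x hx => (hf x hx).differentiableAt.differentiableWithinAt,
        h'.contDiffOn_ψ.congr fun x hx => (hf x hx).fderiv⟩
  exact ⟨Metric.ball x₀ r, fun x => Real.exp (f x), Metric.isOpen_ball, Metric.mem_ball_self hr,
    hrU, { h' with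
      neg := hν
      normSq := fun x hx => hnorm x (hrU hx)
      contDiffOn_t := hfs.exp
      t_pos := fun x _ => Real.exp_pos _
      hasFDerivAt_t := fun x hx => (hf x hx).exp }⟩

theorem extDerivOne_neg (ψ : E → E →L[ℝ] ℝ) (x u v : E) :
    extDerivOne (fun x => -ψ x) x u v = -extDerivOne ψ x u v := by
  rw [extDerivOne, extDerivOne, fderiv_fun_neg]
  simp
  ring

theorem covectorNormSq_neg (g : E → E →L[ℝ] E →L[ℝ] ℝ) (x : E) (φ : E →L[ℝ] ℝ) :
    covectorNormSq g x (-φ) = covectorNormSq g x φ := by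
  simp [covectorNormSq]

end ClosedLeeForm


/-! ### Tensor fields in a chart -/

section Chart

variable {d : ℕ} {M : Type*} [TopologicalSpace M] [ChartedSpace (EuclideanSpace ℝ (Fin d)) M]
  [IsManifold 𝓘(ℝ, EuclideanSpace ℝ (Fin d)) ∞ M]
  {e : OpenPartialHomeomorph M (EuclideanSpace ℝ (Fin d))}

/-- The vector fields which are constant in a chart are smooth. -/
theorem contMDiffOn_chart_field (he : e ∈ atlas (EuclideanSpace ℝ (Fin d)) M)
    (u : EuclideanSpace ℝ (Fin d)) :
    ContMDiffOn 𝓘(ℝ, EuclideanSpace ℝ (Fin d))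
      (𝓘(ℝ, EuclideanSpace ℝ (Fin d)).prod 𝓘(ℝ, EuclideanSpace ℝ (Fin d))) ∞
      (fun y => Bundle.TotalSpace.mk' (EuclideanSpace ℝ (Fin d))
        (E := fun p : M => TangentSpace 𝓘(ℝ, EuclideanSpace ℝ (Fin d)) p) (e.symm y)
        (mfderiv 𝓘(ℝ, EuclideanSpace ℝ (Fin d)) 𝓘(ℝ, EuclideanSpace ℝ (Fin d)) e.symm y u))
      e.target := by
  have h1 : ContMDiffOn 𝓘(ℝ, EuclideanSpace ℝ (Fin d)) 𝓘(ℝ, EuclideanSpace ℝ (Fin d)) ∞ e.symm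
      e.target :=
    contMDiffOn_symm_of_mem_maximalAtlas (IsManifold.subset_maximalAtlas he)
  have h2 := h1.contMDiffOn_tangentMapWithin (m := ∞) (by simp) e.open_target.uniqueMDiffOn
  have h3 : ContMDiffOn 𝓘(ℝ, EuclideanSpace ℝ (Fin d))
      (𝓘(ℝ, EuclideanSpace ℝ (Fin d)).prod 𝓘(ℝ, EuclideanSpace ℝ (Fin d))) ∞
      (fun y => (Bundle.TotalSpace.mk' (EuclideanSpace ℝ (Fin d))
        (E := TangentSpace 𝓘(ℝ, EuclideanSpace ℝ (Fin d))) y u)) e.target :=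
    contMDiffOn_vectorSpace_iff_contDiffOn.2 contDiffOn_const
  refine (h2.comp h3 fun y hy => hy).congr fun y hy => ?_
  simp only [Function.comp, tangentMapWithin]
  rw [mfderivWithin_of_isOpen e.open_target hy]

theorem contDiffOn_chartForm (he : e ∈ atlas (EuclideanSpace ℝ (Fin d)) M)
    (g : Bundle.ContMDiffRiemannianMetric 𝓘(ℝ, EuclideanSpace ℝ (Fin d)) ∞
      (EuclideanSpace ℝ (Fin d)) (fun p : M => TangentSpace 𝓘(ℝ, EuclideanSpace ℝ (Fin d)) p)) :
    ContDiffOn ℝ ∞ (chartForm e g.inner) e.target := by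
  refine contDiffOn_clm_apply.2 fun u => contDiffOn_clm_apply.2 fun v => ?_
  have h1 : ContMDiffOn 𝓘(ℝ, EuclideanSpace ℝ (Fin d)) 𝓘(ℝ, EuclideanSpace ℝ (Fin d)) ∞ e.symm
      e.target :=
    contMDiffOn_symm_of_mem_maximalAtlas (IsManifold.subset_maximalAtlas he)
  have h2 : ContMDiffOn 𝓘(ℝ, EuclideanSpace ℝ (Fin d))
      (𝓘(ℝ, EuclideanSpace ℝ (Fin d)).prod 𝓘(ℝ)) ∞
      (fun y => Bundle.TotalSpace.mk' ℝ (E := Bundle.Trivial M ℝ) (e.symm y)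
        (g.inner (e.symm y)
          (mfderiv 𝓘(ℝ, EuclideanSpace ℝ (Fin d)) 𝓘(ℝ, EuclideanSpace ℝ (Fin d)) e.symm y u)
          (mfderiv 𝓘(ℝ, EuclideanSpace ℝ (Fin d)) 𝓘(ℝ, EuclideanSpace ℝ (Fin d)) e.symm y v)))
      e.target := by
    apply ContMDiffOn.clm_bundle_apply₂ (F₁ := EuclideanSpace ℝ (Fin d))
      (F₂ := EuclideanSpace ℝ (Fin d))
    · exact g.contMDiff.comp_contMDiffOn h1
    · exact contMDiffOn_chart_field he u
    · exact contMDiffOn_chart_field he v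
  intro y hy
  have h3 := h2 y hy
  simp only [Bundle.contMDiffWithinAt_totalSpace] at h3
  exact h3.2.contDiffWithinAt

/-- Smoothness is tested on constant vectors `u`: the section `A` is applied to the corresponding
chart field, and the result is carried back to the model space by the tangent map of `e`. -/
theorem contDiffOn_chartEnd (he : e ∈ atlas (EuclideanSpace ℝ (Fin d)) M)
    {A : (p : M) → TangentSpace 𝓘(ℝ, EuclideanSpace ℝ (Fin d)) p →L[ℝ]
      TangentSpace 𝓘(ℝ, EuclideanSpace ℝ (Fin d)) p}
    (hA : ContMDiff 𝓘(ℝ, EuclideanSpace ℝ (Fin d))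
      (𝓘(ℝ, EuclideanSpace ℝ (Fin d)).prod
        𝓘(ℝ, EuclideanSpace ℝ (Fin d) →L[ℝ] EuclideanSpace ℝ (Fin d))) ∞
      (fun p => Bundle.TotalSpace.mk'
        (EuclideanSpace ℝ (Fin d) →L[ℝ] EuclideanSpace ℝ (Fin d))
        (E := fun p : M => TangentSpace 𝓘(ℝ, EuclideanSpace ℝ (Fin d)) p →L[ℝ]
          TangentSpace 𝓘(ℝ, EuclideanSpace ℝ (Fin d)) p) p (A p))) :
    ContDiffOn ℝ ∞ (chartEnd e A) e.target := by
  refine contDiffOn_clm_apply.2 fun u => ?_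
  have h1 : ContMDiffOn 𝓘(ℝ, EuclideanSpace ℝ (Fin d)) 𝓘(ℝ, EuclideanSpace ℝ (Fin d)) ∞ e.symm
      e.target :=
    contMDiffOn_symm_of_mem_maximalAtlas (IsManifold.subset_maximalAtlas he)
  have h2 : ContMDiffOn 𝓘(ℝ, EuclideanSpace ℝ (Fin d))
      (𝓘(ℝ, EuclideanSpace ℝ (Fin d)).prod 𝓘(ℝ, EuclideanSpace ℝ (Fin d))) ∞
      (fun y => Bundle.TotalSpace.mk' (EuclideanSpace ℝ (Fin d))
        (E := fun p : M => TangentSpace 𝓘(ℝ, EuclideanSpace ℝ (Fin d)) p) (e.symm y)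
        (A (e.symm y)
          (mfderiv 𝓘(ℝ, EuclideanSpace ℝ (Fin d)) 𝓘(ℝ, EuclideanSpace ℝ (Fin d)) e.symm y u)))
      e.target := by
    apply ContMDiffOn.clm_bundle_apply (F₁ := EuclideanSpace ℝ (Fin d))
    · exact hA.comp_contMDiffOn h1
    · exact contMDiffOn_chart_field he u
  have h3 : ContMDiffOn 𝓘(ℝ, EuclideanSpace ℝ (Fin d)) 𝓘(ℝ, EuclideanSpace ℝ (Fin d)) ∞ e
      e.source :=
    contMDiffOn_of_mem_maximalAtlas (IsManifold.subset_maximalAtlas he)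
  have h4 := h3.contMDiffOn_tangentMapWithin (m := ∞) (by simp) e.open_source.uniqueMDiffOn
  have h5 := h4.comp h2 fun y hy => e.map_target hy
  have h6 := (contMDiff_snd_tangentBundle_modelSpace (n := ∞) (EuclideanSpace ℝ (Fin d))
    𝓘(ℝ, EuclideanSpace ℝ (Fin d))).comp_contMDiffOn h5
  refine h6.contDiffOn.congr fun y hy => ?_
  simp only [Function.comp, tangentMapWithin]
  rw [mfderivWithin_of_isOpen e.open_source (e.map_target hy)]
  rfl

theorem IsHyperHermitianTriple.conj {E : Type*} [NormedAddCommGroup E] [NormedSpace ℝ E]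
    {b : E →L[ℝ] E →L[ℝ] ℝ} {I J K : E →L[ℝ] E} (h : IsHyperHermitianTriple b I J K)
    {a r : E →L[ℝ] E} (har : ∀ v, a (r v) = v) (hra : ∀ v, r (a v) = v) :
    IsHyperHermitianTriple (b.bilinearComp a a) (r ∘L I ∘L a) (r ∘L J ∘L a) (r ∘L K ∘L a) := by
  constructor <;> intros <;>
    simp [har, hra, h.I_sq, h.J_sq, h.K_sq, h.IJK, h.orthogonal_I, h.orthogonal_J, h.orthogonal_K]

theorem chart_mfderiv_mfderiv_symm (he : e ∈ atlas (EuclideanSpace ℝ (Fin d)) M)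
    {y : EuclideanSpace ℝ (Fin d)} (hy : y ∈ e.target) (v : EuclideanSpace ℝ (Fin d)) :
    mfderiv 𝓘(ℝ, EuclideanSpace ℝ (Fin d)) 𝓘(ℝ, EuclideanSpace ℝ (Fin d)) e (e.symm y)
      (mfderiv 𝓘(ℝ, EuclideanSpace ℝ (Fin d)) 𝓘(ℝ, EuclideanSpace ℝ (Fin d)) e.symm y v) = v :=
  congrArg (fun f => f v) ((mdifferentiable_of_mem_atlas
    (I := 𝓘(ℝ, EuclideanSpace ℝ (Fin d))) he).comp_symm_deriv hy)

theorem chart_mfderiv_symm_mfderiv (he : e ∈ atlas (EuclideanSpace ℝ (Fin d)) M)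
    {p : M} (hp : p ∈ e.source) (v : TangentSpace 𝓘(ℝ, EuclideanSpace ℝ (Fin d)) p) :
    mfderiv 𝓘(ℝ, EuclideanSpace ℝ (Fin d)) 𝓘(ℝ, EuclideanSpace ℝ (Fin d)) e.symm (e p)
      (mfderiv 𝓘(ℝ, EuclideanSpace ℝ (Fin d)) 𝓘(ℝ, EuclideanSpace ℝ (Fin d)) e p v) = v :=
  congrArg (fun f => f v) ((mdifferentiable_of_mem_atlas
    (I := 𝓘(ℝ, EuclideanSpace ℝ (Fin d))) he).symm_comp_deriv hp)

theorem chartForm_pos (he : e ∈ atlas (EuclideanSpace ℝ (Fin d)) M) (S : AlmostHyperHermitian d M)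
    {y : EuclideanSpace ℝ (Fin d)} (hy : y ∈ e.target) {v : EuclideanSpace ℝ (Fin d)}
    (hv : v ≠ 0) : 0 < chartForm e S.g.inner y v v := by
  refine S.g.pos (e.symm y)
    (mfderiv 𝓘(ℝ, EuclideanSpace ℝ (Fin d)) 𝓘(ℝ, EuclideanSpace ℝ (Fin d)) e.symm y v)
    fun h => hv ?_
  rw [← chart_mfderiv_mfderiv_symm he hy v, h]
  exact map_zero _

theorem chartForm_symm (S : AlmostHyperHermitian d M) (y u v : EuclideanSpace ℝ (Fin d)) :
    chartForm e S.g.inner y u v = chartForm e S.g.inner y v u :=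
  S.g.symm (e.symm y)
    (mfderiv 𝓘(ℝ, EuclideanSpace ℝ (Fin d)) 𝓘(ℝ, EuclideanSpace ℝ (Fin d)) e.symm y u)
    (mfderiv 𝓘(ℝ, EuclideanSpace ℝ (Fin d)) 𝓘(ℝ, EuclideanSpace ℝ (Fin d)) e.symm y v)

theorem chart_triple (he : e ∈ atlas (EuclideanSpace ℝ (Fin d)) M) (S : AlmostHyperHermitian d M)
    {y : EuclideanSpace ℝ (Fin d)} (hy : y ∈ e.target) :
    IsHyperHermitianTriple (chartForm e S.g.inner y) (chartEnd e S.I y) (chartEnd e S.J y)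
      (chartEnd e S.K y) := by
  have h2 : ∀ v : EuclideanSpace ℝ (Fin d),
      mfderiv 𝓘(ℝ, EuclideanSpace ℝ (Fin d)) 𝓘(ℝ, EuclideanSpace ℝ (Fin d)) e.symm y
        (mfderiv 𝓘(ℝ, EuclideanSpace ℝ (Fin d)) 𝓘(ℝ, EuclideanSpace ℝ (Fin d)) e (e.symm y) v)
          = v := by
    intro v
    have := chart_mfderiv_symm_mfderiv he (e.map_target hy) v
    rw [e.right_inv hy] at this
    exact this
  have h1 := chart_mfderiv_mfderiv_symm he hy
  have h3 := S.triple (e.symm y)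
  exact IsHyperHermitianTriple.conj (E := EuclideanSpace ℝ (Fin d)) (b := S.g.inner (e.symm y))
    (I := S.I (e.symm y)) (J := S.J (e.symm y)) (K := S.K (e.symm y))
    (a := mfderiv 𝓘(ℝ, EuclideanSpace ℝ (Fin d)) 𝓘(ℝ, EuclideanSpace ℝ (Fin d)) e.symm y)
    (r := mfderiv 𝓘(ℝ, EuclideanSpace ℝ (Fin d)) 𝓘(ℝ, EuclideanSpace ℝ (Fin d)) e (e.symm y))
    h3 h2 h1

theorem AlmostHyperHermitian.isAlmostHyperHermitianOn (S : AlmostHyperHermitian d M)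
    (he : e ∈ atlas (EuclideanSpace ℝ (Fin d)) M) :
    IsAlmostHyperHermitianOn e.target (chartForm e S.g.inner) (chartEnd e S.I) (chartEnd e S.J)
      (chartEnd e S.K) where
  metric := ⟨contDiffOn_chartForm he S.g, fun _ _ => chartForm_symm S _,
    fun _ hy _ hv => chartForm_pos he S hy hv⟩
  contDiffOn_I := contDiffOn_chartEnd he S.contMDiff_I
  contDiffOn_J := contDiffOn_chartEnd he S.contMDiff_J
  contDiffOn_K := contDiffOn_chartEnd he S.contMDiff_K
  triple := fun _ hy => chart_triple he S hy

theorem chartForm_mfderiv (he : e ∈ atlas (EuclideanSpace ℝ (Fin d)) M)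
    (b : (p : M) → TangentSpace 𝓘(ℝ, EuclideanSpace ℝ (Fin d)) p →L[ℝ]
      TangentSpace 𝓘(ℝ, EuclideanSpace ℝ (Fin d)) p →L[ℝ] ℝ) {p : M} (hp : p ∈ e.source)
    (u v : TangentSpace 𝓘(ℝ, EuclideanSpace ℝ (Fin d)) p) :
    chartForm e b (e p)
      (mfderiv 𝓘(ℝ, EuclideanSpace ℝ (Fin d)) 𝓘(ℝ, EuclideanSpace ℝ (Fin d)) e p u)
      (mfderiv 𝓘(ℝ, EuclideanSpace ℝ (Fin d)) 𝓘(ℝ, EuclideanSpace ℝ (Fin d)) e p v) = b p u v := by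
  -- The tangent spaces at `e.symm (e p)` and at `p` are different types. Both are definitionally
  -- the model space, so the equality of base points is eliminated there.
  have h : ∀ (q : M) (_ : q = p) (u' v' u v : EuclideanSpace ℝ (Fin d)), u' = u → v' = v →
      (b q : EuclideanSpace ℝ (Fin d) →L[ℝ] EuclideanSpace ℝ (Fin d) →L[ℝ] ℝ) u' v'
        = (b p : EuclideanSpace ℝ (Fin d) →L[ℝ] EuclideanSpace ℝ (Fin d) →L[ℝ] ℝ) u v := by
    rintro q rfl u' v' u v rfl rfl
    rfl
  exact h _ (e.left_inv hp) _ _ _ _ (chart_mfderiv_symm_mfderiv he hp u)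
    (chart_mfderiv_symm_mfderiv he hp v)

end Chart

end HHqK

end

/-! ### From the charts of the manifold to the local models -/

theorem theorem7 (n : ℕ) (hn : 1 ≤ n) {M : Type*} [TopologicalSpace M]
    [ChartedSpace (EuclideanSpace ℝ (Fin (4 * n))) M]
    [IsManifold 𝓘(ℝ, EuclideanSpace ℝ (Fin (4 * n))) ∞ M]
    (S : HHqK.AlmostHyperHermitian (4 * n) M) (ν : ℝ) (hS : HHqK.IsHHqK n S ν)
    (hclosed : HHqK.HasClosedLeeForm S) (hν : ν < 0) (hnorm : HHqK.LeeFormNormSqEq S (-ν))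
    (p : M) :
    ∃ (V : Set (EuclideanSpace ℝ (Fin (4 * (n - 1)))))
      (g' : EuclideanSpace ℝ (Fin (4 * (n - 1))) → EuclideanSpace ℝ (Fin (4 * (n - 1))) →L[ℝ]
        EuclideanSpace ℝ (Fin (4 * (n - 1))) →L[ℝ] ℝ)
      (I' J' K' : EuclideanSpace ℝ (Fin (4 * (n - 1))) →
        EuclideanSpace ℝ (Fin (4 * (n - 1))) →L[ℝ] EuclideanSpace ℝ (Fin (4 * (n - 1))))
      (α β γ : EuclideanSpace ℝ (Fin (4 * (n - 1))) →
        EuclideanSpace ℝ (Fin (4 * (n - 1))) →L[ℝ] ℝ)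
      (f : OpenPartialHomeomorph M
        (EuclideanSpace ℝ (Fin 4) × EuclideanSpace ℝ (Fin (4 * (n - 1))))),
      IsOpen V ∧ HHqK.IsHyperKahlerOn V g' I' J' K' ∧
      HHqK.IsKahlerPrimitiveOn V g' I' α ∧ HHqK.IsKahlerPrimitiveOn V g' J' β ∧
      HHqK.IsKahlerPrimitiveOn V g' K' γ ∧
      p ∈ f.source ∧ f.target ⊆ HHqK.modelDomain V ∧
      ContMDiffOn 𝓘(ℝ, EuclideanSpace ℝ (Fin (4 * n)))
        𝓘(ℝ, EuclideanSpace ℝ (Fin 4) × EuclideanSpace ℝ (Fin (4 * (n - 1)))) ∞ f f.source ∧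
      ContMDiffOn 𝓘(ℝ, EuclideanSpace ℝ (Fin 4) × EuclideanSpace ℝ (Fin (4 * (n - 1))))
        𝓘(ℝ, EuclideanSpace ℝ (Fin (4 * n))) ∞ f.symm f.target ∧
      ∀ q ∈ f.source, ∀ X Y : TangentSpace 𝓘(ℝ, EuclideanSpace ℝ (Fin (4 * n))) q,
        S.g.inner q X Y = HHqK.modelMetric ν g' α β γ (f q)
          (mfderiv 𝓘(ℝ, EuclideanSpace ℝ (Fin (4 * n)))
            𝓘(ℝ, EuclideanSpace ℝ (Fin 4) × EuclideanSpace ℝ (Fin (4 * (n - 1)))) f q X)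
          (mfderiv 𝓘(ℝ, EuclideanSpace ℝ (Fin (4 * n)))
            𝓘(ℝ, EuclideanSpace ℝ (Fin 4) × EuclideanSpace ℝ (Fin (4 * (n - 1)))) f q Y) := by
  have : NeZero (4 * n) := ⟨by omega⟩
  obtain ⟨e, he, hp⟩ : ∃ e ∈ atlas (EuclideanSpace ℝ (Fin (4 * n))) M, p ∈ e.source :=
    ⟨chartAt _ p, chart_mem_atlas _ p, mem_chart_source _ p⟩
  have h := HHqK.isHHqKOn_of_quaternionicKahler (n := n) (ν := ν) (by simp)
    (S.isAlmostHyperHermitianOn he) e.open_target (hS.quaternionicKahler e he)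
    (hS.integrable_I e he) (hS.integrable_J e he) (hS.integrable_K e he)
    (hS.scalarCurvature_eq e he)
  obtain ⟨W, t, hW, hpW, hWe, hWt⟩ := h.exists_isExactHHqKOn e.open_target hν
    (fun y hy => by
      rw [HHqK.covectorNormSq_neg]
      exact hnorm e he y hy)
    (fun y hy u v => by
      rw [HHqK.extDerivOne_neg, neg_eq_zero]
      exact hclosed e he y hy u v) (e.map_source hp)
  obtain ⟨V, g', I', J', K', α, β, γ, Φ, hV, hK, hα, hβ, hγ, hpΦ, hΦW, hΦV, hΦ, hΦs, hg⟩ :=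
    hWt.exists_local_model (F := EuclideanSpace ℝ (Fin (4 * (n - 1)))) hW
      (by simp only [finrank_euclideanSpace, Fintype.card_fin]; omega) hpW
  have h1 : ContMDiffOn 𝓘(ℝ, EuclideanSpace ℝ (Fin (4 * n)))
      𝓘(ℝ, EuclideanSpace ℝ (Fin (4 * n))) ∞ e e.source :=
    contMDiffOn_of_mem_maximalAtlas (IsManifold.subset_maximalAtlas he)
  have h2 : ContMDiffOn 𝓘(ℝ, EuclideanSpace ℝ (Fin (4 * n)))
      𝓘(ℝ, EuclideanSpace ℝ (Fin (4 * n))) ∞ e.symm e.target :=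
    contMDiffOn_symm_of_mem_maximalAtlas (IsManifold.subset_maximalAtlas he)
  -- The isometry is the chart `e` followed by the inverse of the straightening map `Φ`.
  refine ⟨V, g', I', J', K', α, β, γ, e ≫ₕ Φ.symm, hV, hK, hα, hβ, hγ, ⟨hp, hpΦ⟩,
    fun z hz => hΦV hz.1, ?_, ?_, fun q hq X Y => ?_⟩
  · exact hΦs.contMDiffOn.comp (h1.mono fun q hq => hq.1) fun q hq => hq.2
  · exact h2.comp (hΦ.contMDiffOn.mono fun z hz => hz.1) fun z hz => hz.2
  · have h3 : DifferentiableAt ℝ Φ.symm (e q) :=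
      (hΦs.contDiffAt (Φ.open_target.mem_nhds hq.2)).differentiableAt (by simp)
    have h4 : MDifferentiableAt 𝓘(ℝ, EuclideanSpace ℝ (Fin (4 * n)))
        𝓘(ℝ, EuclideanSpace ℝ (Fin (4 * n))) e q :=
      mdifferentiableAt_atlas he hq.1
    have h5 := mfderiv_comp (I'' := 𝓘(ℝ, EuclideanSpace ℝ (Fin 4) ×
      EuclideanSpace ℝ (Fin (4 * (n - 1))))) q h3.mdifferentiableAt h4
    rw [mfderiv_eq_fderiv] at h5
    rw [← HHqK.chartForm_mfderiv he S.g.inner hq.1 X Y]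
    refine (hg (e q) hq.2 _ _).trans ?_
    rw [OpenPartialHomeomorph.coe_trans, h5]
    rfl
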